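/- Let $d\ge 2$, $\mathcal A=\{1,\dots,d\}$, and let $\boldsymbol\sigma=(\sigma_n)_{n\in\mathbb Z}$ be a bi-infinite sequence of unimodular substitutions over $\mathcal A$, i.e. nonerasing endomorphisms of $\mathcal A^*$ whose incidence matrices $M_{\sigma_n}=(|\sigma_n(b)|_a)_{a,b\in\mathcal A}$ have determinant $\pm1$. For $m\le n$ put $\sigma_{[m,n)}=\sigma_m\cdots\sigma_{n-1}$ and $M_{[m,n)}=M_{\sigma_m}\cdots M_{\sigma_{n-1}}$; let $\boldsymbol\ell(w)=(|w|_a)_{a\in\mathcal A}$ be the abelianization of a word $w$, and write $v\preceq w$ if $v$ is a prefix of $w$. *Generalized eigenvectors.* $\mathbf u\in\mathbb R^d_{\ge0}\setminus\{\mathbf 0\}$ is a generalized right eigenvector if $\bigcap_{n\in\mathbb N}M_{[0,n)}\mathbb R^d_{\ge0}=\mathbb R_{\ge0}\mathbf u$, and $\mathbf v\in\mathbb R^d_{\ge0}\setminus\{\mathbf 0\}$ is a generalized left eigenvector if $\bigcap_{n\in\mathbb N}{}^tM_{[-n,0)}\mathbb R^d_{\ge0}=\mathbb R_{\ge0}\mathbf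 v$. Given these, put $\mathbf u_n=M_{[0,n)}^{-1}\mathbf u$, $\mathbf v_n={}^tM_{[0,n)}\mathbf v$ for $n\ge0$ and $\mathbf u_n=M_{[n,0)}\mathbf u$, $\mathbf v_n={}^tM_{[n,0)}^{-1}\mathbf v$ for $n<0$, and let $\tilde\pi_n\mathbf x=\frac{\langle\mathbf x,\mathbf v_n\rangle}{\langle\mathbf u_n,\mathbf v_n\rangle}\mathbf u_n$ and $\pi_n\mathbf x=\mathbf x-\tilde\pi_n\mathbf x$. *Rauzy fractals and boxes.* The Rauzy fractal $\mathcal R_n$ is the closure of the set of all $\pi_n\boldsymbol\ell(p)$ with $p\preceq\sigma_{[n,m)}(b)$ for infinitely many $m\ge n$, $b\in\mathcal A$; the subtile $\mathcal R_n(a)$ is defined in the same way with the condition $pa\preceq\sigma_{[n,m)}(b)$. Let $\llbracket\mathbf e_a\rrbracket$ be the segment from $\mathbf 0$ to the standard basis vector $\mathbf e_a$, and put $\hat{\mathcal R}_n(a)=\tilde\pi_n\llbracket\mathbf e_a\rrbracket-\mathcal R_n(a)$. Let $E_n=\{(a,p,b)\in\mathcal A\times\mathcal A^*\times\mathcal A: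 pa\preceq\sigma_n(b)\}$ and, for $(a,p,b)\in E_n$, $$\hat{\mathcal R}_n(a,p,b)=\tilde\pi_n\llbracket\mathbf e_a\rrbracket-\big(\pi_n\boldsymbol\ell(p)+M_{\sigma_n}\mathcal R_{n+1}(b)\big).$$ *Hypotheses.* Assume that (1) $\boldsymbol\sigma$ is two-sided primitive: for each $m\in\mathbb Z$ there is $n>m$, and for each $n\in\mathbb Z$ there is $m<n$, such that all entries of $M_{[m,n)}$ are positive; (2) $\boldsymbol\sigma$ satisfies the tiling condition: there are generalized right and left eigenvectors $\mathbf u$, $\mathbf v$ (they are unique up to positive factors, and these do not affect the sets above), and for each $n\in\mathbb Z$ the closed sets $\mathbf x+\hat{\mathcal R}_n(a)$, $(\mathbf x,a)\in\mathbb Z^d\times\mathcal A$, cover $\mathbb R^d$ and any two of them with distinct indices $(\mathbf x,a)$ meet in a set of Lebesgue measure zero; (3) $\mathcal R_n$ is compact for each $n\in\mathbb Z$. *The two systems.* Let $\mathscr B$ be the Bratteli diagram of $\boldsymbol\sigma$: all vertex sets are $\mathcal A$, the edge sets are $E_n$, $n\in\mathbb Z$, and the source and range of $(a,p,b)$ are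 $a$ and $b$. Let $X_{\mathscr B}^{(0)}=\{(e_k)_{k\in\mathbb Z}\in\prod_kE_k: r(e_k)=s(e_{k+1})\text{ for all }k\}$, with the product of the discrete topologies. Let $\Sigma$ be the shift, $X_{\mathscr B}^{(n)}=\Sigma^n(X_{\mathscr B}^{(0)})$ and $X_{\mathscr B}=\coprod_{n}X_{\mathscr B}^{(n)}$. We denote an element of $X_{\mathscr B}^{(n)}$ by the path $(e_k)_{k\in\mathbb Z}$, $e_k\in E_k$, whose $n$-th shift it is. Let $\mathbb T_n=\mathbb R^d/\mathbb Z^d$ for each $n\in\mathbb Z$, $\mathbb T=\coprod_n\mathbb T_n$, and let $f=f_{\boldsymbol\sigma}:\mathbb T\to\mathbb T$ be the mapping family with $f|_{\mathbb T_n}=f_n:\mathbb T_n\to\mathbb T_{n+1}$, $\mathbf x\mapsto M_{\sigma_n}^{-1}\mathbf x$. Let $\lambda$ be the measure on $\mathbb T$ that restricts to normalized Lebesgue measure on each $\mathbb T_n$. Finally let $$D_n=\bigcup_{k\in\mathbb Z}\bigcup_{e\in E_k}f^{n-k}\big(\partial\hat{\mathcal R}_k(e)\bmod\mathbb Z^d\big)\subset\mathbb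 T_n,\qquad D=\coprod_{n\in\mathbb Z}D_n.$$ **Theorem.** Under these hypotheses, for each $n\in\mathbb Z$ and $(e_k)_{k\in\mathbb Z}\in X_{\mathscr B}^{(n)}$ the set $$\bigcap_{\ell\in\mathbb N}\overline{\bigcap_{|k|\le\ell}f^{n-k}\big(\operatorname{int}(\hat{\mathcal R}_k(e_k))\bmod\mathbb Z^d\big)}\subset\mathbb T_n$$ consists of exactly one point. The maps $\psi_n:X_{\mathscr B}^{(n)}\to\mathbb T_n$ that send $(e_k)_{k\in\mathbb Z}$ to this point have the following properties. (i) Each $\psi_n$ is continuous, and it is injective on $X_{\mathscr B}^{(n)}\setminus\psi_n^{-1}(D_n)$. (ii) $\psi_{n+1}\circ\Sigma=f_n\circ\psi_n$ for all $n\in\mathbb Z$. (iii) The map $\varphi:X_{\mathscr B}\to\mathbb T$ that equals $\psi_n$ on $X_{\mathscr B}^{(n)}$ is a measurable conjugacy between $(X_{\mathscr B},\Sigma)$ and $(\mathbb T,f_{\boldsymbol\sigma})$: there is a $\Sigma$-invariant Borel measure $\mu$ on $X_{\mathscr B}$ with $\varphi_*\mu=\lambda$, the measure $\lambda$ is $f_{\boldsymbol\sigma}$-invariant,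 $\varphi\circ\Sigma=f_{\boldsymbol\sigma}\circ\varphi$, and $\varphi$ has a measurable inverse modulo null sets of $\mu$ and $\lambda$. Moreover $\varphi$ is injective on $X_{\mathscr B}\setminus\varphi^{-1}(D)$, and $\lambda(D)=0$. -/

import Mathlib

open MeasureTheory Set

namespace SAdic

noncomputable section

/-! ### Bratteli diagrams, nonstationary edge shifts, measurable conjugacies -/

/-- A bi-infinite Bratteli diagram. The vertices and edges of level `n` are subsets of fixed
carriers `V` and `E`; the same label may be used on several levels, so that the vertex set (edge
set) of the diagram is the disjoint union over `n` of the sets `vertices n` (`edges n`). -/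
structure BratteliDiagram (V E : Type) where
  vertices : ℤ → Set V
  edges : ℤ → Set E
  src : E → V
  rng : E → V
  finite_vertices : ∀ n, (vertices n).Finite
  finite_edges : ∀ n, (edges n).Finite
  image_src : ∀ n, src '' edges n = vertices n
  image_rng : ∀ n, rng '' edges n = vertices (n + 1)

namespace BratteliDiagram

variable {V E : Type} (B : BratteliDiagram V E)

/-- The component of index `n` of the nonstationary edge shift: the bi-infinite paths of the
diagram, shifted `n` times, so that the entry of index `k` is an edge of level `k + n`. -/
def edgeShift (n : ℤ) : Set (ℤ → E) :=
  {ω | ∀ k, ω k ∈ B.edges (k + n) ∧ B.rng (ω k) = B.src (ω (k + 1))}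

theorem mem_edgeShift_zero (e : ℤ → E) :
    e ∈ B.edgeShift 0 ↔ ∀ k, e k ∈ B.edges k ∧ B.rng (e k) = B.src (e (k + 1)) := by
  simp [edgeShift]

/-- The component of index `n` is the image of the one of index `0` under the `n`-th power of
the shift operator. -/
theorem edgeShift_eq_image (n : ℤ) :
    B.edgeShift n = (fun e : ℤ → E => fun k => e (k + n)) '' B.edgeShift 0 := by
  ext ω
  constructor
  · intro h
    refine ⟨fun k => ω (k - n), ?_, by ext k; simp⟩
    rw [mem_edgeShift_zero]
    intro k
    have h1 := h (k - n)
    rw [sub_add_cancel, show k - n + 1 = k + 1 - n by ring] at h1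
    exact h1
  · rintro ⟨e, he, rfl⟩ k
    rw [mem_edgeShift_zero] at he
    have h1 := he (k + n)
    rw [show k + n + 1 = k + 1 + n by ring] at h1
    exact h1

/-- The shift operator, as a map from the component of index `n` to the next one. -/
def shift (n : ℤ) (ω : B.edgeShift n) : B.edgeShift (n + 1) :=
  ⟨fun k => ω.1 (k + 1), fun k => by
    have h1 := ω.2 (k + 1)
    rw [show k + 1 + n = k + (n + 1) by ring] at h1
    exact h1⟩

/-- The total space of the nonstationary edge shift, the disjoint union of its components. -/
abbrev EdgeShiftSpace : Type := Σ n : ℤ, B.edgeShift n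

/-- The shift operator on the total space. -/
def totalShift (x : B.EdgeShiftSpace) : B.EdgeShiftSpace := ⟨x.1 + 1, B.shift x.1 x.2⟩

end BratteliDiagram

/-- `φ` is a measurable conjugacy between the measure preserving systems `(X, S, μ)` and
`(Y, T, ν)`: it is measure preserving, intertwines `S` and `T` almost everywhere, and has a
measurable inverse modulo null sets. -/
structure IsMeasurableConjugacy {X Y : Type} [MeasurableSpace X] [MeasurableSpace Y]
    (S : X → X) (T : Y → Y) (μ : Measure X) (ν : Measure Y) (φ : X → Y) : Prop where
  preserving_source : MeasurePreserving S μ μ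
  preserving_target : MeasurePreserving T ν ν
  preserving_map : MeasurePreserving φ μ ν
  semiconj : ∀ᵐ x ∂μ, φ (S x) = T (φ x)
  inverse : ∃ g : Y → X, Measurable g ∧ (∀ᵐ x ∂μ, g (φ x) = x) ∧ ∀ᵐ y ∂ν, φ (g y) = y

/-! ### Unimodular substitutions -/

/-- A unimodular substitution over the alphabet `Fin d`, given by the images of the letters. -/
structure UnimodularSubstitution (d : ℕ) where
  image : Fin d → List (Fin d)
  nonerasing : ∀ a, image a ≠ []
  unimodular : |(Matrix.of fun a b => ((image b).count a : ℤ)).det| = 1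

variable {d : ℕ}

namespace UnimodularSubstitution

/-- The action of a substitution on words, as an endomorphism of the free monoid. -/
def apply (s : UnimodularSubstitution d) (w : List (Fin d)) : List (Fin d) := w.flatMap s.image

/-- The incidence matrix. -/
def incidence (s : UnimodularSubstitution d) : Matrix (Fin d) (Fin d) ℤ :=
  Matrix.of fun a b => ((s.image b).count a : ℤ)

end UnimodularSubstitution

/-- The abelianization of a word. -/
def abel (w : List (Fin d)) : Fin d → ℝ := fun a => (w.count a : ℝ)

/-- The word `σ_m σ_{m+1} ⋯ σ_{n-1} (b)`, for `m ≤ n`. -/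
def blockWord (σ : ℤ → UnimodularSubstitution d) (m n : ℤ) (b : Fin d) : List (Fin d) :=
  (List.range (n - m).toNat).foldr (fun (i : ℕ) w => (σ (m + i)).apply w) [b]

/-- The matrix product `M_m M_{m+1} ⋯ M_{n-1}` of incidence matrices, for `m ≤ n`. -/
def blockMatrix (σ : ℤ → UnimodularSubstitution d) (m n : ℤ) : Matrix (Fin d) (Fin d) ℤ :=
  ((List.range (n - m).toNat).map fun i : ℕ => (σ (m + i)).incidence).prod

/-- The same product as a real matrix. -/
def blockMatrixReal (σ : ℤ → UnimodularSubstitution d) (m n : ℤ) : Matrix (Fin d) (Fin d) ℝ :=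
  (blockMatrix σ m n).map (Int.cast : ℤ → ℝ)

/-- Primitivity in the future. -/
def IsPrimitive (σ : ℤ → UnimodularSubstitution d) : Prop :=
  ∀ m : ℤ, ∃ n : ℤ, m < n ∧ ∀ i j, 0 < blockMatrix σ m n i j

/-- Primitivity in the past. -/
def IsPrimitiveInPast (σ : ℤ → UnimodularSubstitution d) : Prop :=
  ∀ n : ℤ, ∃ m : ℤ, m < n ∧ ∀ i j, 0 < blockMatrix σ m n i j

/-- Two-sided primitivity. -/
def IsTwoSidedPrimitive (σ : ℤ → UnimodularSubstitution d) : Prop :=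
  IsPrimitive σ ∧ IsPrimitiveInPast σ

/-- `u` is a generalized right eigenvector of `σ`. -/
def IsGeneralizedRightEigenvector (σ : ℤ → UnimodularSubstitution d) (u : Fin d → ℝ) : Prop :=
  0 ≤ u ∧ u ≠ 0 ∧
    ⋂ n : ℕ, (blockMatrixReal σ 0 n).mulVec '' {x | 0 ≤ x} = {y | ∃ c : ℝ, 0 ≤ c ∧ y = c • u}

/-- `v` is a generalized left eigenvector of `σ`. -/
def IsGeneralizedLeftEigenvector (σ : ℤ → UnimodularSubstitution d) (v : Fin d → ℝ) : Prop :=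
  0 ≤ v ∧ v ≠ 0 ∧
    ⋂ n : ℕ, (blockMatrixReal σ (-n) 0).transpose.mulVec '' {x | 0 ≤ x} =
      {y | ∃ c : ℝ, 0 ≤ c ∧ y = c • v}

/-- The generalized right eigenvector `u_n` of the sequence shifted by `n`. -/
def rightVec (σ : ℤ → UnimodularSubstitution d) (u : Fin d → ℝ) (n : ℤ) : Fin d → ℝ :=
  if 0 ≤ n then (blockMatrixReal σ 0 n)⁻¹.mulVec u else (blockMatrixReal σ n 0).mulVec u

/-- The generalized left eigenvector `v_n` of the sequence shifted by `n`. -/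
def leftVec (σ : ℤ → UnimodularSubstitution d) (v : Fin d → ℝ) (n : ℤ) : Fin d → ℝ :=
  if 0 ≤ n then (blockMatrixReal σ 0 n).transpose.mulVec v
  else (blockMatrixReal σ n 0).transpose⁻¹.mulVec v

/-- The projection along the line `ℝ u` onto the hyperplane orthogonal to `v`. -/
def projHyp (u v x : Fin d → ℝ) : Fin d → ℝ := x - (x ⬝ᵥ v / u ⬝ᵥ v) • u

/-- The projection along the hyperplane orthogonal to `v` onto the line `ℝ u`. -/
def projLine (u v x : Fin d → ℝ) : Fin d → ℝ := (x ⬝ᵥ v / u ⬝ᵥ v) • u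

/-! ### Rauzy fractals and Rauzy boxes

Everything below is relative to a generalized right eigenvector `u` and a generalized left
eigenvector `v`; multiplying these by positive constants changes none of the sets. -/

section Rauzy

variable (σ : ℤ → UnimodularSubstitution d) (u v : Fin d → ℝ)

/-- The projection `π_n`. -/
def piLevel (n : ℤ) : (Fin d → ℝ) → (Fin d → ℝ) := projHyp (rightVec σ u n) (leftVec σ v n)

/-- The complementary projection `π̃_n`. -/
def piTildeLevel (n : ℤ) : (Fin d → ℝ) → (Fin d → ℝ) :=
  projLine (rightVec σ u n) (leftVec σ v n)

/-- The Rauzy fractal of level `n`. -/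
def rauzyFractal (n : ℤ) : Set (Fin d → ℝ) :=
  closure {y | ∃ p : List (Fin d),
    {m : ℤ | n ≤ m ∧ ∃ b, p <+: blockWord σ n m b}.Infinite ∧ y = piLevel σ u v n (abel p)}

/-- The subtile of the letter `a` of the Rauzy fractal of level `n`. -/
def rauzySubtile (n : ℤ) (a : Fin d) : Set (Fin d → ℝ) :=
  closure {y | ∃ p : List (Fin d),
    {m : ℤ | n ≤ m ∧ ∃ b, (p ++ [a]) <+: blockWord σ n m b}.Infinite ∧
      y = piLevel σ u v n (abel p)}

/-- The segment from the origin to the standard basis vector of the letter `a`. -/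
def letterSegment (a : Fin d) : Set (Fin d → ℝ) := segment ℝ 0 (Pi.single a 1)

/-- The Rauzy box of level `n` of the letter `a`. -/
def rauzyBox (n : ℤ) (a : Fin d) : Set (Fin d → ℝ) :=
  image2 (fun s r => s - r) (piTildeLevel σ u v n '' letterSegment a) (rauzySubtile σ u v n a)

/-- A family of subsets is a tiling: closed sets that cover the space, such that any two members
of distinct index meet in a Lebesgue null set. -/
def IsTiling {ι : Type} (T : ι → Set (Fin d → ℝ)) : Prop :=
  (∀ i, IsClosed (T i)) ∧ ⋃ i, T i = univ ∧ ∀ i j, i ≠ j → volume (T i ∩ T j) = 0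

/-- The tiling condition: `σ` is primitive with generalized eigenvectors `u` and `v`, and at each
level the translates of the Rauzy boxes by integer vectors form a tiling. -/
def TilingCondition : Prop :=
  IsPrimitive σ ∧ IsGeneralizedRightEigenvector σ u ∧ IsGeneralizedLeftEigenvector σ v ∧
    ∀ n : ℤ, IsTiling fun i : (Fin d → ℤ) × Fin d =>
      (fun y : Fin d → ℝ => (fun j => (i.1 j : ℝ)) + y) '' rauzyBox σ u v n i.2

end Rauzy

/-! ### The Bratteli diagram of a sequence of substitutions -/

/-- A triple `(a, p, b)` of a letter, a word and a letter. -/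
@[ext]
structure PrefixEdge (d : ℕ) where
  src : Fin d
  word : List (Fin d)
  rng : Fin d

/-- Edge labels carry the discrete topology. -/
instance : TopologicalSpace (PrefixEdge d) := ⊥

instance : DiscreteTopology (PrefixEdge d) := ⟨rfl⟩

/-- Edge labels carry the discrete σ-algebra. -/
instance : MeasurableSpace (PrefixEdge d) := ⊤

/-- The edges of a substitution: the triples `(a, p, b)` such that `p a` is a prefix of the image
of `b`. -/
def edgeSet (s : UnimodularSubstitution d) : Set (PrefixEdge d) :=
  {e | (e.word ++ [e.src]) <+: s.image e.rng}

theorem edgeSet_finite (s : UnimodularSubstitution d) : (edgeSet s).Finite := by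
  have h : (⋃ a : Fin d, ⋃ b : Fin d, ⋃ w ∈ {w | w ∈ (s.image b).inits},
      ({PrefixEdge.mk a w b} : Set (PrefixEdge d))).Finite := by
    refine finite_iUnion fun a => finite_iUnion fun b => ?_
    exact (List.finite_toSet _).biUnion fun _ _ => finite_singleton _
  refine h.subset fun e he => ?_
  simp only [mem_iUnion]
  refine ⟨e.src, e.rng, e.word, ?_, rfl⟩
  change e.word ∈ (s.image e.rng).inits
  rw [List.mem_inits]
  exact (List.prefix_append _ _).trans he

theorem exists_edge_of_src (s : UnimodularSubstitution d) (a : Fin d) :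
    ∃ e ∈ edgeSet s, e.src = a := by
  by_cases h : ∃ b, a ∈ s.image b
  · obtain ⟨b, hb⟩ := h
    obtain ⟨p, q, hpq⟩ := List.append_of_mem hb
    refine ⟨⟨a, p, b⟩, ?_, rfl⟩
    change (p ++ [a]) <+: s.image b
    rw [hpq]
    exact ⟨q, by simp⟩
  · exfalso
    push Not at h
    have h0 : (Matrix.of fun a b => ((s.image b).count a : ℤ)).det = 0 :=
      Matrix.det_eq_zero_of_row_eq_zero a fun b => by
        simp [List.count_eq_zero_of_not_mem (h b)]
    have h1 := s.unimodular
    rw [h0] at h1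
    simp at h1

theorem exists_edge_of_rng (s : UnimodularSubstitution d) (b : Fin d) :
    ∃ e ∈ edgeSet s, e.rng = b := by
  obtain ⟨a, q, hq⟩ := List.exists_cons_of_ne_nil (s.nonerasing b)
  refine ⟨⟨a, [], b⟩, ?_, rfl⟩
  change ([] ++ [a]) <+: s.image b
  rw [hq]
  exact ⟨q, by simp⟩

/-- The Bratteli diagram of a sequence of substitutions. -/
def bratteli (σ : ℤ → UnimodularSubstitution d) : BratteliDiagram (Fin d) (PrefixEdge d) where
  vertices _ := univ
  edges n := edgeSet (σ n)
  src := PrefixEdge.src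
  rng := PrefixEdge.rng
  finite_vertices _ := finite_univ
  finite_edges n := edgeSet_finite (σ n)
  image_src n := eq_univ_of_forall fun a => exists_edge_of_src (σ n) a
  image_rng n := eq_univ_of_forall fun b => exists_edge_of_rng (σ n) b

section EdgeBoxes

variable (σ : ℤ → UnimodularSubstitution d) (u v : Fin d → ℝ)

/-- The subtile `π_n ℓ(p) + M_{σ_n} R_{n+1}(b)` of an edge `(a, p, b)` of level `n`. -/
def edgeSubtile (n : ℤ) (e : PrefixEdge d) : Set (Fin d → ℝ) :=
  (fun y => piLevel σ u v n (abel e.word) +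
    ((σ n).incidence.map (Int.cast : ℤ → ℝ)).mulVec y) '' rauzySubtile σ u v (n + 1) e.rng

/-- The Rauzy box of an edge `(a, p, b)` of level `n`. -/
def edgeBox (n : ℤ) (e : PrefixEdge d) : Set (Fin d → ℝ) :=
  image2 (fun s r => s - r) (piTildeLevel σ u v n '' letterSegment e.src) (edgeSubtile σ u v n e)

end EdgeBoxes

/-! ### The mapping family on tori -/

/-- The projection from `ℝ^d` onto the torus `ℝ^d / ℤ^d`. -/
def toTorus (x : Fin d → ℝ) : UnitAddTorus (Fin d) := fun i => (x i : UnitAddCircle)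

/-- The action of an integer matrix on the torus. -/
def torusAct (M : Matrix (Fin d) (Fin d) ℤ) (x : UnitAddTorus (Fin d)) : UnitAddTorus (Fin d) :=
  fun i => ∑ j, M i j • x j

/-- The map `f_n` from the torus of level `n` to the torus of level `n + 1`, given by the inverse
of the incidence matrix. -/
def familyMap (σ : ℤ → UnimodularSubstitution d) (n : ℤ) :
    UnitAddTorus (Fin d) → UnitAddTorus (Fin d) :=
  torusAct (σ n).incidence⁻¹

/-- The power `f^{n-k}` of the mapping family, from the torus of level `k` to that of level `n`. -/
def familyIter (σ : ℤ → UnimodularSubstitution d) (k n : ℤ) :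
    UnitAddTorus (Fin d) → UnitAddTorus (Fin d) :=
  if n ≤ k then torusAct (blockMatrix σ n k) else torusAct (blockMatrix σ k n)⁻¹

/-- The total space of the mapping family, a disjoint union of tori. -/
abbrev TorusSpace (d : ℕ) : Type := Σ _ : ℤ, UnitAddTorus (Fin d)

/-- The mapping family as a self-map of the total space. -/
def totalFamilyMap (σ : ℤ → UnimodularSubstitution d) (x : TorusSpace d) : TorusSpace d :=
  ⟨x.1 + 1, familyMap σ x.1 x.2⟩

/-- Lebesgue measure on the total space, with total mass one on each torus. -/
def torusMeasure (d : ℕ) : Measure (TorusSpace d) :=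
  Measure.sum fun n : ℤ =>
    (volume : Measure (UnitAddTorus (Fin d))).map fun x => (⟨n, x⟩ : TorusSpace d)

section Coding

variable (σ : ℤ → UnimodularSubstitution d) (u v : Fin d → ℝ)

/-- The intersection over all `ℓ` of the closures of the intersections over `|k| ≤ ℓ` of the sets
`f^{n-k}(int R̂_k(e_k))`, in the torus of level `n`. Here `e` is the path in the Bratteli diagram
whose `n`-th shift is `ω`, i.e. `e_k = ω_{k-n}`. -/
def codedSet (n : ℤ) (ω : ℤ → PrefixEdge d) : Set (UnitAddTorus (Fin d)) :=
  ⋂ l : ℕ, closure (⋂ k ∈ {k : ℤ | |k| ≤ l},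
    familyIter σ k n '' (toTorus '' interior (edgeBox σ u v k (ω (k - n)))))

/-- The union of the images in the torus of level `n`, under the powers of the mapping family, of
the boundaries of the Rauzy boxes of all edges of all levels. -/
def boundarySet (n : ℤ) : Set (UnitAddTorus (Fin d)) :=
  ⋃ k : ℤ, ⋃ e ∈ edgeSet (σ k), familyIter σ k n '' (toTorus '' frontier (edgeBox σ u v k e))

/-- The same set on the total space. -/
def totalBoundarySet : Set (TorusSpace d) := {x | x.2 ∈ boundarySet σ u v x.1}

end Coding

/-- The map between total spaces given by a family of maps of the components. -/
def totalCoding (σ : ℤ → UnimodularSubstitution d)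
    (ψ : ∀ n : ℤ, (bratteli σ).edgeShift n → UnitAddTorus (Fin d))
    (x : (bratteli σ).EdgeShiftSpace) : TorusSpace d := ⟨x.1, ψ x.1 x.2⟩

end

end SAdic

namespace SAdic

/-! ### Words, their abelianizations, and products of incidence matrices -/

section Words

variable {d : ℕ}

/-! For an edge e = (a, p, b) of level n, the affine map x ↦ M_{σ_n}⁻¹(x + ℓ(p)) is a lift of f_n
and sends the edge box of e into the Rauzy box of b at level n + 1. In the coordinates x =
(t/⟨u,v⟩)u_n − y, the coordinate t moves to t + ⟨ℓ(p), v_n⟩ and y = π_n ℓ(p) + M_{σ_n} y' moves to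
y'. Thus the edge boxes form a Markov partition, and the proof is the coding argument for such
partitions.

Existence. The Rauzy boxes have nonempty interior, by Baire and primitivity. Pulling an interior
back along a finite path gives an orbit that follows this path through the interiors of its edge
boxes (`CodingHypotheses.exists_orbit`). The closed cylinders are then nonempty, and compactness
gives a coded point.

Uniqueness. The tiling property pins down the integer ambiguity between successive lifts, so two
orbits with the same edges differ by vectors related by the linear maps M_{σ_k}. Such a difference
is small (`CodingHypotheses.exists_norm_sub_le`). Its component along u_n is measured by v_{n−L},
which tends to zero as L grows. Its component in the hyperplane is the image under M_{[n,n+L)} of a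
difference of two points of a Rauzy fractal of level n + L. The bound is uniform over paths, so it
also gives continuity.

The hard point is that M_{[n,m)} contracts the fractals of level m as m → ∞
(`exists_forall_norm_iterMat_mulVec_le`). The coordinates of π_n ℓ are additive functions of words,
bounded on the prefixes of a limit word because the fractal is compact. Near-maximality on some
factor makes such a function almost constant on the prefixes of high level that precede a given
letter. If its values on prefixes did not tend to zero, they would omit an interval, and counting
crossings of this gap would give a nonzero integer vector orthogonal to some u_m. The tiling forbids
that: pairing with such a vector takes integer values on all tiles, hence on ℝ^d
(`eq_zero_of_dotProduct_rightVec`).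

Conjugacy. Box boundaries are null, because they are covered by overlaps of distinct tiles. Outside
the null set D a point lies in the interior of exactly one edge box at each level, and these edges
form its unique code. This gives a measurable inverse of the coding map, and μ is the image of
Lebesgue measure under it. -/

theorem UnimodularSubstitution.apply_append (s : UnimodularSubstitution d) (w w' : List (Fin d)) :
    s.apply (w ++ w') = s.apply w ++ s.apply w' := by
  simp [UnimodularSubstitution.apply]

theorem UnimodularSubstitution.apply_singleton (s : UnimodularSubstitution d) (b : Fin d) :
    s.apply [b] = s.image b := by
  simp [UnimodularSubstitution.apply]

theorem UnimodularSubstitution.length_le_apply (s : UnimodularSubstitution d)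
    (w : List (Fin d)) : w.length ≤ (s.apply w).length := by
  induction w with
  | nil => simp
  | cons a w ih =>
    have h : s.apply (a :: w) = s.image a ++ s.apply w := by
      simp [UnimodularSubstitution.apply]
    have h1 := List.length_pos_iff.2 (s.nonerasing a)
    simp only [h, List.length_append, List.length_cons]
    omega

/-- The real incidence matrix of a substitution. -/
noncomputable def incR (s : UnimodularSubstitution d) : Matrix (Fin d) (Fin d) ℝ :=
  s.incidence.map (Int.cast : ℤ → ℝ)

theorem abel_append (w w' : List (Fin d)) : abel (w ++ w') = abel w + abel w' := by
  ext a; simp [abel]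

theorem abel_nil : abel ([] : List (Fin d)) = 0 := by
  ext a; simp [abel]

theorem abel_singleton (b : Fin d) : abel [b] = Pi.single b 1 := by
  ext a
  by_cases h : a = b
  · subst h; simp [abel]
  · simp [abel, h, Ne.symm h]

theorem abel_apply (s : UnimodularSubstitution d) (w : List (Fin d)) :
    abel (s.apply w) = (incR s).mulVec (abel w) := by
  induction w with
  | nil => simp [UnimodularSubstitution.apply, abel_nil]
  | cons b w ih =>
    rw [show b :: w = [b] ++ w from rfl, s.apply_append, abel_append, abel_append,
      Matrix.mulVec_add, ih, s.apply_singleton, abel_singleton, Matrix.mulVec_single_one]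
    ext a
    simp [abel, incR, UnimodularSubstitution.incidence]

theorem sum_abel (w : List (Fin d)) : ∑ a, abel w a = w.length := by
  induction w with
  | nil => simp [abel_nil]
  | cons b w ih =>
    rw [show b :: w = [b] ++ w from rfl, abel_append, abel_singleton]
    simp [Finset.sum_add_distrib, ih, add_comm]

theorem abel_nonneg (w : List (Fin d)) : 0 ≤ abel w := fun a => by simp [abel]

/-- The image of a word under `σ_n σ_{n+1} ⋯ σ_{n+j-1}`. -/
def iterWord (σ : ℤ → UnimodularSubstitution d) : ℤ → ℕ → List (Fin d) → List (Fin d)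
  | _, 0, w => w
  | n, j + 1, w => (σ n).apply (iterWord σ (n + 1) j w)

/-- The real matrix product `M_n M_{n+1} ⋯ M_{n+j-1}`. -/
noncomputable def iterMat (σ : ℤ → UnimodularSubstitution d) :
    ℤ → ℕ → Matrix (Fin d) (Fin d) ℝ
  | _, 0 => 1
  | n, j + 1 => incR (σ n) * iterMat σ (n + 1) j

variable (σ : ℤ → UnimodularSubstitution d)

theorem blockWord_add (n : ℤ) (j : ℕ) (b : Fin d) :
    blockWord σ n (n + j) b = iterWord σ n j [b] := by
  unfold blockWord
  rw [show (n + j - n).toNat = j by omega]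
  induction j generalizing n with
  | zero => simp [iterWord]
  | succ j ih =>
    rw [List.range_succ_eq_map, List.foldr_cons, List.foldr_map, iterWord, ← ih]
    simp only [Nat.cast_zero, add_zero, Nat.cast_succ]
    congr 2
    ext i w : 2
    rw [show n + ((i : ℤ) + 1) = n + 1 + i by ring]

theorem blockMatrix_self_add_succ (n : ℤ) (j : ℕ) :
    blockMatrix σ n (n + (j + 1 : ℕ)) =
      (σ n).incidence * blockMatrix σ (n + 1) (n + 1 + j) := by
  unfold blockMatrix
  rw [show (n + (j + 1 : ℕ) - n).toNat = j + 1 by omega,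
    show (n + 1 + j - (n + 1)).toNat = j by omega, List.range_succ_eq_map, List.map_cons,
    List.prod_cons, List.map_map]
  simp only [Nat.cast_zero, add_zero]
  congr 3
  ext i : 1
  simp only [Function.comp, Nat.cast_succ]
  rw [show n + ((i : ℤ) + 1) = n + 1 + i by ring]

theorem blockMatrix_self (n : ℤ) : blockMatrix σ n n = 1 := by
  simp [blockMatrix]

theorem blockMatrix_succ_right {n m : ℤ} (h : n ≤ m) :
    blockMatrix σ n (m + 1) = blockMatrix σ n m * (σ m).incidence := by
  unfold blockMatrix
  rw [show (m + 1 - n).toNat = (m - n).toNat + 1 by omega, List.range_succ, List.map_append,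
    List.prod_append]
  simp only [List.map_cons, List.map_nil, List.prod_cons, List.prod_nil, mul_one]
  rw [show n + ((m - n).toNat : ℤ) = m by omega]

theorem blockMatrix_succ_left {n m : ℤ} (h : n < m) :
    blockMatrix σ n m = (σ n).incidence * blockMatrix σ (n + 1) m := by
  obtain ⟨j, rfl⟩ : ∃ j : ℕ, m = n + (j + 1 : ℕ) := ⟨(m - n - 1).toNat, by push_cast; omega⟩
  rw [blockMatrix_self_add_succ]
  congr 2
  push_cast; ring

theorem blockMatrixReal_add (n : ℤ) (j : ℕ) : blockMatrixReal σ n (n + j) = iterMat σ n j := by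
  induction j generalizing n with
  | zero => simp [blockMatrixReal, blockMatrix_self, iterMat]
  | succ j ih =>
    rw [iterMat, ← ih, blockMatrixReal, blockMatrix_self_add_succ]
    exact Matrix.map_mul_intCast _ _

theorem iterWord_append (n : ℤ) (j : ℕ) (w w' : List (Fin d)) :
    iterWord σ n j (w ++ w') = iterWord σ n j w ++ iterWord σ n j w' := by
  induction j generalizing n with
  | zero => rfl
  | succ j ih => simp only [iterWord, ih, UnimodularSubstitution.apply_append]

theorem iterWord_add (n : ℤ) (i j : ℕ) (w : List (Fin d)) :
    iterWord σ n (i + j) w = iterWord σ n i (iterWord σ (n + i) j w) := by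
  induction i generalizing n with
  | zero => simp [iterWord]
  | succ i ih =>
    rw [show i + 1 + j = (i + j) + 1 by ring, iterWord, iterWord, ih]
    rw [show n + 1 + (i : ℤ) = n + ((i + 1 : ℕ) : ℤ) by push_cast; ring]

theorem abel_iterWord (n : ℤ) (j : ℕ) (w : List (Fin d)) :
    abel (iterWord σ n j w) = (iterMat σ n j).mulVec (abel w) := by
  induction j generalizing n with
  | zero => simp [iterWord, iterMat]
  | succ j ih => rw [iterWord, iterMat, abel_apply, ih, Matrix.mulVec_mulVec]

theorem length_le_iterWord (n : ℤ) (j : ℕ) (w : List (Fin d)) :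
    w.length ≤ (iterWord σ n j w).length := by
  induction j generalizing n with
  | zero => exact le_rfl
  | succ j ih => exact (ih _).trans ((σ n).length_le_apply _)

theorem iterWord_prefix {w w' : List (Fin d)} (h : w <+: w') (n : ℤ) (j : ℕ) :
    iterWord σ n j w <+: iterWord σ n j w' := by
  obtain ⟨t, rfl⟩ := h
  rw [iterWord_append]
  exact List.prefix_append _ _

theorem UnimodularSubstitution.apply_prefix (s : UnimodularSubstitution d) {w w' : List (Fin d)}
    (h : w <+: w') : s.apply w <+: s.apply w' := by
  obtain ⟨t, rfl⟩ := h
  rw [s.apply_append]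
  exact List.prefix_append _ _

theorem isUnit_det_incidence (s : UnimodularSubstitution d) : IsUnit s.incidence.det :=
  Int.isUnit_iff_abs_eq.2 s.unimodular

theorem isUnit_det_blockMatrix (n m : ℤ) : IsUnit (blockMatrix σ n m).det := by
  unfold blockMatrix
  induction List.range (m - n).toNat with
  | nil => simp
  | cons a l ih =>
    rw [List.map_cons, List.prod_cons, Matrix.det_mul]
    exact (isUnit_det_incidence _).mul ih

theorem isUnit_det_incR (s : UnimodularSubstitution d) : IsUnit (incR s).det := by
  have h := (isUnit_det_incidence s).map (Int.castRingHom ℝ)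
  rwa [RingHom.map_det] at h

theorem incR_nonneg (s : UnimodularSubstitution d) (a b : Fin d) : 0 ≤ incR s a b := by
  simp [incR, UnimodularSubstitution.incidence]

theorem one_le_incR_of_mem (s : UnimodularSubstitution d) {a b : Fin d} (h : a ∈ s.image b) :
    1 ≤ incR s a b := by
  have := List.count_pos_iff.2 h
  simp only [incR, UnimodularSubstitution.incidence, Matrix.map_apply, Matrix.of_apply]
  exact_mod_cast this

theorem exists_mem_image_row (s : UnimodularSubstitution d) (a : Fin d) : ∃ b, a ∈ s.image b := by
  obtain ⟨e, he, rfl⟩ := exists_edge_of_src s a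
  exact ⟨e.rng, List.IsPrefix.subset he (by simp)⟩

theorem exists_mem_image_col (s : UnimodularSubstitution d) (b : Fin d) : ∃ a, a ∈ s.image b :=
  List.exists_mem_of_ne_nil _ (s.nonerasing b)

theorem iterMat_eq_count (n : ℤ) (j : ℕ) (a b : Fin d) :
    iterMat σ n j a b = ((iterWord σ n j [b]).count a : ℝ) := by
  have h := congrFun (abel_iterWord σ n j [b]) a
  rw [abel_singleton, Matrix.mulVec_single_one] at h
  exact h.symm

theorem mem_iterWord_iff (n : ℤ) (j : ℕ) (a b : Fin d) :
    a ∈ iterWord σ n j [b] ↔ 0 < iterMat σ n j a b := by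
  rw [iterMat_eq_count, ← List.count_pos_iff]
  simp

/-- A positive block of matrices remains positive when it is extended to the right. -/
theorem mem_iterWord_of_le {n : ℤ} {j : ℕ} (h : ∀ a b, a ∈ iterWord σ n j [b]) {k : ℕ}
    (hjk : j ≤ k) (a b : Fin d) : a ∈ iterWord σ n k [b] := by
  obtain ⟨i, rfl⟩ := Nat.exists_eq_add_of_le hjk
  rw [iterWord_add]
  have h0 : iterWord σ (n + j) i [b] ≠ [] := by
    have := length_le_iterWord σ (n + j) i [b]
    intro h
    simp [h] at this
  obtain ⟨c, w, hc⟩ := List.exists_cons_of_ne_nil h0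
  rw [hc, show c :: w = [c] ++ w from rfl, iterWord_append]
  exact List.mem_append_left _ (h a c)

theorem exists_mem_iterWord (hp : IsPrimitive σ) (n : ℤ) :
    ∃ j : ℕ, 0 < j ∧ ∀ a b, a ∈ iterWord σ n j [b] := by
  obtain ⟨m, hm, h⟩ := hp n
  obtain ⟨j, rfl⟩ : ∃ j : ℕ, m = n + j := ⟨(m - n).toNat, by omega⟩
  refine ⟨j, by omega, fun a b => ?_⟩
  rw [mem_iterWord_iff, ← blockMatrixReal_add]
  simpa [blockMatrixReal] using h a b

theorem exists_mem_iterWord_past (hp : IsPrimitiveInPast σ) (n : ℤ) :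
    ∃ j : ℕ, 0 < j ∧ ∀ a b, a ∈ iterWord σ (n - j) j [b] := by
  obtain ⟨m, hm, h⟩ := hp n
  obtain ⟨j, rfl⟩ : ∃ j : ℕ, n = m + j := ⟨(n - m).toNat, by omega⟩
  refine ⟨j, by omega, fun a b => ?_⟩
  rw [mem_iterWord_iff, add_sub_cancel_right, ← blockMatrixReal_add]
  simpa [blockMatrixReal] using h a b

end Words

/-! ### Generalized eigenvectors: equivariance, positivity, decay -/

section Vectors

variable {d : ℕ} (σ : ℤ → UnimodularSubstitution d) (u v : Fin d → ℝ)

theorem isUnit_det_blockMatrixReal (n m : ℤ) : IsUnit (blockMatrixReal σ n m).det := by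
  have h := (isUnit_det_blockMatrix σ n m).map (Int.castRingHom ℝ)
  rwa [RingHom.map_det] at h

theorem blockMatrixReal_succ_right {n m : ℤ} (h : n ≤ m) :
    blockMatrixReal σ n (m + 1) = blockMatrixReal σ n m * incR (σ m) := by
  rw [blockMatrixReal, blockMatrix_succ_right σ h]
  exact Matrix.map_mul_intCast _ _

theorem blockMatrixReal_succ_left {n m : ℤ} (h : n < m) :
    blockMatrixReal σ n m = incR (σ n) * blockMatrixReal σ (n + 1) m := by
  rw [blockMatrixReal, blockMatrix_succ_left σ h]
  exact Matrix.map_mul_intCast _ _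

theorem blockMatrixReal_self (n : ℤ) : blockMatrixReal σ n n = 1 := by
  simp [blockMatrixReal, blockMatrix_self]

theorem incR_mulVec_rightVec (n : ℤ) :
    (incR (σ n)).mulVec (rightVec σ u (n + 1)) = rightVec σ u n := by
  rcases lt_trichotomy n (-1) with h | rfl | h
  · rw [rightVec, rightVec, if_neg (by omega), if_neg (by omega), Matrix.mulVec_mulVec,
      ← blockMatrixReal_succ_left σ (by omega)]
  · rw [rightVec, rightVec, if_pos (by omega), if_neg (by omega),
      blockMatrixReal_succ_left σ (by omega : (-1 : ℤ) < 0)]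
    norm_num [blockMatrixReal_self]
  · rw [rightVec, rightVec, if_pos (by omega), if_pos (by omega),
      blockMatrixReal_succ_right σ (by omega), Matrix.mul_inv_rev, Matrix.mulVec_mulVec,
      ← mul_assoc, Matrix.mul_nonsing_inv _ (isUnit_det_incR _), one_mul]

theorem incR_transpose_mulVec_leftVec (n : ℤ) :
    (incR (σ n)).transpose.mulVec (leftVec σ v n) = leftVec σ v (n + 1) := by
  have hu : IsUnit (incR (σ n)).transpose.det := by
    rw [Matrix.det_transpose]; exact isUnit_det_incR _
  rcases lt_trichotomy n (-1) with h | rfl | h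
  · rw [leftVec, leftVec, if_neg (by omega), if_neg (by omega),
      blockMatrixReal_succ_left σ (by omega : n < 0), Matrix.transpose_mul, Matrix.mul_inv_rev,
      Matrix.mulVec_mulVec, ← mul_assoc, Matrix.mul_nonsing_inv _ hu, one_mul]
  · rw [leftVec, leftVec, if_neg (by omega), if_pos (by omega),
      blockMatrixReal_succ_left σ (by omega : (-1 : ℤ) < 0)]
    norm_num [blockMatrixReal_self, Matrix.mul_nonsing_inv _ hu]
  · rw [leftVec, leftVec, if_pos (by omega), if_pos (by omega),
      blockMatrixReal_succ_right σ (by omega), Matrix.transpose_mul, Matrix.mulVec_mulVec]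

theorem iterMat_mulVec_rightVec (n : ℤ) (j : ℕ) :
    (iterMat σ n j).mulVec (rightVec σ u (n + j)) = rightVec σ u n := by
  induction j generalizing n with
  | zero => simp [iterMat]
  | succ j ih =>
    rw [iterMat, ← Matrix.mulVec_mulVec,
      show n + ((j + 1 : ℕ) : ℤ) = n + 1 + j by push_cast; ring, ih, incR_mulVec_rightVec]

/-- The pairing with the left eigenvectors is equivariant. -/
theorem incR_mulVec_dotProduct_leftVec (n : ℤ) (x : Fin d → ℝ) :
    (incR (σ n)).mulVec x ⬝ᵥ leftVec σ v n = x ⬝ᵥ leftVec σ v (n + 1) := by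
  rw [← incR_transpose_mulVec_leftVec, Matrix.dotProduct_mulVec, Matrix.vecMul_transpose]

theorem iterMat_mulVec_dotProduct_leftVec (n : ℤ) (j : ℕ) (x : Fin d → ℝ) :
    (iterMat σ n j).mulVec x ⬝ᵥ leftVec σ v n = x ⬝ᵥ leftVec σ v (n + j) := by
  induction j generalizing n with
  | zero => simp [iterMat]
  | succ j ih =>
    rw [iterMat, ← Matrix.mulVec_mulVec, incR_mulVec_dotProduct_leftVec, ih,
      show n + ((j + 1 : ℕ) : ℤ) = n + 1 + j by push_cast; ring]

theorem rightVec_dotProduct_leftVec_succ (n : ℤ) :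
    rightVec σ u (n + 1) ⬝ᵥ leftVec σ v (n + 1) = rightVec σ u n ⬝ᵥ leftVec σ v n := by
  rw [← incR_mulVec_dotProduct_leftVec, incR_mulVec_rightVec]

theorem rightVec_dotProduct_leftVec (n : ℤ) :
    rightVec σ u n ⬝ᵥ leftVec σ v n = u ⬝ᵥ v := by
  have h0 : rightVec σ u 0 ⬝ᵥ leftVec σ v 0 = u ⬝ᵥ v := by
    simp [rightVec, leftVec, blockMatrixReal_self]
  rw [← h0]
  induction n using Int.induction_on with
  | zero => rfl
  | succ n ih => rw [rightVec_dotProduct_leftVec_succ, ih]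
  | pred n ih =>
    rw [← ih, ← rightVec_dotProduct_leftVec_succ, sub_add_cancel]

theorem incR_mulVec_nonneg (s : UnimodularSubstitution d) {x : Fin d → ℝ} (hx : 0 ≤ x) :
    0 ≤ (incR s).mulVec x := fun a => show 0 ≤ ∑ b, incR s a b * x b from
  Finset.sum_nonneg fun b _ => mul_nonneg (incR_nonneg s a b) (hx b)

theorem incR_transpose_mulVec_nonneg (s : UnimodularSubstitution d) {x : Fin d → ℝ}
    (hx : 0 ≤ x) : 0 ≤ (incR s).transpose.mulVec x := fun a => show 0 ≤ ∑ b, incR s b a * x b from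
  Finset.sum_nonneg fun b _ => mul_nonneg (incR_nonneg s b a) (hx b)

variable {σ u v}

/-- At levels n ≥ 0, `u` lies in the cone M_{[0,n)} ℝ^d_{≥0}, and u_n is its unique preimage under
an invertible matrix. Negative levels follow by applying nonnegative matrices. -/
theorem IsGeneralizedRightEigenvector.rightVec_nonneg (hu : IsGeneralizedRightEigenvector σ u)
    (n : ℤ) : 0 ≤ rightVec σ u n := by
  have hpos : ∀ j : ℕ, 0 ≤ rightVec σ u j := by
    intro j
    have h1 : u ∈ ⋂ n : ℕ, (blockMatrixReal σ 0 n).mulVec '' {x | 0 ≤ x} := by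
      rw [hu.2.2]; exact ⟨1, zero_le_one, by simp⟩
    obtain ⟨x, hx, hxu⟩ := mem_iInter.1 h1 j
    rw [rightVec, if_pos (by omega), ← hxu, Matrix.mulVec_mulVec,
      Matrix.nonsing_inv_mul _ (isUnit_det_blockMatrixReal σ 0 j), Matrix.one_mulVec]
    exact hx
  induction n using Int.induction_on with
  | zero => exact_mod_cast hpos 0
  | succ n ih => exact_mod_cast hpos (n + 1)
  | pred n ih =>
    rw [← incR_mulVec_rightVec, sub_add_cancel]
    exact incR_mulVec_nonneg _ ih

theorem IsGeneralizedLeftEigenvector.leftVec_nonneg (hv : IsGeneralizedLeftEigenvector σ v)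
    (n : ℤ) : 0 ≤ leftVec σ v n := by
  have h0 : leftVec σ v 0 = v := by simp [leftVec, blockMatrixReal_self]
  have hneg : ∀ j : ℕ, 0 ≤ leftVec σ v (-j) := by
    intro j
    rcases Nat.eq_zero_or_pos j with rfl | hj
    · simpa [h0] using hv.1
    have h1 : v ∈ ⋂ n : ℕ, (blockMatrixReal σ (-n) 0).transpose.mulVec '' {x | 0 ≤ x} := by
      rw [hv.2.2]; exact ⟨1, zero_le_one, by simp⟩
    obtain ⟨x, hx, hxv⟩ := mem_iInter.1 h1 j
    have hdet : IsUnit (blockMatrixReal σ (-j) 0).transpose.det := by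
      rw [Matrix.det_transpose]; exact isUnit_det_blockMatrixReal _ _ _
    rw [leftVec, if_neg (by omega), ← hxv, Matrix.mulVec_mulVec, Matrix.nonsing_inv_mul _ hdet,
      Matrix.one_mulVec]
    exact hx
  induction n using Int.induction_on with
  | zero => exact_mod_cast hneg 0
  | succ n ih =>
    rw [← incR_transpose_mulVec_leftVec]
    exact incR_transpose_mulVec_nonneg _ ih
  | pred n ih => have := hneg (n + 1); push_cast at this; rwa [neg_add'] at this

/-- Unimodularity excludes zero rows, so every row of an incidence matrix has an entry at least 1.
-/
theorem sum_leftVec_le (hv : IsGeneralizedLeftEigenvector σ v) (n : ℤ) :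
    ∑ a, leftVec σ v n a ≤ ∑ a, leftVec σ v (n + 1) a := by
  have h : ∀ b, leftVec σ v (n + 1) b = ∑ a, incR (σ n) a b * leftVec σ v n a := fun b => by
    rw [← incR_transpose_mulVec_leftVec]; rfl
  simp_rw [h]
  rw [Finset.sum_comm]
  refine Finset.sum_le_sum fun a _ => ?_
  obtain ⟨b, hb⟩ := exists_mem_image_row (σ n) a
  rw [← Finset.sum_mul]
  refine le_mul_of_one_le_left (hv.leftVec_nonneg n a) ((one_le_incR_of_mem _ hb).trans ?_)
  exact Finset.single_le_sum (f := fun b => incR (σ n) a b) (fun b _ => incR_nonneg _ _ _)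
    (Finset.mem_univ b)

theorem sum_rightVec_le (hu : IsGeneralizedRightEigenvector σ u) (n : ℤ) :
    ∑ a, rightVec σ u (n + 1) a ≤ ∑ a, rightVec σ u n a := by
  have h : ∀ a, rightVec σ u n a = ∑ b, incR (σ n) a b * rightVec σ u (n + 1) b := fun a => by
    rw [← incR_mulVec_rightVec]; rfl
  simp_rw [h]
  rw [Finset.sum_comm]
  refine Finset.sum_le_sum fun b _ => ?_
  obtain ⟨a, ha⟩ := exists_mem_image_col (σ n) b
  rw [← Finset.sum_mul]
  refine le_mul_of_one_le_left (hu.rightVec_nonneg (n + 1) b) ((one_le_incR_of_mem _ ha).trans ?_)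
  exact Finset.single_le_sum (f := fun a => incR (σ n) a b) (fun b _ => incR_nonneg _ _ _)
    (Finset.mem_univ a)

theorem one_le_iterMat {n : ℤ} {j : ℕ} {a b : Fin d} (h : a ∈ iterWord σ n j [b]) :
    1 ≤ iterMat σ n j a b := by
  rw [iterMat_eq_count]
  exact_mod_cast List.count_pos_iff.2 h

/-- The entries of a positive block are integers, hence at least 1, so each later coordinate
dominates the whole earlier mass. Both the positivity of v_n and its decay at −∞ come from this. -/
theorem sum_leftVec_le_leftVec (hv : IsGeneralizedLeftEigenvector σ v) {n : ℤ} {j : ℕ}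
    (h : ∀ a b, a ∈ iterWord σ n j [b]) (b : Fin d) :
    ∑ a, leftVec σ v n a ≤ leftVec σ v (n + j) b := by
  have h1 := iterMat_mulVec_dotProduct_leftVec σ v n j (Pi.single b 1)
  rw [single_one_dotProduct, Matrix.mulVec_single_one] at h1
  rw [← h1]
  exact Finset.sum_le_sum fun a _ =>
    le_mul_of_one_le_left (hv.leftVec_nonneg n a) (one_le_iterMat (h a b))

theorem sum_rightVec_le_rightVec (hu : IsGeneralizedRightEigenvector σ u) {n : ℤ} {j : ℕ}
    (h : ∀ a b, a ∈ iterWord σ n j [b]) (a : Fin d) :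
    ∑ b, rightVec σ u (n + j) b ≤ rightVec σ u n a := by
  rw [← iterMat_mulVec_rightVec σ u n j]
  exact Finset.sum_le_sum fun b _ =>
    le_mul_of_one_le_left (hu.rightVec_nonneg _ b) (one_le_iterMat (h a b))

theorem leftVec_ne_zero (hv : IsGeneralizedLeftEigenvector σ v) (n : ℤ) :
    leftVec σ v n ≠ 0 := by
  have h0 : leftVec σ v 0 = v := by simp [leftVec, blockMatrixReal_self]
  induction n using Int.induction_on with
  | zero => rw [h0]; exact hv.2.1
  | succ n ih =>
    intro h
    apply ih
    rw [← incR_transpose_mulVec_leftVec] at h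
    have hinj := Matrix.mulVec_injective_of_isUnit
      ((Matrix.isUnit_iff_isUnit_det (incR (σ n)).transpose).2
      (by rw [Matrix.det_transpose]; exact isUnit_det_incR _))
    exact hinj (h.trans (Matrix.mulVec_zero _).symm)
  | pred n ih =>
    intro h
    apply ih
    rw [← sub_add_cancel (-(n : ℤ)) 1, ← incR_transpose_mulVec_leftVec, h, Matrix.mulVec_zero]

theorem leftVec_pos (hp : IsPrimitiveInPast σ) (hv : IsGeneralizedLeftEigenvector σ v)
    (n : ℤ) (a : Fin d) : 0 < leftVec σ v n a := by
  obtain ⟨j, -, h⟩ := exists_mem_iterWord_past σ hp n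
  have h1 := sum_leftVec_le_leftVec hv h a
  rw [sub_add_cancel] at h1
  refine lt_of_lt_of_le (lt_of_le_of_ne (Finset.sum_nonneg fun b _ => hv.leftVec_nonneg _ b) ?_) h1
  intro h0
  refine leftVec_ne_zero hv (n - j) (funext fun b => ?_)
  exact (Finset.sum_eq_zero_iff_of_nonneg (fun b _ => hv.leftVec_nonneg _ b)).1 h0.symm b
    (Finset.mem_univ b)

theorem dotProduct_pos_of_eigenvectors (hp : IsPrimitiveInPast σ)
    (hu : IsGeneralizedRightEigenvector σ u) (hv : IsGeneralizedLeftEigenvector σ v) :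
    0 < u ⬝ᵥ v := by
  have h0 : leftVec σ v 0 = v := by simp [leftVec, blockMatrixReal_self]
  have hv0 : ∀ a, 0 < v a := fun a => by rw [← h0]; exact leftVec_pos hp hv 0 a
  obtain ⟨a, ha⟩ := Function.ne_iff.1 hu.2.1
  exact Finset.sum_pos' (fun b _ => mul_nonneg (hu.1 b) (hv0 b).le)
    ⟨a, Finset.mem_univ a, mul_pos (lt_of_le_of_ne (hu.1 a) (Ne.symm ha)) (hv0 a)⟩

/-- A nonincreasing nonnegative sequence that is halved again and again tends to zero. -/
theorem tendsto_zero_of_halving {f : ℕ → ℝ} (h0 : ∀ n, 0 ≤ f n) (hf : Antitone f)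
    (h2 : ∀ n, ∃ m, f m ≤ f n / 2) : Filter.Tendsto f Filter.atTop (nhds 0) := by
  have h3 : ∀ k : ℕ, ∃ m, f m ≤ f 0 / 2 ^ k := by
    intro k
    induction k with
    | zero => exact ⟨0, by simp⟩
    | succ k ih =>
      obtain ⟨m, hm⟩ := ih
      obtain ⟨m', hm'⟩ := h2 m
      refine ⟨m', hm'.trans ?_⟩
      rw [pow_succ, ← div_div]
      linarith
  rw [Metric.tendsto_atTop]
  intro ε hε
  have h4 : Filter.Tendsto (fun k : ℕ => f 0 / 2 ^ k) Filter.atTop (nhds 0) :=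
    tendsto_const_nhds.div_atTop (tendsto_pow_atTop_atTop_of_one_lt one_lt_two)
  obtain ⟨k, hk⟩ := (h4.eventually (gt_mem_nhds hε)).exists
  obtain ⟨m, hm⟩ := h3 k
  refine ⟨m, fun n hn => ?_⟩
  rw [Real.dist_eq, sub_zero, abs_of_nonneg (h0 n)]
  exact lt_of_le_of_lt ((hf hn).trans hm) hk

/-- Across a positive block each of the d coordinates of the earlier vector dominates the later sum.
Adding them up, d ≥ 2 gives a loss by a factor of at least 2. -/
theorem tendsto_sum_rightVec (hd : 2 ≤ d) (hp : IsPrimitive σ)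
    (hu : IsGeneralizedRightEigenvector σ u) (n : ℤ) :
    Filter.Tendsto (fun j : ℕ => ∑ a, rightVec σ u (n + j) a) Filter.atTop (nhds 0) := by
  refine tendsto_zero_of_halving (fun j => Finset.sum_nonneg fun a _ => hu.rightVec_nonneg _ a)
    (antitone_nat_of_succ_le fun j => ?_) fun j => ?_
  · have := sum_rightVec_le hu (n + j)
    rwa [show n + (j : ℤ) + 1 = n + ((j + 1 : ℕ) : ℤ) by push_cast; ring] at this
  · obtain ⟨i, -, h⟩ := exists_mem_iterWord σ hp (n + j)
    refine ⟨j + i, ?_⟩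
    have h1 := fun a => sum_rightVec_le_rightVec hu h a
    rw [show n + (j : ℤ) + i = n + ((j + i : ℕ) : ℤ) by push_cast; ring] at h1
    have h2 := Finset.sum_le_sum fun a (_ : a ∈ Finset.univ) => h1 a
    rw [Finset.sum_const, Finset.card_univ, Fintype.card_fin, nsmul_eq_mul] at h2
    have h3 : (0 : ℝ) ≤ ∑ b, rightVec σ u (n + ((j + i : ℕ) : ℤ)) b :=
      Finset.sum_nonneg fun a _ => hu.rightVec_nonneg _ a
    have h4 : (2 : ℝ) ≤ d := by exact_mod_cast hd
    rw [le_div_iff₀ two_pos]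
    nlinarith

theorem tendsto_sum_leftVec (hd : 2 ≤ d) (hp : IsPrimitiveInPast σ)
    (hv : IsGeneralizedLeftEigenvector σ v) :
    Filter.Tendsto (fun j : ℕ => ∑ a, leftVec σ v (-j) a) Filter.atTop (nhds 0) := by
  refine tendsto_zero_of_halving (fun j => Finset.sum_nonneg fun a _ => hv.leftVec_nonneg _ a)
    (antitone_nat_of_succ_le fun j => ?_) fun j => ?_
  · have := sum_leftVec_le hv (-((j + 1 : ℕ) : ℤ))
    rwa [show -((j + 1 : ℕ) : ℤ) + 1 = -(j : ℤ) by push_cast; ring] at this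
  · obtain ⟨i, -, h⟩ := exists_mem_iterWord_past σ hp (-j)
    refine ⟨j + i, ?_⟩
    have h1 := fun a => sum_leftVec_le_leftVec hv h a
    rw [sub_add_cancel, show -(j : ℤ) - i = -((j + i : ℕ) : ℤ) by push_cast; ring] at h1
    have h2 := Finset.sum_le_sum fun a (_ : a ∈ Finset.univ) => h1 a
    rw [Finset.sum_const, Finset.card_univ, Fintype.card_fin, nsmul_eq_mul] at h2
    have h3 : (0 : ℝ) ≤ ∑ b, leftVec σ v (-((j + i : ℕ) : ℤ)) b :=
      Finset.sum_nonneg fun a _ => hv.leftVec_nonneg _ a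
    have h4 : (2 : ℝ) ≤ d := by exact_mod_cast hd
    rw [le_div_iff₀ two_pos]
    nlinarith

end Vectors

/-! ### Equivariance of the projections -/

section Projections

variable {d : ℕ} (σ : ℤ → UnimodularSubstitution d) (u v : Fin d → ℝ)

theorem piLevel_eq (n : ℤ) (x : Fin d → ℝ) :
    piLevel σ u v n x = x - (x ⬝ᵥ leftVec σ v n / u ⬝ᵥ v) • rightVec σ u n := by
  rw [piLevel, projHyp, rightVec_dotProduct_leftVec]

theorem piTildeLevel_eq (n : ℤ) (x : Fin d → ℝ) :
    piTildeLevel σ u v n x = (x ⬝ᵥ leftVec σ v n / u ⬝ᵥ v) • rightVec σ u n := by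
  rw [piTildeLevel, projLine, rightVec_dotProduct_leftVec]

theorem piLevel_add (n : ℤ) (x y : Fin d → ℝ) :
    piLevel σ u v n (x + y) = piLevel σ u v n x + piLevel σ u v n y := by
  simp only [piLevel_eq, add_dotProduct, add_div, add_smul]
  abel

variable {u v} in
theorem piLevel_dotProduct_leftVec (hc : 0 < u ⬝ᵥ v) (n : ℤ) (x : Fin d → ℝ) :
    piLevel σ u v n x ⬝ᵥ leftVec σ v n = 0 := by
  rw [piLevel_eq, sub_dotProduct, smul_dotProduct, rightVec_dotProduct_leftVec, smul_eq_mul,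
    div_mul_cancel₀ _ hc.ne', sub_self]

/-- Both M_{σ_n} u_{n+1} = u_n and the invariance of the pairing enter. This intertwining transports
projected prefixes between levels. -/
theorem incR_mulVec_piLevel (n : ℤ) (x : Fin d → ℝ) :
    (incR (σ n)).mulVec (piLevel σ u v (n + 1) x) = piLevel σ u v n ((incR (σ n)).mulVec x) := by
  rw [piLevel_eq, piLevel_eq, Matrix.mulVec_sub, Matrix.mulVec_smul, incR_mulVec_rightVec,
    incR_mulVec_dotProduct_leftVec]

theorem iterMat_mulVec_piLevel (n : ℤ) (j : ℕ) (x : Fin d → ℝ) :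
    (iterMat σ n j).mulVec (piLevel σ u v (n + j) x) =
      piLevel σ u v n ((iterMat σ n j).mulVec x) := by
  rw [piLevel_eq, piLevel_eq, Matrix.mulVec_sub, Matrix.mulVec_smul, iterMat_mulVec_rightVec,
    iterMat_mulVec_dotProduct_leftVec]

end Projections

/-! ### Prefixes that occur infinitely often, and their desubstitution -/

section LimitPrefixes

variable {d : ℕ} (σ : ℤ → UnimodularSubstitution d)

/-- `p` is a prefix of `σ_{[n,m)}(b)` for infinitely many `m`. -/
def IsLimitPrefix (n : ℤ) (p : List (Fin d)) : Prop :=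
  ∃ᶠ j : ℕ in Filter.atTop, ∃ b, p <+: iterWord σ n j [b]

theorem infinite_iff_isLimitPrefix (n : ℤ) (p : List (Fin d)) :
    {m : ℤ | n ≤ m ∧ ∃ b, p <+: blockWord σ n m b}.Infinite ↔ IsLimitPrefix σ n p := by
  rw [IsLimitPrefix, Filter.frequently_atTop]
  constructor
  · intro h N
    by_contra hN
    push Not at hN
    refine h ((Set.finite_Icc n (n + N)).subset ?_)
    rintro m ⟨hm, b, hb⟩
    refine ⟨hm, ?_⟩
    by_contra hlt
    obtain ⟨j, rfl⟩ : ∃ j : ℕ, m = n + j := ⟨(m - n).toNat, by omega⟩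
    rw [blockWord_add] at hb
    exact hN j (by omega) b hb
  · intro h
    refine Set.infinite_of_forall_exists_gt fun m => ?_
    obtain ⟨j, hj, b, hb⟩ := h ((m - n).toNat + 1)
    exact ⟨n + j, ⟨by omega, b, by rwa [blockWord_add]⟩, by omega⟩

variable {σ}

theorem IsLimitPrefix.of_prefix {n : ℤ} {p q : List (Fin d)} (h : IsLimitPrefix σ n q)
    (hpq : p <+: q) : IsLimitPrefix σ n p :=
  Filter.Frequently.mono h fun _ ⟨b, hb⟩ => ⟨b, hpq.trans hb⟩

theorem IsLimitPrefix.apply {n : ℤ} {q : List (Fin d)} (h : IsLimitPrefix σ (n + 1) q) :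
    IsLimitPrefix σ n ((σ n).apply q) := by
  rw [IsLimitPrefix, Filter.frequently_atTop] at h ⊢
  intro N
  obtain ⟨j, hj, b, hb⟩ := h N
  exact ⟨j + 1, by omega, b, (σ n).apply_prefix hb⟩

theorem IsLimitPrefix.iterWord {n : ℤ} {j : ℕ} {q : List (Fin d)}
    (h : IsLimitPrefix σ (n + j) q) : IsLimitPrefix σ n (iterWord σ n j q) := by
  induction j generalizing n with
  | zero => simpa [SAdic.iterWord] using h
  | succ j ih =>
    refine IsLimitPrefix.apply (ih ?_)
    rwa [show n + 1 + (j : ℤ) = n + ((j + 1 : ℕ) : ℤ) by push_cast; ring]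

/-- A nonempty prefix of the image of a word ends within the image of one of its letters. -/
theorem UnimodularSubstitution.exists_of_prefix_apply (s : UnimodularSubstitution d) {a : Fin d}
    {w p : List (Fin d)} (h : (p ++ [a]) <+: s.apply w) :
    ∃ q c p', (q ++ [c]) <+: w ∧ p = s.apply q ++ p' ∧ (p' ++ [a]) <+: s.image c := by
  induction w generalizing p with
  | nil =>
    have := h.length_le
    simp [UnimodularSubstitution.apply] at this
  | cons c w ih =>
    rw [show c :: w = [c] ++ w from rfl, s.apply_append, s.apply_singleton] at h
    rcases List.prefix_or_prefix_of_prefix h (List.prefix_append _ _) with h1 | ⟨t, ht⟩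
    · exact ⟨[], c, p, ⟨w, rfl⟩, rfl, h1⟩
    · rcases List.eq_nil_or_concat t with rfl | ⟨t', a', rfl⟩
      · refine ⟨[], c, p, ⟨w, rfl⟩, rfl, ?_⟩
        rw [← ht]; simp
      · rw [List.concat_eq_append, ← List.append_assoc] at ht
        obtain ⟨hp, ha⟩ := List.append_inj' ht rfl
        obtain rfl : a' = a := by simpa using ha
        rw [← hp, List.append_assoc, List.prefix_append_right_inj] at h
        obtain ⟨q, c', p', hq, hp', hc⟩ := ih h
        refine ⟨c :: q, c', p', ?_, ?_, hc⟩
        · simpa using hq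
        · rw [← hp, hp', show c :: q = [c] ++ q from rfl, s.apply_append, s.apply_singleton,
            List.append_assoc]

/-- At each occurrence the prefix desubstitutes through some edge. There are only finitely many
candidates, so one of them serves infinitely often. -/
theorem IsLimitPrefix.exists_edge {n : ℤ} {p : List (Fin d)} {a : Fin d}
    (h : IsLimitPrefix σ n (p ++ [a])) :
    ∃ e ∈ edgeSet (σ n), e.src = a ∧ ∃ q, IsLimitPrefix σ (n + 1) (q ++ [e.rng]) ∧
      p = (σ n).apply q ++ e.word := by
  by_contra hcon
  push Not at hcon
  -- Substitutions do not shorten words, so the desubstituted prefix has length at most that of `p`.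
  -- This makes the set of candidates finite.
  let T : Set (List (Fin d) × PrefixEdge d) :=
    {q : List (Fin d) | q.length ≤ p.length} ×ˢ edgeSet (σ n)
  have hT : T.Finite := (List.finite_length_le _ _).prod (edgeSet_finite _)
  have h1 : ∀ t ∈ T, ∀ᶠ j : ℕ in Filter.atTop, ¬ (t.2.src = a ∧ p = (σ n).apply t.1 ++ t.2.word ∧
      ∃ b, (t.1 ++ [t.2.rng]) <+: SAdic.iterWord σ (n + 1) j [b]) := by
    intro t ht
    by_contra hf
    have hf' : ∃ᶠ j : ℕ in Filter.atTop, t.2.src = a ∧ p = (σ n).apply t.1 ++ t.2.word ∧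
      ∃ b, (t.1 ++ [t.2.rng]) <+: SAdic.iterWord σ (n + 1) j [b] := hf
    obtain ⟨j, h2, h3, -⟩ := hf'.exists
    exact hcon t.2 ht.2 h2 t.1 (hf'.mono fun _ hx => hx.2.2) h3
  rw [← Filter.eventually_all_finite hT] at h1
  obtain ⟨N, hN⟩ := Filter.eventually_atTop.1 h1
  obtain ⟨j, hj, b, hb⟩ := Filter.frequently_atTop.1 h (N + 1)
  obtain ⟨j, rfl⟩ : ∃ i, j = i + 1 := ⟨j - 1, by omega⟩
  obtain ⟨q, c, p', hq, hp, hc⟩ := (σ n).exists_of_prefix_apply hb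
  refine hN j (by omega) (q, ⟨a, p', c⟩) ⟨?_, hc⟩ ⟨rfl, hp, b, hq⟩
  change q.length ≤ p.length
  rw [hp, List.length_append]
  exact ((σ n).length_le_apply q).trans (Nat.le_add_right _ _)

end LimitPrefixes

/-! ### The set equation of the subtiles -/

section Fractals

variable {d : ℕ} {σ : ℤ → UnimodularSubstitution d} {u v : Fin d → ℝ}

theorem rauzyFractal_eq (n : ℤ) : rauzyFractal σ u v n =
    closure {y | ∃ p, IsLimitPrefix σ n p ∧ y = piLevel σ u v n (abel p)} := by
  simp only [rauzyFractal, infinite_iff_isLimitPrefix]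

theorem rauzySubtile_eq (n : ℤ) (a : Fin d) : rauzySubtile σ u v n a =
    closure {y | ∃ p, IsLimitPrefix σ n (p ++ [a]) ∧ y = piLevel σ u v n (abel p)} := by
  simp only [rauzySubtile, infinite_iff_isLimitPrefix]

theorem rauzySubtile_subset_rauzyFractal (n : ℤ) (a : Fin d) :
    rauzySubtile σ u v n a ⊆ rauzyFractal σ u v n := by
  rw [rauzySubtile_eq, rauzyFractal_eq]
  refine closure_mono ?_
  rintro _ ⟨p, hp, rfl⟩
  exact ⟨p, hp.of_prefix (List.prefix_append _ _), rfl⟩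

theorem isCompact_rauzySubtile {n : ℤ} (h : IsCompact (rauzyFractal σ u v n)) (a : Fin d) :
    IsCompact (rauzySubtile σ u v n a) :=
  h.of_isClosed_subset isClosed_closure (rauzySubtile_subset_rauzyFractal n a)

theorem edgeSubtile_eq (n : ℤ) (e : PrefixEdge d) : edgeSubtile σ u v n e =
    (fun y => piLevel σ u v n (abel e.word) + (incR (σ n)).mulVec y) ''
      rauzySubtile σ u v (n + 1) e.rng := rfl

theorem isCompact_edgeSubtile {n : ℤ} (h : IsCompact (rauzyFractal σ u v (n + 1)))
    (e : PrefixEdge d) : IsCompact (edgeSubtile σ u v n e) := by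
  rw [edgeSubtile_eq]
  refine (isCompact_rauzySubtile h _).image ?_
  exact continuous_const.add (Continuous.matrix_mulVec continuous_const continuous_id)

/-- If q b is a limit prefix at level n + 1, then σ_n(q) p a is one at level n, and π_n ℓ(σ_n(q)p) =
π_n ℓ(p) + M_{σ_n} π_{n+1} ℓ(q). -/
theorem edgeSubtile_subset {n : ℤ} {e : PrefixEdge d} (he : e ∈ edgeSet (σ n)) :
    edgeSubtile σ u v n e ⊆ rauzySubtile σ u v n e.src := by
  rw [edgeSubtile_eq, rauzySubtile_eq, rauzySubtile_eq]
  refine (image_closure_subset_closure_image (continuous_const.add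
    (Continuous.matrix_mulVec continuous_const continuous_id))).trans (closure_mono ?_)
  rintro _ ⟨_, ⟨q, hq, rfl⟩, rfl⟩
  refine ⟨(σ n).apply q ++ e.word, ?_, ?_⟩
  · refine hq.apply.of_prefix ?_
    rw [(σ n).apply_append, (σ n).apply_singleton, List.append_assoc,
      List.prefix_append_right_inj]
    exact he
  · change piLevel σ u v n (abel e.word) +
      (incR (σ n)).mulVec (piLevel σ u v (n + 1) (abel q)) = _
    rw [incR_mulVec_piLevel, abel_append, piLevel_add, abel_apply, add_comm]

/-- The set equation: a subtile is the union of the subtiles of the edges that start in it. -/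
theorem rauzySubtile_subset_iUnion (h : ∀ n : ℤ, IsCompact (rauzyFractal σ u v n)) (n : ℤ)
    (a : Fin d) : rauzySubtile σ u v n a ⊆
      ⋃ e ∈ {e ∈ edgeSet (σ n) | e.src = a}, edgeSubtile σ u v n e := by
  have hfin : {e ∈ edgeSet (σ n) | e.src = a}.Finite :=
    (edgeSet_finite (σ n)).subset fun _ he => he.1
  rw [rauzySubtile_eq]
  -- A finite union of compact sets is closed, so it suffices to treat the projected prefixes that
  -- generate the subtile.
  refine closure_minimal ?_ (hfin.isClosed_biUnion fun e _ =>
    (isCompact_edgeSubtile (h (n + 1)) e).isClosed)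
  rintro _ ⟨p, hp, rfl⟩
  obtain ⟨e, he, hea, q, hq, rfl⟩ := hp.exists_edge
  refine mem_biUnion (show e ∈ {e ∈ edgeSet (σ n) | e.src = a} from ⟨he, hea⟩) ?_
  rw [edgeSubtile_eq]
  refine ⟨piLevel σ u v (n + 1) (abel q), ?_, ?_⟩
  · rw [rauzySubtile_eq]
    exact subset_closure ⟨q, hq, rfl⟩
  · change piLevel σ u v n (abel e.word) +
      (incR (σ n)).mulVec (piLevel σ u v (n + 1) (abel q)) = _
    rw [incR_mulVec_piLevel, abel_append, piLevel_add, abel_apply, add_comm]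

theorem rauzyFractal_dotProduct_leftVec (hc : 0 < u ⬝ᵥ v) {n : ℤ} {y : Fin d → ℝ}
    (hy : y ∈ rauzyFractal σ u v n) : y ⬝ᵥ leftVec σ v n = 0 := by
  rw [rauzyFractal_eq] at hy
  have hcl : IsClosed {y : Fin d → ℝ | y ⬝ᵥ leftVec σ v n = 0} :=
    isClosed_eq (by unfold dotProduct; fun_prop) continuous_const
  refine closure_minimal ?_ hcl hy
  rintro _ ⟨p, -, rfl⟩
  exact piLevel_dotProduct_leftVec σ hc n _

end Fractals

/-! ### Rational independence of the coordinates of u_n -/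

section Independence

variable {d : ℕ} {σ : ℤ → UnimodularSubstitution d} {u v : Fin d → ℝ}

theorem mem_rauzyBox {n : ℤ} {a : Fin d} {x : Fin d → ℝ} : x ∈ rauzyBox σ u v n a ↔
    ∃ t ∈ Icc (0 : ℝ) 1, ∃ y ∈ rauzySubtile σ u v n a,
      x = (t * leftVec σ v n a / u ⬝ᵥ v) • rightVec σ u n - y := by
  have h : ∀ t : ℝ, piTildeLevel σ u v n (t • Pi.single a 1) =
      (t * leftVec σ v n a / u ⬝ᵥ v) • rightVec σ u n := fun t => by
    rw [piTildeLevel_eq, smul_dotProduct, single_one_dotProduct, smul_eq_mul]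
  rw [rauzyBox, letterSegment, segment_eq_image', image_image]
  simp only [sub_zero, zero_add, mem_image2, mem_image, h]
  constructor
  · rintro ⟨_, ⟨t, ht, rfl⟩, y, hy, rfl⟩
    exact ⟨t, ht, y, hy, rfl⟩
  · rintro ⟨t, ht, y, hy, rfl⟩
    exact ⟨_, ⟨t, ht, rfl⟩, y, hy, rfl⟩

/-- The tiling condition forces the coordinates of `u_n` to be rationally independent: if an
integer vector is orthogonal to `u_n`, then it takes integer values on all tiles. -/
theorem eq_zero_of_dotProduct_rightVec (htile : TilingCondition σ u v) (n : ℤ) {s : Fin d → ℤ}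
    (hs : (fun a => (s a : ℝ)) ⬝ᵥ rightVec σ u n = 0) : s = 0 := by
  by_contra hne
  obtain ⟨a, ha⟩ := Function.ne_iff.1 hne
  have ha' : (s a : ℝ) ≠ 0 := by simpa using ha
  set S : Fin d → ℝ := fun a => (s a : ℝ) with hS
  -- Pairing with `S` does not see the multiple of u_n that π_n removes, so it is an integer on
  -- projected prefixes. Since ℤ is closed in ℝ, this extends to the closure.
  have hR : ∀ b, ∀ y ∈ rauzySubtile σ u v n b, ∃ k : ℤ, (k : ℝ) = S ⬝ᵥ y := by
    intro b y hy
    rw [rauzySubtile_eq] at hy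
    have hcl : IsClosed {y : Fin d → ℝ | S ⬝ᵥ y ∈ range ((↑) : ℤ → ℝ)} :=
      Int.isClosedEmbedding_coe_real.isClosed_range.preimage (by unfold dotProduct; fun_prop)
    refine closure_minimal ?_ hcl hy
    rintro _ ⟨p, -, rfl⟩
    refine ⟨∑ b, s b * (p.count b : ℤ), ?_⟩
    rw [piLevel_eq, dotProduct_sub, dotProduct_smul, hs, smul_zero, sub_zero]
    simp [dotProduct, abel, hS]
  have hcov := (htile.2.2.2 n).2.1
  -- This vector pairs to 1/2 with `S`, so no tile can contain it.
  have hx : (Pi.single a ((2 * (s a : ℝ))⁻¹) : Fin d → ℝ) ∈ (univ : Set (Fin d → ℝ)) := mem_univ _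
  rw [← hcov, mem_iUnion] at hx
  obtain ⟨⟨z, b⟩, w, hw, hzw⟩ := hx
  obtain ⟨t, -, y, hy, rfl⟩ := mem_rauzyBox.1 hw
  obtain ⟨k, hk⟩ := hR b y hy
  have h1 := congrArg (fun x => S ⬝ᵥ x) hzw
  simp only [dotProduct_add, dotProduct_sub, dotProduct_smul, hs, smul_zero, zero_sub, ← hk,
    dotProduct_single] at h1
  have h2 : S ⬝ᵥ (fun j => (z j : ℝ)) = ((∑ j, s j * z j : ℤ) : ℝ) := by
    simp [dotProduct, hS]
  have h4 : S a * (2 * (s a : ℝ))⁻¹ = 1 / 2 := by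
    rw [hS]; field_simp
  rw [h2, h4] at h1
  have h5 : (2 * ((∑ j, s j * z j) - k) : ℤ) = 1 := by
    have : (2 * ((∑ j, s j * z j : ℤ) : ℝ) - 2 * k) = 1 := by linarith
    have h6 : ((2 * ((∑ j, s j * z j) - k) : ℤ) : ℝ) = (1 : ℤ) := by
      push_cast at this ⊢; linarith
    exact_mod_cast h6
  omega

end Independence

/-! ### Limit words given by coherent sequences of first letters -/

section CoherentPrefixes

variable {d : ℕ} (σ : ℤ → UnimodularSubstitution d)

/-- A sequence of letters such that the `k`-th one is the first letter of the image under
`σ_{n+k}` of the next one. -/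
def IsCoherent (n : ℤ) (b : ℕ → Fin d) : Prop :=
  ∀ k : ℕ, [b k] <+: (σ (n + k)).image (b (k + 1))

/-- A sequence coherent up to any finite level is found by taking first letters downwards from an
arbitrary top letter. Compactness of the space of letter sequences gives coherence at all levels. -/
theorem exists_isCoherent [Nonempty (Fin d)] (n : ℤ) : ∃ b : ℕ → Fin d, IsCoherent σ n b := by
  let F : ℕ → Fin d → Fin d := fun k c => ((σ (n + k)).image c).head ((σ (n + k)).nonerasing c)
  have hF : ∀ k c, [F k c] <+: (σ (n + k)).image c := fun k c =>
    ⟨((σ (n + k)).image c).tail, by simp [F]⟩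
  let C : ℕ → Set (ℕ → Fin d) := fun N => {b | ∀ k < N, b k = F k (b (k + 1))}
  have hcl : ∀ N, IsClosed (C N) := by
    intro N
    have : C N = ⋂ k ∈ {k | k < N}, {b | b k = F k (b (k + 1))} := by
      ext b; simp [C]
    rw [this]
    refine isClosed_biInter fun k _ => isClosed_eq (continuous_apply k) ?_
    exact (continuous_of_discreteTopology (f := F k)).comp (continuous_apply (k + 1))
  have hne : ∀ N, (C N).Nonempty := by
    intro N
    induction N with
    | zero => exact ⟨fun _ => Classical.arbitrary _, fun k hk => absurd hk (Nat.not_lt_zero k)⟩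
    | succ N ih =>
      -- `G i` is the letter at position N + 1 − i: the recursion runs downwards from an arbitrary
      -- letter at position N + 1.
      let G : ℕ → Fin d := fun i => Nat.rec (Classical.arbitrary _) (fun i c => F (N - i) c) i
      refine ⟨fun k => G (N + 1 - k), fun k hk => ?_⟩
      change G (N + 1 - k) = F k (G (N + 1 - (k + 1)))
      obtain ⟨i, hi⟩ : ∃ i, N - k = i := ⟨_, rfl⟩
      rw [show N + 1 - k = i + 1 by omega, show N + 1 - (k + 1) = i by omega]
      change F (N - i) (G i) = _
      rw [show N - i = k by omega]
  obtain ⟨b, hb⟩ := IsCompact.nonempty_iInter_of_sequence_nonempty_isCompact_isClosed C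
    (fun N b hb k hk => hb k (by omega)) hne (hcl 0).isCompact hcl
  refine ⟨b, fun k => ?_⟩
  rw [(mem_iInter.1 hb (k + 1)) k (by omega)]
  exact hF k _

/-- The prefixes at level `n + k` of the infinite words determined by a coherent sequence. -/
def coherentPrefixes (n : ℤ) (b : ℕ → Fin d) (k : ℕ) : Set (List (Fin d)) :=
  {p | ∃ j : ℕ, p <+: iterWord σ (n + k) j [b (k + j)]}

variable {σ} {n : ℤ} {b : ℕ → Fin d}

theorem IsCoherent.singleton_prefix (hb : IsCoherent σ n b) (k i : ℕ) :
    [b k] <+: iterWord σ (n + k) i [b (k + i)] := by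
  induction i generalizing k with
  | zero => simp [iterWord]
  | succ i ih =>
    have h := (σ (n + k)).apply_prefix (ih (k + 1))
    rw [UnimodularSubstitution.apply_singleton] at h
    refine (hb k).trans (h.trans ?_)
    rw [iterWord, show n + ((k + 1 : ℕ) : ℤ) = n + k + 1 by push_cast; ring,
      show k + 1 + i = k + (i + 1) by ring]

theorem IsCoherent.iterWord_prefix_add (hb : IsCoherent σ n b) (k j i : ℕ) :
    iterWord σ (n + k) j [b (k + j)] <+: iterWord σ (n + k) (j + i) [b (k + (j + i))] := by
  rw [iterWord_add]
  have h := iterWord_prefix σ (hb.singleton_prefix (k + j) i) (n + k) j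
  rwa [show n + ((k + j : ℕ) : ℤ) = n + k + j by push_cast; ring, add_assoc k j i] at h

/-- Coherence makes the words σ_{[n+k,n+k+j)}(b_{k+j}) increase with j, so all these prefixes are
prefixes of one limit word. -/
theorem IsCoherent.prefix_of_length_le (hb : IsCoherent σ n b) {k : ℕ} {p q : List (Fin d)}
    (hp : p ∈ coherentPrefixes σ n b k) (hq : q ∈ coherentPrefixes σ n b k)
    (h : p.length ≤ q.length) : p <+: q := by
  obtain ⟨i, hi⟩ := hp
  obtain ⟨j, hj⟩ := hq
  have h1 := hi.trans (hb.iterWord_prefix_add k i j)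
  have h2 := hj.trans (hb.iterWord_prefix_add k j i)
  rw [add_comm j i] at h2
  exact List.prefix_of_prefix_length_le h1 h2 h

theorem coherentPrefixes_of_prefix {k : ℕ} {p q : List (Fin d)}
    (hq : q ∈ coherentPrefixes σ n b k) (h : p <+: q) : p ∈ coherentPrefixes σ n b k := by
  obtain ⟨j, hj⟩ := hq
  exact ⟨j, h.trans hj⟩

theorem nil_mem_coherentPrefixes (k : ℕ) : [] ∈ coherentPrefixes σ n b k :=
  ⟨0, List.nil_prefix⟩

theorem iterWord_mem_coherentPrefixes {k i : ℕ} {p : List (Fin d)}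
    (hp : p ∈ coherentPrefixes σ n b (k + i)) :
    iterWord σ (n + k) i p ∈ coherentPrefixes σ n b k := by
  obtain ⟨j, hj⟩ := hp
  refine ⟨i + j, ?_⟩
  rw [iterWord_add]
  have h := iterWord_prefix σ hj (n + k) i
  rwa [show n + ((k + i : ℕ) : ℤ) = n + k + i by push_cast; ring, add_assoc k i j] at h

theorem iterWord_zero_mem_coherentPrefixes {k : ℕ} {p : List (Fin d)}
    (hp : p ∈ coherentPrefixes σ n b k) :
    iterWord σ n k p ∈ coherentPrefixes σ n b 0 := by
  have h := iterWord_mem_coherentPrefixes (k := 0) (i := k) (p := p) (by simpa using hp)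
  simpa using h

theorem IsCoherent.isLimitPrefix (hb : IsCoherent σ n b) {p : List (Fin d)}
    (hp : p ∈ coherentPrefixes σ n b 0) : IsLimitPrefix σ n p := by
  obtain ⟨j, hj⟩ := hp
  rw [IsLimitPrefix, Filter.frequently_atTop]
  intro N
  have h := hj.trans (hb.iterWord_prefix_add 0 j N)
  exact ⟨j + N, by omega, _, by simpa using h⟩

theorem exists_append_mem_coherentPrefixes (hprim : IsPrimitive σ) (k : ℕ) (a : Fin d) :
    ∃ p, p ++ [a] ∈ coherentPrefixes σ n b k := by
  obtain ⟨j, -, hj⟩ := exists_mem_iterWord σ hprim (n + k)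
  obtain ⟨p, r, hpr⟩ := List.append_of_mem (hj a (b (k + j)))
  exact ⟨p, j, r, by rw [hpr]; simp⟩

/-- The limit words are infinite: a positive block contains all d ≥ 2 letters, so it has a nonempty
rest after its first letter. -/
theorem IsCoherent.exists_extend (hb : IsCoherent σ n b) (hd : 2 ≤ d) (hprim : IsPrimitive σ)
    {k : ℕ} {p : List (Fin d)} (hp : p ∈ coherentPrefixes σ n b k) :
    ∃ a, p ++ [a] ∈ coherentPrefixes σ n b k := by
  obtain ⟨j, hj⟩ := hp
  obtain ⟨i, -, hi⟩ := exists_mem_iterWord σ hprim (n + (k + j : ℕ))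
  obtain ⟨t, ht⟩ := hb.singleton_prefix (k + j) i
  have htne : t ≠ [] := by
    rintro rfl
    have : Nontrivial (Fin d) := Fin.nontrivial_iff_two_le.2 hd
    obtain ⟨c, hc⟩ := exists_ne (b (k + j))
    have := hi c (b (k + j + i))
    rw [← ht] at this
    simp at this
    exact hc this
  have h1 : iterWord σ (n + k) j ([b (k + j)] ++ t) ∈ coherentPrefixes σ n b k := by
    refine ⟨j + i, ?_⟩
    rw [iterWord_add, ht, show n + ((k + j : ℕ) : ℤ) = n + k + j by push_cast; ring,
      add_assoc k j i]
  obtain ⟨r, hr⟩ := hj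
  have h2 : iterWord σ (n + k) j t ≠ [] := by
    have := length_le_iterWord σ (n + k) j t
    intro h
    rw [h] at this
    exact htne (List.eq_nil_of_length_eq_zero (by simpa using this))
  rw [iterWord_append, ← hr, List.append_assoc] at h1
  obtain ⟨a, s, has⟩ := List.exists_cons_of_ne_nil (List.append_ne_nil_of_right_ne_nil r h2)
  rw [has] at h1
  exact ⟨a, coherentPrefixes_of_prefix h1 ⟨s, by simp⟩⟩

end CoherentPrefixes

/-! ### Contraction of the Rauzy fractals along the sequence -/

section Convergence

variable {d : ℕ} {σ : ℤ → UnimodularSubstitution d} {n : ℤ} {b : ℕ → Fin d}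

/-- A bounded additive function of words is small on return words of high level. -/
theorem IsCoherent.return_le (hb : IsCoherent σ n b) (hprim : IsPrimitive σ)
    {f : List (Fin d) → ℝ} (hf : ∀ w w', f (w ++ w') = f w + f w') {C : ℝ}
    (hC : ∀ w ∈ coherentPrefixes σ n b 0, |f w| ≤ C) {ε : ℝ} (hε : 0 < ε) :
    ∃ k₀ : ℕ, ∀ k ≥ k₀, ∀ a p p', p ++ [a] ∈ coherentPrefixes σ n b k →
      p' ++ [a] ∈ coherentPrefixes σ n b k → p.length ≤ p'.length →
      f (iterWord σ n k p') - f (iterWord σ n k p) ≤ ε := by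
  -- Writing y = x w, these are the values of `f` on the factors w of the limit word. Some factor
  -- comes within ε of their supremum.
  set A : Set ℝ := {r | ∃ x ∈ coherentPrefixes σ n b 0, ∃ y ∈ coherentPrefixes σ n b 0,
    x.length ≤ y.length ∧ r = f y - f x} with hA
  have hbdd : BddAbove A := by
    refine ⟨2 * C, ?_⟩
    rintro _ ⟨x, hx, y, hy, -, rfl⟩
    have h1 := abs_le.1 (hC x hx)
    have h2 := abs_le.1 (hC y hy)
    linarith
  have hne : A.Nonempty := ⟨_, [], nil_mem_coherentPrefixes 0, [], nil_mem_coherentPrefixes 0,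
    le_rfl, rfl⟩
  obtain ⟨r, ⟨x, hx, y, hy, hxy, rfl⟩, hr⟩ := exists_lt_of_lt_csSup hne (sub_lt_self (sSup A) hε)
  obtain ⟨w, rfl⟩ := hb.prefix_of_length_le hx hy hxy
  obtain ⟨j, t, ht⟩ := hy
  simp only [Nat.cast_zero, add_zero, zero_add] at ht
  obtain ⟨i, -, hi⟩ := exists_mem_iterWord σ hprim (n + j)
  refine ⟨j + i, fun k hk a p p' hp hp' hlen => ?_⟩
  obtain ⟨m, rfl⟩ := Nat.exists_eq_add_of_le (le_of_add_le_left hk)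
  obtain ⟨q, s, hqs⟩ := List.append_of_mem (mem_iterWord_of_le σ hi (by omega : i ≤ m) (b j) a)
  set T := iterWord σ n (j + m) with hT
  -- At high levels the image of every letter contains the near-maximal factor `w`.
  have ha : T [a] = iterWord σ n j q ++ x ++ w ++ (t ++ iterWord σ n j s) := by
    rw [hT, iterWord_add, hqs, show q ++ b j :: s = q ++ ([b j] ++ s) by simp, iterWord_append,
      iterWord_append, ← ht]
    simp only [List.append_assoc]
  have hmem : ∀ p, p ++ [a] ∈ coherentPrefixes σ n b (j + m) →
      T p ++ (iterWord σ n j q ++ x ++ w) ∈ coherentPrefixes σ n b 0 := by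
    intro p hp
    have h := iterWord_zero_mem_coherentPrefixes hp
    rw [iterWord_append, ← hT, ha] at h
    exact coherentPrefixes_of_prefix h
      ((List.prefix_append_right_inj _).2 (List.prefix_append _ _))
  have h1 : T p ++ (iterWord σ n j q ++ x) ∈ coherentPrefixes σ n b 0 :=
    coherentPrefixes_of_prefix (hmem p hp)
      ((List.prefix_append_right_inj _).2 (List.prefix_append _ _))
  have hpre : p <+: p' := hb.prefix_of_length_le
    (coherentPrefixes_of_prefix hp (List.prefix_append _ _))
    (coherentPrefixes_of_prefix hp' (List.prefix_append _ _)) hlen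
  have hle : (T p).length ≤ (T p').length := (iterWord_prefix σ hpre n (j + m)).length_le
  -- The factor that starts at the copy of `w` following `T p` and ends with the copy following `T
  -- p'` has value f(w) + f(T p') − f(T p). This cannot exceed the supremum, whereas f(w) is within
  -- ε of it.
  have h2 := le_csSup hbdd (show _ ∈ A from ⟨_, h1, _, hmem p' hp', by
    simp only [List.length_append]; omega, rfl⟩)
  simp only [hf] at h2 hr
  linarith

/-- Apply the one-sided bound to `f` and to −`f`, and order the two prefixes by length. -/
theorem IsCoherent.abs_return_le (hb : IsCoherent σ n b) (hprim : IsPrimitive σ)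
    {f : List (Fin d) → ℝ} (hf : ∀ w w', f (w ++ w') = f w + f w') {C : ℝ}
    (hC : ∀ w ∈ coherentPrefixes σ n b 0, |f w| ≤ C) {ε : ℝ} (hε : 0 < ε) :
    ∃ k : ℕ, ∀ a p p', p ++ [a] ∈ coherentPrefixes σ n b k →
      p' ++ [a] ∈ coherentPrefixes σ n b k →
      |f (iterWord σ n k p') - f (iterWord σ n k p)| ≤ ε := by
  obtain ⟨k₁, h₁⟩ := hb.return_le hprim hf hC hε
  obtain ⟨k₂, h₂⟩ := hb.return_le hprim (f := fun w => -f w) (fun w w' => by simp [hf]; ring)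
    (C := C) (fun w hw => by simpa using hC w hw) hε
  have key : ∀ a p p', p ++ [a] ∈ coherentPrefixes σ n b (max k₁ k₂) →
      p' ++ [a] ∈ coherentPrefixes σ n b (max k₁ k₂) → p.length ≤ p'.length →
      |f (iterWord σ n (max k₁ k₂) p') - f (iterWord σ n (max k₁ k₂) p)| ≤ ε := by
    intro a p p' hp hp' hle
    have h3 := h₁ _ (le_max_left _ _) a p p' hp hp' hle
    have h4 := h₂ _ (le_max_right _ _) a p p' hp hp' hle
    rw [abs_le]
    constructor <;> linarith
  refine ⟨max k₁ k₂, fun a p p' hp hp' => ?_⟩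
  rcases le_total p.length p'.length with h | h
  · exact key a p p' hp hp' h
  · rw [abs_sub_comm]
    exact key a p' p hp' hp h

/-- If the values of a bounded additive function at prefixes of high level do not become small,
then some `u_m` has rationally dependent coordinates. -/
theorem IsCoherent.exists_lt (hb : IsCoherent σ n b) (hd : 2 ≤ d) (hprim : IsPrimitive σ)
    {u : Fin d → ℝ} (hu : IsGeneralizedRightEigenvector σ u)
    (hind : ∀ (m : ℤ) (s : Fin d → ℤ), (fun a => (s a : ℝ)) ⬝ᵥ rightVec σ u m = 0 → s = 0)
    {f : List (Fin d) → ℝ} (hf : ∀ w w', f (w ++ w') = f w + f w') {C : ℝ}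
    (hC : ∀ w ∈ coherentPrefixes σ n b 0, |f w| ≤ C) {D : ℝ} (hD : 0 < D) :
    ∃ k : ℕ, ∀ p ∈ coherentPrefixes σ n b k, f (iterWord σ n k p) < D := by
  by_contra hcon
  push Not at hcon
  -- With this choice the d + 1 points (4i + 2)ε, 0 ≤ i ≤ d, lie in (0, D) and are 4ε apart.
  set ε : ℝ := D / (4 * (d + 1)) with hε
  have hd0 : (0 : ℝ) < d + 1 := by positivity
  have hε0 : 0 < ε := by positivity
  have hεD : ε * (4 * (d + 1)) = D := by rw [hε]; field_simp
  obtain ⟨k, hk⟩ := hb.abs_return_le hprim hf hC hε0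
  set P := coherentPrefixes σ n b k with hP
  set g : List (Fin d) → ℝ := fun p => f (iterWord σ n k p) with hg
  have hgadd : ∀ w w', g (w ++ w') = g w + g w' := fun w w' => by
    simp only [hg, iterWord_append, hf]
  have hg0 : g [] = 0 := by
    have := hgadd [] []
    simp only [List.append_nil] at this
    linarith
  -- The values of `g` at the prefixes preceding a given letter have diameter at most ε, so they
  -- form at most d clusters. By pigeonhole these cannot come within ε of all d + 1 points, since
  -- two points served by one cluster would be less than 3ε apart.
  obtain ⟨θ, hθ0, hθD, hθ⟩ : ∃ θ : ℝ, 0 < θ ∧ θ < D ∧ ∀ p ∈ P, ε ≤ |g p - θ| := by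
    by_contra hno
    push Not at hno
    have h1 : ∀ i : Fin (d + 1), ∃ a : Fin d, ∃ p, p ++ [a] ∈ P ∧
        |g p - (4 * (i : ℝ) + 2) * ε| < ε := by
      intro i
      have hi : (i : ℝ) ≤ d := by exact_mod_cast Nat.lt_succ_iff.1 i.2
      have hi0 : (0 : ℝ) ≤ (i : ℝ) := by positivity
      obtain ⟨p, hp, hlt⟩ := hno ((4 * (i : ℝ) + 2) * ε) (by positivity) (by nlinarith)
      obtain ⟨a, ha⟩ := hb.exists_extend hd hprim hp
      exact ⟨a, p, ha, hlt⟩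
    choose a p hp hlt using h1
    obtain ⟨i, i', hne, hii⟩ := Fintype.exists_ne_map_eq_of_card_lt a (by simp)
    have h2 := hk (a i) (p i) (p i') (hp i) (by rw [hii]; exact hp i')
    have h3 : 4 * ε ≤ |(4 * (i : ℝ) + 2) * ε - (4 * (i' : ℝ) + 2) * ε| := by
      have : (1 : ℝ) ≤ |(i : ℝ) - (i' : ℝ)| := by
        have h5 : ((i : ℕ) : ℤ) - ((i' : ℕ) : ℤ) ≠ 0 := by
          intro h; apply hne; ext; omega
        exact_mod_cast Int.one_le_abs h5
      rw [show (4 * (i : ℝ) + 2) * ε - (4 * (i' : ℝ) + 2) * ε = 4 * ε * ((i : ℝ) - i') by ring,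
        abs_mul, abs_of_pos (by positivity : 0 < 4 * ε)]
      nlinarith
    have h4 := hlt i
    have h5 := hlt i'
    change |g (p i') - g (p i)| ≤ ε at h2
    rw [abs_le] at h2
    rw [abs_lt] at h4 h5
    rcases le_abs'.1 h3 with h | h <;> linarith [h2.1, h2.2, h4.1, h4.2, h5.1, h5.2]
  -- `χ` records the side of the gap. Values within ε of each other cannot straddle a gap of width
  -- 2ε, so the jump of `χ` when a letter is appended depends only on this letter.
  set χ : List (Fin d) → ℤ := fun p => if θ < g p then 1 else 0 with hχ
  have hχ0 : χ [] = 0 := by simp only [hχ, hg0]; rw [if_neg (by linarith)]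
  have hχ_eq : ∀ p ∈ P, ∀ p' ∈ P, |g p' - g p| ≤ ε → χ p' = χ p := by
    intro p hp p' hp' h
    have h1 := hθ p hp
    have h2 := hθ p' hp'
    simp only [hχ]
    rw [abs_le] at h
    rw [le_abs'] at h1 h2
    split_ifs with h3 h4 h4
    · rfl
    · rcases h1 with h1 | h1 <;> rcases h2 with h2 | h2 <;> linarith [h.1, h.2]
    · rcases h1 with h1 | h1 <;> rcases h2 with h2 | h2 <;> linarith [h.1, h.2]
    · rfl
  have hocc := fun a => exists_append_mem_coherentPrefixes (n := n) (b := b) hprim k a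
  choose p₀ hp₀ using hocc
  set s : Fin d → ℤ := fun a => χ (p₀ a ++ [a]) - χ (p₀ a) with hs
  have hs_eq : ∀ p a, p ++ [a] ∈ P → s a = χ (p ++ [a]) - χ p := by
    intro p a hp
    have h := hk a p (p₀ a) hp (hp₀ a)
    have hx := hχ_eq p (coherentPrefixes_of_prefix hp (List.prefix_append _ _)) (p₀ a)
      (coherentPrefixes_of_prefix (hp₀ a) (List.prefix_append _ _)) h
    have hy := hχ_eq (p ++ [a]) hp (p₀ a ++ [a]) (hp₀ a) (by
      rw [hgadd, hgadd, add_sub_add_right_eq_sub]; exact h)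
    simp only [hs, hx, hy]
  set S : Fin d → ℝ := fun a => (s a : ℝ) with hS
  -- Summing the jumps turns `χ` into a linear function of the abelianization.
  have hsum : ∀ p ∈ P, S ⬝ᵥ abel p = (χ p : ℝ) := by
    intro p
    induction p using List.reverseRecOn with
    | nil => intro _; simp [abel_nil, hχ0]
    | append_singleton p a ih =>
      intro hp
      rw [abel_append, dotProduct_add, ih (coherentPrefixes_of_prefix hp (List.prefix_append _ _)),
        abel_singleton, dotProduct_single_one, hS]
      simp only [hs_eq p a hp]
      push_cast; ring
  have hχ01 : ∀ p, 0 ≤ χ p ∧ χ p ≤ 1 := fun p => by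
    simp only [hχ]; split_ifs <;> norm_num
  have hbound : ∀ j : ℕ, |S ⬝ᵥ rightVec σ u (n + k)| ≤ ∑ a, rightVec σ u (n + k + j) a := by
    intro j
    -- This coordinate is the pairing of `S` with the abelianized image of one letter. That image
    -- sits between two prefixes of the limit word, so the value is a difference of two values of
    -- `χ` in {0, 1}.
    have hcol : ∀ a, |Matrix.vecMul S (iterMat σ (n + k) j) a| ≤ 1 := by
      intro a
      obtain ⟨p, hp⟩ := exists_append_mem_coherentPrefixes (n := n) (b := b) hprim (k + j) a
      have h1 := hsum _ (iterWord_mem_coherentPrefixes hp)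
      have h2 := hsum _ (iterWord_mem_coherentPrefixes
        (coherentPrefixes_of_prefix hp (List.prefix_append p [a])))
      rw [iterWord_append, abel_append, dotProduct_add, h2, abel_iterWord, abel_singleton,
        Matrix.dotProduct_mulVec, dotProduct_single_one, ← iterWord_append] at h1
      have h3 : Matrix.vecMul S (iterMat σ (n + k) j) a =
          ((χ (iterWord σ (n + k) j (p ++ [a])) - χ (iterWord σ (n + k) j p) : ℤ) : ℝ) := by
        push_cast; linarith
      rw [h3, ← Int.cast_abs, ← Int.cast_one, Int.cast_le, abs_le]
      have := hχ01 (iterWord σ (n + k) j (p ++ [a]))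
      have := hχ01 (iterWord σ (n + k) j p)
      omega
    rw [← iterMat_mulVec_rightVec σ u (n + k) j, Matrix.dotProduct_mulVec]
    refine (Finset.abs_sum_le_sum_abs _ _).trans (Finset.sum_le_sum fun a _ => ?_)
    rw [abs_mul, abs_of_nonneg (hu.rightVec_nonneg _ a)]
    exact mul_le_of_le_one_left (hu.rightVec_nonneg _ a) (hcol a)
  have hzero : S ⬝ᵥ rightVec σ u (n + k) = 0 := by
    have h1 := ge_of_tendsto' (tendsto_sum_rightVec hd hprim hu (n + k)) hbound
    exact abs_eq_zero.1 (le_antisymm h1 (abs_nonneg _))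
  have hs0 := hind (n + k) s hzero
  obtain ⟨p, hp, hpD⟩ := hcon k
  have h1 := hsum p hp
  have h2 : χ p = 1 := by
    simp only [hχ]; rw [if_pos (lt_of_lt_of_le hθD hpD)]
  rw [h2, hS, hs0] at h1
  simp [dotProduct] at h1

/-- One good level suffices for all higher ones, because substitution maps higher prefixes to
prefixes at that level. The two-sided bound comes from using `f` and −`f`. -/
theorem IsCoherent.exists_forall_abs_le (hb : IsCoherent σ n b) (hd : 2 ≤ d)
    (hprim : IsPrimitive σ) {u : Fin d → ℝ} (hu : IsGeneralizedRightEigenvector σ u)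
    (hind : ∀ (m : ℤ) (s : Fin d → ℤ), (fun a => (s a : ℝ)) ⬝ᵥ rightVec σ u m = 0 → s = 0)
    {f : List (Fin d) → ℝ} (hf : ∀ w w', f (w ++ w') = f w + f w') {C : ℝ}
    (hC : ∀ w ∈ coherentPrefixes σ n b 0, |f w| ≤ C) {ε : ℝ} (hε : 0 < ε) :
    ∃ k₀ : ℕ, ∀ k ≥ k₀, ∀ p ∈ coherentPrefixes σ n b k, |f (iterWord σ n k p)| ≤ ε := by
  have hdown : ∀ {g : List (Fin d) → ℝ} {k₀ : ℕ},
      (∀ p ∈ coherentPrefixes σ n b k₀, g (iterWord σ n k₀ p) < ε) → ∀ k ≥ k₀,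
      ∀ p ∈ coherentPrefixes σ n b k, g (iterWord σ n k p) < ε := by
    intro g k₀ h k hk p hp
    obtain ⟨i, rfl⟩ := Nat.exists_eq_add_of_le hk
    rw [iterWord_add]
    exact h _ (iterWord_mem_coherentPrefixes hp)
  obtain ⟨k₁, h₁⟩ := hb.exists_lt hd hprim hu hind hf hC hε
  obtain ⟨k₂, h₂⟩ := hb.exists_lt hd hprim hu hind (f := fun w => -f w)
    (fun w w' => by simp [hf]; ring) (C := C) (fun w hw => by simpa using hC w hw) hε
  refine ⟨max k₁ k₂, fun k hk p hp => abs_le.2 ?_⟩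
  have h3 := hdown h₁ k (le_of_max_le_left hk) p hp
  have h4 := hdown (g := fun w => -f w) h₂ k (le_of_max_le_right hk) p hp
  constructor <;> linarith

/-- The matrices `M_{[n,m)}` contract the Rauzy fractals of level `m` as `m` tends to infinity. -/
theorem exists_forall_norm_iterMat_mulVec_le (hd : 2 ≤ d) {u v : Fin d → ℝ}
    (htile : TilingCondition σ u v) (hcompact : ∀ n : ℤ, IsCompact (rauzyFractal σ u v n))
    (n : ℤ) {ε : ℝ} (hε : 0 < ε) :
    ∃ k₀ : ℕ, ∀ k ≥ k₀, ∀ y ∈ rauzyFractal σ u v (n + k),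
      ‖(iterMat σ n k).mulVec y‖ ≤ ε := by
  have hprim := htile.1
  have : Nonempty (Fin d) := ⟨⟨0, by omega⟩⟩
  obtain ⟨b, hb⟩ := exists_isCoherent σ n
  obtain ⟨C, hC⟩ := (hcompact n).isBounded.exists_norm_le
  have h1 : ∀ i : Fin d, ∃ k₀ : ℕ, ∀ k ≥ k₀, ∀ p ∈ coherentPrefixes σ n b k,
      |piLevel σ u v n (abel (iterWord σ n k p)) i| ≤ ε / 2 := by
    intro i
    refine hb.exists_forall_abs_le hd hprim htile.2.1
      (fun m s => eq_zero_of_dotProduct_rightVec htile m)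
      (f := fun w => piLevel σ u v n (abel w) i) (fun w w' => ?_) (C := C) (fun w hw => ?_)
      (half_pos hε)
    · rw [abel_append, piLevel_add, Pi.add_apply]
    · refine (norm_le_pi_norm (piLevel σ u v n (abel w)) i).trans (hC _ ?_)
      rw [rauzyFractal_eq]
      exact subset_closure ⟨w, hb.isLimitPrefix hw, rfl⟩
  choose K hK using h1
  refine ⟨Finset.univ.sup K, fun k hk y hy => ?_⟩
  rw [rauzyFractal_eq] at hy
  have hcl : IsClosed {y : Fin d → ℝ | ‖(iterMat σ n k).mulVec y‖ ≤ ε} :=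
    isClosed_le (Continuous.matrix_mulVec continuous_const continuous_id).norm continuous_const
  refine closure_minimal ?_ hcl hy
  rintro _ ⟨p, hp, rfl⟩
  rw [mem_ofPred_eq, iterMat_mulVec_piLevel, ← abel_iterWord, pi_norm_le_iff_of_nonneg hε.le]
  intro i
  -- An arbitrary limit prefix p need not begin the chosen limit word, but it occurs inside it after
  -- some word, since the letter `c` occurs at level n + k + j. Its value is then a difference of
  -- two values at prefixes of that word, which explains ε/2 above.
  obtain ⟨j, c, hc⟩ := hp.exists
  obtain ⟨q, hq⟩ := exists_append_mem_coherentPrefixes (n := n) (b := b) hprim (k + j) c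
  have hq2 := iterWord_mem_coherentPrefixes hq
  rw [iterWord_append] at hq2
  have h2 := hK i k ((Finset.le_sup (Finset.mem_univ i)).trans hk) _
    (coherentPrefixes_of_prefix hq2 ((List.prefix_append_right_inj _).2 hc))
  have h3 := hK i k ((Finset.le_sup (Finset.mem_univ i)).trans hk) _
    (coherentPrefixes_of_prefix hq2 (List.prefix_append _ _))
  rw [iterWord_append, abel_append, piLevel_add, Pi.add_apply] at h2
  rw [Real.norm_eq_abs]
  rw [abs_le] at h2 h3 ⊢
  constructor <;> linarith [h2.1, h2.2, h3.1, h3.2]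

end Convergence

/-! ### Standing assumptions and coordinates on boxes -/

section Hypotheses

variable {d : ℕ}

/-- The standing assumptions: two-sided primitivity, the tiling condition, and compactness of the
Rauzy fractals. -/
structure CodingHypotheses (σ : ℤ → UnimodularSubstitution d) (u v : Fin d → ℝ) : Prop where
  two_le : 2 ≤ d
  primitive : IsTwoSidedPrimitive σ
  tiling : TilingCondition σ u v
  compact : ∀ n : ℤ, IsCompact (rauzyFractal σ u v n)

variable {σ : ℤ → UnimodularSubstitution d} {u v : Fin d → ℝ}

theorem CodingHypotheses.pairing_pos (h : CodingHypotheses σ u v) : 0 < u ⬝ᵥ v :=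
  dotProduct_pos_of_eigenvectors h.primitive.2 h.tiling.2.1 h.tiling.2.2.1

theorem CodingHypotheses.leftVec_pos (h : CodingHypotheses σ u v) (n : ℤ) (a : Fin d) :
    0 < leftVec σ v n a :=
  SAdic.leftVec_pos h.primitive.2 h.tiling.2.2.1 n a

variable (σ u v) in
/-- The product of the projection of the segment of a letter with a set of points. -/
noncomputable def productBox (n : ℤ) (a : Fin d) (Y : Set (Fin d → ℝ)) : Set (Fin d → ℝ) :=
  image2 (fun s r => s - r) (piTildeLevel σ u v n '' letterSegment a) Y

theorem rauzyBox_eq_productBox (n : ℤ) (a : Fin d) :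
    rauzyBox σ u v n a = productBox σ u v n a (rauzySubtile σ u v n a) := rfl

theorem edgeBox_eq_productBox (n : ℤ) (e : PrefixEdge d) :
    edgeBox σ u v n e = productBox σ u v n e.src (edgeSubtile σ u v n e) := rfl

theorem productBox_mono {n : ℤ} {a : Fin d} {Y Y' : Set (Fin d → ℝ)} (h : Y ⊆ Y') :
    productBox σ u v n a Y ⊆ productBox σ u v n a Y' := image2_subset_left h

theorem isCompact_productBox {n : ℤ} {a : Fin d} {Y : Set (Fin d → ℝ)} (hY : IsCompact Y) :
    IsCompact (productBox σ u v n a Y) := by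
  have h1 : IsCompact (letterSegment a : Set (Fin d → ℝ)) := by
    rw [letterSegment, segment_eq_image']
    exact isCompact_Icc.image (by fun_prop)
  have h2 : Continuous (piTildeLevel σ u v n) := by
    have : piTildeLevel σ u v n = fun x => (x ⬝ᵥ leftVec σ v n / u ⬝ᵥ v) • rightVec σ u n :=
      funext fun x => piTildeLevel_eq σ u v n x
    rw [this]
    unfold dotProduct
    fun_prop
  rw [productBox, ← image_uncurry_prod]
  exact ((h1.image h2).prod hY).image (by unfold Function.uncurry; fun_prop)

/-- Positivity of v_n(a) permits rescaling the segment parameter to the range [0, v_n(a)]. When `Y`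
is orthogonal to v_n, this t is the pairing of x with v_n. -/
theorem CodingHypotheses.mem_productBox (h : CodingHypotheses σ u v) {n : ℤ} {a : Fin d}
    {Y : Set (Fin d → ℝ)} {x : Fin d → ℝ} : x ∈ productBox σ u v n a Y ↔
    ∃ t ∈ Icc (0 : ℝ) (leftVec σ v n a), ∃ y ∈ Y, x = (t / u ⬝ᵥ v) • rightVec σ u n - y := by
  have h1 : ∀ t : ℝ, piTildeLevel σ u v n (t • Pi.single a 1) =
      (t * leftVec σ v n a / u ⬝ᵥ v) • rightVec σ u n := fun t => by
    rw [piTildeLevel_eq, smul_dotProduct, single_one_dotProduct, smul_eq_mul]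
  have hpos := h.leftVec_pos n a
  rw [productBox, letterSegment, segment_eq_image', image_image]
  simp only [sub_zero, zero_add, mem_image2, mem_image, h1]
  constructor
  · rintro ⟨_, ⟨t, ht, rfl⟩, y, hy, rfl⟩
    exact ⟨t * leftVec σ v n a, ⟨mul_nonneg ht.1 hpos.le, mul_le_of_le_one_left hpos.le ht.2⟩,
      y, hy, rfl⟩
  · rintro ⟨t, ht, y, hy, rfl⟩
    refine ⟨_, ⟨t / leftVec σ v n a, ⟨div_nonneg ht.1 hpos.le, (div_le_one hpos).2 ht.2⟩, rfl⟩,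
      y, hy, ?_⟩
    rw [div_mul_cancel₀ _ hpos.ne']

end Hypotheses

/-! ### Affine maps of edges and scaling of the expanding direction -/

section Homeomorphisms

variable {d : ℕ}

/-- The homeomorphism given by an invertible matrix. -/
noncomputable def matHomeo (A : Matrix (Fin d) (Fin d) ℝ) (hA : IsUnit A.det) :
    (Fin d → ℝ) ≃ₜ (Fin d → ℝ) where
  toFun := A.mulVec
  invFun := A⁻¹.mulVec
  left_inv x := by simp [Matrix.mulVec_mulVec, Matrix.nonsing_inv_mul _ hA]
  right_inv x := by simp [Matrix.mulVec_mulVec, Matrix.mul_nonsing_inv _ hA]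
  continuous_toFun := Continuous.matrix_mulVec continuous_const continuous_id
  continuous_invFun := Continuous.matrix_mulVec continuous_const continuous_id

variable (σ : ℤ → UnimodularSubstitution d) (u v : Fin d → ℝ)

/-- The map `x ↦ M_{σ_n}⁻¹ (x + ℓ(p))` of an edge `(a, p, b)`. -/
noncomputable def step (n : ℤ) (e : PrefixEdge d) : (Fin d → ℝ) ≃ₜ (Fin d → ℝ) :=
  (Homeomorph.addRight (abel e.word)).trans (matHomeo (incR (σ n)) (isUnit_det_incR _)).symm

theorem incR_mulVec_step (n : ℤ) (e : PrefixEdge d) (x : Fin d → ℝ) :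
    (incR (σ n)).mulVec (step σ n e x) = x + abel e.word :=
  (matHomeo (incR (σ n)) (isUnit_det_incR _)).apply_symm_apply _

theorem step_eq_iff {n : ℤ} {e : PrefixEdge d} {x y : Fin d → ℝ} :
    step σ n e x = y ↔ x + abel e.word = (incR (σ n)).mulVec y := by
  rw [← incR_mulVec_step]
  exact (matHomeo (incR (σ n)) (isUnit_det_incR _)).injective.eq_iff.symm

/-- The linear map that scales the direction of `u_n` and fixes the hyperplane orthogonal to
`v_n`. -/
noncomputable def scaleMap (n : ℤ) (r : ℝ) (x : Fin d → ℝ) : Fin d → ℝ :=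
  x + ((r - 1) * (x ⬝ᵥ leftVec σ v n) / u ⬝ᵥ v) • rightVec σ u n

variable {σ u v}

theorem scaleMap_scaleMap (hc : 0 < u ⬝ᵥ v) (n : ℤ) {r s : ℝ} (hrs : r * s = 1)
    (x : Fin d → ℝ) : scaleMap σ u v n r (scaleMap σ u v n s x) = x := by
  have h1 : scaleMap σ u v n s x ⬝ᵥ leftVec σ v n = s * (x ⬝ᵥ leftVec σ v n) := by
    rw [scaleMap, add_dotProduct, smul_dotProduct, rightVec_dotProduct_leftVec, smul_eq_mul,
      div_mul_cancel₀ _ hc.ne']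
    ring
  rw [scaleMap, h1, scaleMap, add_assoc, ← add_smul, ← add_div]
  have h2 : (s - 1) * (x ⬝ᵥ leftVec σ v n) + (r - 1) * (s * (x ⬝ᵥ leftVec σ v n)) = 0 := by
    linear_combination (x ⬝ᵥ leftVec σ v n) * hrs
  rw [h2]
  simp

theorem continuous_scaleMap (n : ℤ) (r : ℝ) : Continuous (scaleMap σ u v n r) := by
  unfold scaleMap dotProduct
  fun_prop

/-- Scaling of the direction of `u_n` as a homeomorphism. -/
noncomputable def scaleHomeo (σ : ℤ → UnimodularSubstitution d) {u v : Fin d → ℝ}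
    (hc : 0 < u ⬝ᵥ v) (n : ℤ) {r : ℝ} (hr : r ≠ 0) : (Fin d → ℝ) ≃ₜ (Fin d → ℝ) where
  toFun := scaleMap σ u v n r
  invFun := scaleMap σ u v n r⁻¹
  left_inv := scaleMap_scaleMap hc n (inv_mul_cancel₀ hr)
  right_inv := scaleMap_scaleMap hc n (mul_inv_cancel₀ hr)
  continuous_toFun := continuous_scaleMap n r
  continuous_invFun := continuous_scaleMap n _

theorem interior_nonempty_of_image_subset {X : Type*} [TopologicalSpace X] (H : X ≃ₜ X)
    {A B : Set X} (hA : (interior A).Nonempty) (h : H '' A ⊆ B) : (interior B).Nonempty := by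
  have h1 : H '' interior A ⊆ interior B := by
    rw [H.image_interior]
    exact interior_mono h
  exact (hA.image H).mono h1

theorem image_mem_interior {X : Type*} [TopologicalSpace X] (H : X ≃ₜ X)
    {A B : Set X} (h : ∀ x ∈ A, H x ∈ B) {x : X} (hx : x ∈ interior A) : H x ∈ interior B := by
  have h1 : H '' interior A ⊆ interior B := by
    rw [H.image_interior]
    exact interior_mono (image_subset_iff.2 h)
  exact h1 (mem_image_of_mem _ hx)

end Homeomorphisms

/-! ### The Markov inclusion and nonempty interiors -/

section Boxes

variable {d : ℕ} {σ : ℤ → UnimodularSubstitution d} {u v : Fin d → ℝ}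

theorem abel_le_of_prefix {p q : List (Fin d)} (h : p <+: q) : abel p ≤ abel q := by
  obtain ⟨t, rfl⟩ := h
  rw [abel_append]
  exact le_add_of_nonneg_right (abel_nonneg t)

namespace CodingHypotheses

variable (h : CodingHypotheses σ u v)

include h

/-- Since pa is a prefix of σ_n(b), one has ⟨ℓ(p), v_n⟩ + v_n(a) ≤ ⟨M_{σ_n} e_b, v_n⟩ = v_{n+1}(b).
-/
theorem add_dotProduct_mem_Icc {n : ℤ} {e : PrefixEdge d} (he : e ∈ edgeSet (σ n)) {t : ℝ}
    (ht : t ∈ Icc 0 (leftVec σ v n e.src)) :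
    t + abel e.word ⬝ᵥ leftVec σ v n ∈ Icc 0 (leftVec σ v (n + 1) e.rng) := by
  have hv : 0 ≤ leftVec σ v n := fun a => (h.leftVec_pos n a).le
  have h0 : 0 ≤ abel e.word ⬝ᵥ leftVec σ v n := dotProduct_nonneg_of_nonneg (abel_nonneg _) hv
  refine ⟨add_nonneg ht.1 h0, ?_⟩
  have h1 : abel (e.word ++ [e.src]) ⬝ᵥ leftVec σ v n ≤
      abel ((σ n).apply [e.rng]) ⬝ᵥ leftVec σ v n := by
    refine dotProduct_le_dotProduct_of_nonneg_right (abel_le_of_prefix ?_) hv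
    rw [(σ n).apply_singleton]
    exact he
  rw [abel_apply, incR_mulVec_dotProduct_leftVec, abel_append, abel_singleton, abel_singleton,
    add_dotProduct, single_one_dotProduct, single_one_dotProduct] at h1
  linarith [ht.2]

/-- The map of an edge sends the product of a segment and a subtile of the edge into the
corresponding box of the next level. -/
theorem step_mem_productBox {n : ℤ} {e : PrefixEdge d} (he : e ∈ edgeSet (σ n))
    {Y : Set (Fin d → ℝ)} {x : Fin d → ℝ}
    (hx : x ∈ productBox σ u v n e.src
      ((fun y => piLevel σ u v n (abel e.word) + (incR (σ n)).mulVec y) '' Y)) :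
    step σ n e x ∈ productBox σ u v (n + 1) e.rng Y := by
  rw [h.mem_productBox] at hx ⊢
  obtain ⟨t, ht, _, ⟨y, hy, rfl⟩, rfl⟩ := hx
  refine ⟨_, h.add_dotProduct_mem_Icc he ht, y, hy, ?_⟩
  rw [step_eq_iff, Matrix.mulVec_sub, Matrix.mulVec_smul, incR_mulVec_rightVec, piLevel_eq,
    add_div, add_smul]
  ext i
  simp only [Pi.add_apply, Pi.sub_apply, Pi.smul_apply, smul_eq_mul]
  ring

theorem step_mem_rauzyBox {n : ℤ} {e : PrefixEdge d} (he : e ∈ edgeSet (σ n))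
    {x : Fin d → ℝ} (hx : x ∈ edgeBox σ u v n e) :
    step σ n e x ∈ rauzyBox σ u v (n + 1) e.rng := by
  rw [edgeBox_eq_productBox, edgeSubtile_eq] at hx
  exact h.step_mem_productBox he hx

omit h in
theorem edgeBox_subset_rauzyBox {n : ℤ} {e : PrefixEdge d} (he : e ∈ edgeSet (σ n)) :
    edgeBox σ u v n e ⊆ rauzyBox σ u v n e.src :=
  productBox_mono (edgeSubtile_subset he)

theorem isCompact_edgeBox (n : ℤ) (e : PrefixEdge d) : IsCompact (edgeBox σ u v n e) :=
  isCompact_productBox (isCompact_edgeSubtile (h.compact (n + 1)) e)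

/-- Applying M_{σ_n}, scaling the u_n direction by v_n(a)/v_{n+1}(b), and translating by −`w` is a
homeomorphism that carries the upper box into the lower one. -/
theorem interior_productBox_nonempty {n : ℤ} {b : Fin d} {Y : Set (Fin d → ℝ)}
    (hY : ∀ y ∈ Y, y ⬝ᵥ leftVec σ v (n + 1) = 0)
    (hint : (interior (productBox σ u v (n + 1) b Y)).Nonempty) (a : Fin d) (w : Fin d → ℝ) :
    (interior (productBox σ u v n a ((fun y => w + (incR (σ n)).mulVec y) '' Y))).Nonempty := by
  have hc := h.pairing_pos
  have ha := h.leftVec_pos n a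
  have hb := h.leftVec_pos (n + 1) b
  have hr : leftVec σ v n a / leftVec σ v (n + 1) b ≠ 0 := (div_pos ha hb).ne'
  refine interior_nonempty_of_image_subset
    ((matHomeo (incR (σ n)) (isUnit_det_incR _)).trans
      ((scaleHomeo σ hc n hr).trans (Homeomorph.addRight (-w)))) hint ?_
  rintro _ ⟨x, hx, rfl⟩
  rw [h.mem_productBox] at hx ⊢
  obtain ⟨t, ht, y, hy, rfl⟩ := hx
  refine ⟨leftVec σ v n a / leftVec σ v (n + 1) b * t,
    ⟨mul_nonneg (div_pos ha hb).le ht.1, ?_⟩, _, ⟨y, hy, rfl⟩, ?_⟩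
  · rw [div_mul_eq_mul_div, div_le_iff₀ hb]
    exact mul_le_mul_of_nonneg_left ht.2 ha.le
  · change scaleMap σ u v n _ ((incR (σ n)).mulVec _) + -w = _
    rw [scaleMap, incR_mulVec_dotProduct_leftVec, sub_dotProduct, hY y hy, smul_dotProduct,
      rightVec_dotProduct_leftVec, smul_eq_mul, div_mul_cancel₀ _ hc.ne', sub_zero,
      Matrix.mulVec_sub, Matrix.mulVec_smul, incR_mulVec_rightVec]
    ext i
    simp only [Pi.add_apply, Pi.sub_apply, Pi.smul_apply, Pi.neg_apply, smul_eq_mul]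
    ring

theorem rauzySubtile_dotProduct_leftVec {n : ℤ} {a : Fin d} {y : Fin d → ℝ}
    (hy : y ∈ rauzySubtile σ u v n a) : y ⬝ᵥ leftVec σ v n = 0 :=
  rauzyFractal_dotProduct_leftVec h.pairing_pos (rauzySubtile_subset_rauzyFractal n a hy)

theorem interior_rauzyBox_nonempty_of_mem {n : ℤ} {a b : Fin d} (hab : a ∈ (σ n).image b)
    (hint : (interior (rauzyBox σ u v (n + 1) b)).Nonempty) :
    (interior (rauzyBox σ u v n a)).Nonempty := by
  obtain ⟨p, q, hpq⟩ := List.append_of_mem hab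
  have he : (⟨a, p, b⟩ : PrefixEdge d) ∈ edgeSet (σ n) := ⟨q, by rw [hpq]; simp⟩
  have h1 := h.interior_productBox_nonempty
    (fun y hy => h.rauzySubtile_dotProduct_leftVec hy) hint a (piLevel σ u v n (abel p))
  exact h1.mono (interior_mono (edgeBox_subset_rauzyBox he))

/-- Baire gives one box with interior at level n + j. When the block from n to n + j is positive,
this box pulls back to every letter of level n. -/
theorem interior_rauzyBox_nonempty (n : ℤ) (a : Fin d) :
    (interior (rauzyBox σ u v n a)).Nonempty := by
  obtain ⟨j, -, hj⟩ := exists_mem_iterWord σ h.primitive.1 n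
  have hB := h.tiling.2.2.2 (n + j)
  have : Nonempty (Fin d) := ⟨a⟩
  obtain ⟨⟨z, b⟩, hzb⟩ := nonempty_interior_of_iUnion_of_closed hB.1 hB.2.1
  have h1 : (interior (rauzyBox σ u v (n + j) b)).Nonempty := by
    refine interior_nonempty_of_image_subset
      (Homeomorph.addLeft (fun j => (z j : ℝ))).symm hzb ?_
    rintro _ ⟨_, ⟨y, hy, rfl⟩, rfl⟩
    change -(fun j => (z j : ℝ)) + ((fun j => (z j : ℝ)) + y) ∈ _
    rwa [neg_add_cancel_left]
  have key : ∀ (j : ℕ) (n : ℤ) (a : Fin d), a ∈ iterWord σ n j [b] →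
      (interior (rauzyBox σ u v (n + j) b)).Nonempty →
      (interior (rauzyBox σ u v n a)).Nonempty := by
    intro j
    induction j with
    | zero =>
      intro n a ha hi
      obtain rfl : a = b := by simpa [iterWord] using ha
      simpa using hi
    | succ j ih =>
      intro n a ha hi
      obtain ⟨c, hc, hac⟩ := List.mem_flatMap.1 ha
      refine h.interior_rauzyBox_nonempty_of_mem hac (ih (n + 1) c hc ?_)
      rwa [show n + 1 + (j : ℤ) = n + ((j + 1 : ℕ) : ℤ) by push_cast; ring]
  exact key j n a (hj a b) h1

end CodingHypotheses

end Boxes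

/-! ### Orbits that follow finite paths -/

section Paths

variable {d : ℕ} (σ : ℤ → UnimodularSubstitution d) (u v : Fin d → ℝ)

/-- The part of a subtile that is determined by the first edges of a path. -/
noncomputable def tailTile (e : ℤ → PrefixEdge d) : ℤ → ℕ → Set (Fin d → ℝ)
  | k, 0 => rauzySubtile σ u v k (e k).src
  | k, j + 1 => (fun y => piLevel σ u v k (abel (e k).word) + (incR (σ k)).mulVec y) ''
      tailTile e (k + 1) j

variable {σ u v} {e : ℤ → PrefixEdge d} (he : e ∈ (bratteli σ).edgeShift 0)

include he

theorem mem_edgeSet_of_path (k : ℤ) : e k ∈ edgeSet (σ k) :=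
  (((bratteli σ).mem_edgeShift_zero e).1 he k).1

theorem rng_eq_src_of_path (k : ℤ) : (e k).rng = (e (k + 1)).src :=
  (((bratteli σ).mem_edgeShift_zero e).1 he k).2

theorem tailTile_one (k : ℤ) : tailTile σ u v e k 1 = edgeSubtile σ u v k (e k) := by
  rw [tailTile, tailTile, ← rng_eq_src_of_path he, edgeSubtile_eq]

theorem tailTile_succ_subset (k : ℤ) (j : ℕ) :
    tailTile σ u v e k (j + 1) ⊆ tailTile σ u v e k j := by
  induction j generalizing k with
  | zero =>
    rw [zero_add, tailTile_one he, tailTile]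
    exact edgeSubtile_subset (mem_edgeSet_of_path he k)
  | succ j ih =>
    rw [tailTile, tailTile]
    exact image_mono (ih (k + 1))

theorem tailTile_subset_edgeSubtile (k : ℤ) (j : ℕ) :
    tailTile σ u v e k (j + 1) ⊆ edgeSubtile σ u v k (e k) := by
  induction j with
  | zero => rw [zero_add, tailTile_one he]
  | succ j ih => exact (tailTile_succ_subset he k (j + 1)).trans ih

theorem CodingHypotheses.tailTile_dotProduct_leftVec (h : CodingHypotheses σ u v) (k : ℤ) (j : ℕ)
    {y : Fin d → ℝ} (hy : y ∈ tailTile σ u v e k j) : y ⬝ᵥ leftVec σ v k = 0 := by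
  cases j with
  | zero => exact h.rauzySubtile_dotProduct_leftVec hy
  | succ j =>
    exact h.rauzySubtile_dotProduct_leftVec
      (edgeSubtile_subset (mem_edgeSet_of_path he k) (tailTile_subset_edgeSubtile he k j hy))

/-- The interior of the Rauzy box at the end of the finite path is pulled back one edge at a time.
-/
theorem CodingHypotheses.interior_tailBox_nonempty (h : CodingHypotheses σ u v) (k : ℤ) (j : ℕ) :
    (interior (productBox σ u v k (e k).src (tailTile σ u v e k j))).Nonempty := by
  induction j generalizing k with
  | zero => exact h.interior_rauzyBox_nonempty k (e k).src
  | succ j ih =>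
    exact h.interior_productBox_nonempty
      (fun y hy => h.tailTile_dotProduct_leftVec he (k + 1) j hy) (ih (k + 1)) _ _

/-- There are points whose orbits follow a given finite part of a path in the interiors of the
boxes of its edges. -/
theorem CodingHypotheses.exists_orbit (h : CodingHypotheses σ u v) (k : ℤ) (N : ℕ) :
    ∃ x : ℕ → Fin d → ℝ, (∀ i, x (i + 1) = step σ (k + i) (e (k + i)) (x i)) ∧
      ∀ i ≤ N, x i ∈ interior (edgeBox σ u v (k + i) (e (k + i))) := by
  obtain ⟨x₀, hx₀⟩ := h.interior_tailBox_nonempty he k (N + 1)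
  let x : ℕ → Fin d → ℝ := fun i => Nat.rec x₀ (fun i y => step σ (k + i) (e (k + i)) y) i
  -- After i steps N + 1 − i edges remain prescribed. For i ≤ N at least one remains, which places
  -- the point in the current edge box.
  have hx : ∀ i j, i + j = N + 1 → x i ∈ interior
      (productBox σ u v (k + i) (e (k + i)).src (tailTile σ u v e (k + i) j)) := by
    intro i
    induction i with
    | zero =>
      intro j hj
      obtain rfl : j = N + 1 := by omega
      simp only [Nat.cast_zero, add_zero]
      exact hx₀
    | succ i ih =>
      intro j hj
      have h1 := ih (j + 1) (by omega)
      have h2 := image_mem_interior (step σ (k + i) (e (k + i)))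
        (fun y hy => h.step_mem_productBox (mem_edgeSet_of_path he (k + i)) hy) h1
      rw [rng_eq_src_of_path he] at h2
      rw [show k + ((i + 1 : ℕ) : ℤ) = k + i + 1 by push_cast; ring]
      exact h2
  refine ⟨x, fun i => rfl, fun i hi => ?_⟩
  obtain ⟨j, hj⟩ := Nat.exists_eq_add_of_le hi
  refine interior_mono (productBox_mono (tailTile_subset_edgeSubtile he (k + i) j))
    (hx i (j + 1) (by omega))

end Paths

/-! ### Integer vectors and disjointness of interiors -/

section IntegerVectors

variable {d : ℕ}

/-- An integer vector as a real vector. -/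
def intVec (z : Fin d → ℤ) : Fin d → ℝ := fun j => (z j : ℝ)

/-- The abelianization of a word as an integer vector. -/
def abelInt (w : List (Fin d)) : Fin d → ℤ := fun a => (w.count a : ℤ)

theorem intVec_abelInt (w : List (Fin d)) : intVec (abelInt w) = abel w := by
  ext a; simp [intVec, abelInt, abel]

theorem intVec_zero : intVec (0 : Fin d → ℤ) = 0 := by ext; simp [intVec]

theorem intVec_sub (z z' : Fin d → ℤ) : intVec (z - z') = intVec z - intVec z' := by
  ext; simp [intVec]

theorem intVec_injective : Function.Injective (intVec : (Fin d → ℤ) → Fin d → ℝ) := by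
  intro z z' h
  ext j
  have := congrFun h j
  simpa [intVec] using this

theorem map_mulVec_intVec (M : Matrix (Fin d) (Fin d) ℤ) (z : Fin d → ℤ) :
    (M.map (Int.cast : ℤ → ℝ)).mulVec (intVec z) = intVec (M.mulVec z) := by
  ext i
  simp [intVec, Matrix.mulVec, dotProduct]

theorem incR_mulVec_intVec (s : UnimodularSubstitution d) (z : Fin d → ℤ) :
    (incR s).mulVec (intVec (s.incidence⁻¹.mulVec z)) = intVec z := by
  rw [incR, map_mulVec_intVec, Matrix.mulVec_mulVec,
    Matrix.mul_nonsing_inv _ (isUnit_det_incidence s), Matrix.one_mulVec]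

theorem incR_mulVec_injective (s : UnimodularSubstitution d) :
    Function.Injective (incR s).mulVec :=
  (matHomeo (incR s) (isUnit_det_incR s)).injective

/-- Sets that meet in a null set have disjoint interiors. -/
theorem not_mem_interior_of_volume_inter_eq_zero {A B : Set (Fin d → ℝ)} {z x' : Fin d → ℝ}
    (h : volume (A ∩ (fun y => z + y) '' B) = 0) (hx : z + x' ∈ interior A) :
    x' ∉ interior B := by
  intro hx'
  have h1 : IsOpen (interior A ∩ (Homeomorph.addLeft z) '' interior B) :=
    isOpen_interior.inter ((Homeomorph.addLeft z).isOpenMap _ isOpen_interior)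
  have h2 : (interior A ∩ (Homeomorph.addLeft z) '' interior B).Nonempty :=
    ⟨z + x', hx, x', hx', rfl⟩
  refine (h1.measure_pos volume h2).ne' (measure_mono_null ?_ h)
  exact inter_subset_inter interior_subset (image_mono interior_subset)

end IntegerVectors

/-! ### The tiling by edge boxes, null boundaries, and closeness of orbits -/

section Tilings

variable {d : ℕ} {σ : ℤ → UnimodularSubstitution d} {u v : Fin d → ℝ}

theorem prefixEdge_eq_of_length {s : UnimodularSubstitution d} {e e' : PrefixEdge d}
    (he : e ∈ edgeSet s) (he' : e' ∈ edgeSet s) (hr : e.rng = e'.rng)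
    (hl : e.word.length = e'.word.length) : e = e' := by
  have h1 : (e'.word ++ [e'.src]) <+: s.image e.rng := by rw [hr]; exact he'
  have h2 := List.prefix_of_prefix_length_le he h1 (by simp [hl])
  have h3 := h2.eq_of_length (by simp [hl])
  obtain ⟨h4, h5⟩ := List.append_inj h3 hl
  exact PrefixEdge.ext (by simpa using h5) h4 hr

theorem abelInt_injective_length {w w' : List (Fin d)} (h : abelInt w = abelInt w') :
    w.length = w'.length := by
  have h1 := sum_abel w
  rw [← intVec_abelInt, h, intVec_abelInt, sum_abel] at h1
  exact_mod_cast h1.symm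

namespace CodingHypotheses

variable (h : CodingHypotheses σ u v)

include h

theorem volume_rauzyBox_inter {n : ℤ} {a a' : Fin d} {z : Fin d → ℤ}
    (hne : z = 0 → a ≠ a') :
    volume (rauzyBox σ u v n a ∩ (fun y => intVec z + y) '' rauzyBox σ u v n a') = 0 := by
  have h1 := (h.tiling.2.2.2 n).2.2 (0, a) (z, a') (by
    intro heq
    rw [Prod.mk.injEq] at heq
    exact hne heq.1.symm heq.2)
  have h2 : (fun y : Fin d → ℝ => (fun j => (((0 : Fin d → ℤ) j : ℤ) : ℝ)) + y) = id := by
    ext y j; simp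
  simp only [h2, image_id] at h1
  exact h1

/-- Different sources or a nonzero translation reduce to the Rauzy tiling of level n. Otherwise the
two edge maps send the overlap into an overlap of Rauzy boxes of level n + 1, and these are distinct
tiles because the edges differ. -/
theorem volume_edgeBox_inter {n : ℤ} {e e' : PrefixEdge d} (he : e ∈ edgeSet (σ n))
    (he' : e' ∈ edgeSet (σ n)) {z : Fin d → ℤ} (hne : z = 0 → e ≠ e') :
    volume (edgeBox σ u v n e ∩ (fun y => intVec z + y) '' edgeBox σ u v n e') = 0 := by
  by_cases hz : z = 0 → e.src ≠ e'.src
  · exact measure_mono_null (inter_subset_inter (edgeBox_subset_rauzyBox he)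
      (image_mono (edgeBox_subset_rauzyBox he'))) (h.volume_rauzyBox_inter hz)
  push Not at hz
  obtain ⟨rfl, -⟩ := hz
  have hne := hne rfl
  -- The two edge maps differ by the translation `y`, integral by unimodularity. If `y` = 0 and the
  -- ranges agree, both words are prefixes of the same image and have equal length, so the edges
  -- coincide.
  set y := (σ n).incidence⁻¹.mulVec (abelInt e.word - abelInt e'.word) with hy
  have hMy : (incR (σ n)).mulVec (intVec y) = abel e.word - abel e'.word := by
    rw [hy, incR_mulVec_intVec, intVec_sub, intVec_abelInt, intVec_abelInt]
  have hnull : volume (rauzyBox σ u v (n + 1) e.rng ∩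
      (fun w => intVec y + w) '' rauzyBox σ u v (n + 1) e'.rng) = 0 := by
    refine h.volume_rauzyBox_inter fun hy0 hr => hne (prefixEdge_eq_of_length he he' hr ?_)
    rw [hy0, intVec_zero, Matrix.mulVec_zero, ← intVec_abelInt, ← intVec_abelInt,
      eq_comm, sub_eq_zero] at hMy
    exact abelInt_injective_length (intVec_injective hMy)
  have hdiff : DifferentiableOn ℝ (fun w => (incR (σ n)).mulVec w - abel e.word)
      (rauzyBox σ u v (n + 1) e.rng ∩
      (fun w => intVec y + w) '' rauzyBox σ u v (n + 1) e'.rng) := by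
    have : Differentiable ℝ fun w => Matrix.toLin' (incR (σ n)) w :=
      (LinearMap.toContinuousLinearMap (Matrix.toLin' (incR (σ n)))).differentiable
    exact (this.sub_const _).differentiableOn
  refine measure_mono_null ?_
    (addHaar_image_eq_zero_of_differentiableOn_of_addHaar_eq_zero volume hdiff hnull)
  rintro _ ⟨hx, x, hx', rfl⟩
  simp only [intVec_zero, zero_add] at hx ⊢
  refine ⟨step σ n e x, ⟨h.step_mem_rauzyBox he hx, step σ n e' x,
    h.step_mem_rauzyBox he' hx', ?_⟩, ?_⟩
  · apply incR_mulVec_injective (σ n)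
    simp only [Matrix.mulVec_add, incR_mulVec_step, hMy]
    abel
  · simp only [incR_mulVec_step, add_sub_cancel_right]

theorem eq_of_mem_interior_rauzyBox {n : ℤ} {a a' : Fin d} {z : Fin d → ℤ} {x' : Fin d → ℝ}
    (hx : intVec z + x' ∈ interior (rauzyBox σ u v n a))
    (hx' : x' ∈ interior (rauzyBox σ u v n a')) : z = 0 ∧ a = a' := by
  by_contra hne
  exact not_mem_interior_of_volume_inter_eq_zero
    (h.volume_rauzyBox_inter fun hz ha => hne ⟨hz, ha⟩) hx hx'

theorem eq_of_mem_interior_edgeBox {n : ℤ} {e e' : PrefixEdge d} (he : e ∈ edgeSet (σ n))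
    (he' : e' ∈ edgeSet (σ n)) {z : Fin d → ℤ} {x' : Fin d → ℝ}
    (hx : intVec z + x' ∈ interior (edgeBox σ u v n e))
    (hx' : x' ∈ interior (edgeBox σ u v n e')) : e = e' := by
  by_contra hne
  exact not_mem_interior_of_volume_inter_eq_zero
    (h.volume_edgeBox_inter he he' fun _ => hne) hx hx'

theorem rauzyBox_subset_iUnion (n : ℤ) (a : Fin d) {x : Fin d → ℝ}
    (hx : x ∈ rauzyBox σ u v n a) : ∃ e ∈ edgeSet (σ n), x ∈ edgeBox σ u v n e := by
  obtain ⟨s, hs, y, hy, rfl⟩ := hx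
  obtain ⟨e, ⟨he, rfl⟩, hye⟩ := mem_iUnion₂.1 (rauzySubtile_subset_iUnion h.compact n a hy)
  exact ⟨e, he, s, hs, y, hye, rfl⟩

theorem exists_mem_edgeBox (n : ℤ) (x : Fin d → ℝ) :
    ∃ e ∈ edgeSet (σ n), ∃ z : Fin d → ℤ, ∃ x' ∈ edgeBox σ u v n e, x = intVec z + x' := by
  have h1 : x ∈ (univ : Set (Fin d → ℝ)) := mem_univ x
  rw [← (h.tiling.2.2.2 n).2.1, mem_iUnion] at h1
  obtain ⟨⟨z, a⟩, x', hx', rfl⟩ := h1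
  obtain ⟨e, he, hxe⟩ := h.rauzyBox_subset_iUnion n a hx'
  exact ⟨e, he, z, x', hxe, rfl⟩

theorem exists_norm_edgeBox_le (n : ℤ) :
    ∃ B : ℝ, ∀ e ∈ edgeSet (σ n), ∀ x ∈ edgeBox σ u v n e, ‖x‖ ≤ B := by
  have h1 : Bornology.IsBounded (⋃ e ∈ edgeSet (σ n), edgeBox σ u v n e) :=
    ((edgeSet_finite (σ n)).isCompact_biUnion fun e _ => h.isCompact_edgeBox n e).isBounded
  obtain ⟨B, hB⟩ := h1.exists_norm_le
  exact ⟨B, fun e he x hx => hB x (mem_biUnion he hx)⟩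

/-- The finitely many boxes are uniformly bounded, so only boundedly many integer translations reach
a unit ball. -/
theorem locallyFinite_edgeBox (n : ℤ) :
    LocallyFinite fun i : (Fin d → ℤ) × edgeSet (σ n) =>
      (fun y => intVec i.1 + y) '' edgeBox σ u v n i.2 := by
  obtain ⟨B, hB⟩ := h.exists_norm_edgeBox_le n
  have : Finite (edgeSet (σ n)) := (edgeSet_finite (σ n)).to_subtype
  intro x
  refine ⟨Metric.ball x 1, Metric.ball_mem_nhds x one_pos, ?_⟩
  set N : ℤ := ⌈‖x‖ + 1 + B⌉
  refine ((Set.finite_Icc (fun _ : Fin d => -N) fun _ => N).prod (finite_univ (α := edgeSet (σ n)))).subset ?_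
  rintro ⟨z, e⟩ ⟨_, ⟨y, hy, rfl⟩, hyx⟩
  have h1 : ∀ j, |z j| ≤ N := by
    intro j
    have h2 : ‖intVec z‖ ≤ ‖x‖ + 1 + B := by
      have h3 : intVec z = x + ((intVec z + y) - x) + -y := by abel
      rw [h3]
      refine (norm_add_le _ _).trans (add_le_add ((norm_add_le _ _).trans
        (add_le_add le_rfl ?_)) ?_)
      · rw [← dist_eq_norm]; exact (Metric.mem_ball.1 hyx).le
      · rw [norm_neg]; exact hB _ e.2 y hy
    have h4 : ((|z j| : ℤ) : ℝ) ≤ N := by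
      have h5 := norm_le_pi_norm (intVec z) j
      rw [Real.norm_eq_abs, intVec] at h5
      push_cast
      exact h5.trans (h2.trans (Int.le_ceil _))
    exact_mod_cast h4
  exact ⟨⟨fun j => (abs_le.1 (h1 j)).1, fun j => (abs_le.1 (h1 j)).2⟩, mem_univ _⟩

/-- The other tiles have a closed union, by local finiteness, and this union contains the complement
of the box. A boundary point therefore lies in a second tile, and the countably many overlaps are
null. -/
theorem volume_frontier_edgeBox {n : ℤ} {e : PrefixEdge d} (he : e ∈ edgeSet (σ n)) :
    volume (frontier (edgeBox σ u v n e)) = 0 := by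
  set T : (Fin d → ℤ) × edgeSet (σ n) → Set (Fin d → ℝ) := fun i =>
    (fun y => intVec i.1 + y) '' edgeBox σ u v n i.2 with hT
  have : Countable (edgeSet (σ n)) := (edgeSet_finite (σ n)).countable.to_subtype
  let J := {i : (Fin d → ℤ) × edgeSet (σ n) // i ≠ (0, ⟨e, he⟩)}
  have hcl : IsClosed (⋃ i : J, T i.1) := by
    refine LocallyFinite.isClosed_iUnion ((h.locallyFinite_edgeBox n).comp_injective
      Subtype.val_injective) fun i => ?_
    exact ((h.isCompact_edgeBox n i.1.2).image (by fun_prop)).isClosed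
  have hsub : frontier (edgeBox σ u v n e) ⊆ ⋃ i : J, (edgeBox σ u v n e ∩ T i.1) := by
    rw [← inter_iUnion, frontier_eq_closure_inter_closure,
      (h.isCompact_edgeBox n e).isClosed.closure_eq]
    refine inter_subset_inter_right _ (closure_minimal (fun x hx => ?_) hcl)
    obtain ⟨e', he', z, x', hx', rfl⟩ := h.exists_mem_edgeBox n x
    refine mem_iUnion.2 ⟨⟨(z, ⟨e', he'⟩), ?_⟩, x', hx', rfl⟩
    intro heq
    rw [Prod.mk.injEq, Subtype.mk.injEq] at heq
    obtain ⟨rfl, rfl⟩ := heq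
    rw [intVec_zero, zero_add] at hx
    exact hx hx'
  refine measure_mono_null hsub (measure_iUnion_null fun i => ?_)
  refine h.volume_edgeBox_inter he i.1.2.2 fun hz hee => i.2 ?_
  exact Prod.ext hz (Subtype.ext hee.symm)

/-- Points in the interiors of the boxes of consecutive edges of a path that are related by the
dynamics modulo integer vectors are related by the map of the first edge. -/
theorem eq_step_of_mem_interior {n : ℤ} {e e' : PrefixEdge d} (he : e ∈ edgeSet (σ n))
    (he' : e' ∈ edgeSet (σ (n + 1))) {x x' : Fin d → ℝ} {z : Fin d → ℤ}
    (hx : x ∈ interior (edgeBox σ u v n e)) (hx' : x' ∈ interior (edgeBox σ u v (n + 1) e'))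
    (hz : step σ n e x = intVec z + x') : step σ n e x = x' ∧ e.rng = e'.src := by
  -- The Markov inclusion puts the image in the interior of the box of `e.rng`. It also lies in the
  -- `z`-translate of the interior of the box of `e'.src`, so disjointness of interiors forces `z` =
  -- 0 and equal letters.
  have h1 := image_mem_interior (step σ n e) (fun y hy => h.step_mem_rauzyBox he hy) hx
  rw [hz] at h1
  obtain ⟨rfl, h2⟩ := h.eq_of_mem_interior_rauzyBox h1
    (interior_mono (edgeBox_subset_rauzyBox he') hx')
  rw [intVec_zero, zero_add] at hz
  exact ⟨hz, h2⟩

/-- Differences of points whose orbits stay in common boxes in the past and in the future are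
small. -/
theorem exists_norm_sub_le (n : ℤ) {ε : ℝ} (hε : 0 < ε) :
    ∃ L : ℕ, ∀ (x x' y y' : Fin d → ℝ) (a b : Fin d), x ∈ rauzyBox σ u v (n - L) a →
      x' ∈ rauzyBox σ u v (n - L) a → y ∈ rauzyBox σ u v (n + L) b →
      y' ∈ rauzyBox σ u v (n + L) b →
      x - x' = (iterMat σ (n - L) L).mulVec ((iterMat σ n L).mulVec (y - y')) →
      ‖(iterMat σ n L).mulVec (y - y')‖ ≤ ε := by
  have hc := h.pairing_pos
  set U := ‖rightVec σ u n‖ / u ⬝ᵥ v with hU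
  have hU0 : 0 ≤ U := by positivity
  obtain ⟨k, hk⟩ := exists_forall_norm_iterMat_mulVec_le h.two_le h.tiling h.compact n
    (by positivity : 0 < ε / 4)
  have h1 := tendsto_sum_leftVec h.two_le h.primitive.2 h.tiling.2.2.1
  -- The denominator uses U + 1 to stay positive without a lower bound for U.
  have h2 : ∀ᶠ j : ℕ in Filter.atTop, ∑ a, leftVec σ v (-j) a < ε / 2 / (U + 1) :=
    h1.eventually (gt_mem_nhds (by positivity))
  obtain ⟨j, hj⟩ := Filter.eventually_atTop.1 h2
  -- L ≥ k serves the contraction of the fractals, and n − L ≤ −j makes v_{n−L} small.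
  refine ⟨max k (j + n.natAbs), ?_⟩
  set L := max k (j + n.natAbs) with hL
  intro x x' y y' a b hx hx' hy hy' hxy
  rw [rauzyBox_eq_productBox, h.mem_productBox] at hx hx' hy hy'
  obtain ⟨t, ht, r, hr, rfl⟩ := hx
  obtain ⟨t', ht', r', hr', rfl⟩ := hx'
  obtain ⟨s, -, q, hq, rfl⟩ := hy
  obtain ⟨s', -, q', hq', rfl⟩ := hy'
  set δ := (iterMat σ n L).mulVec ((s / u ⬝ᵥ v) • rightVec σ u (n + L) - q -
    ((s' / u ⬝ᵥ v) • rightVec σ u (n + L) - q')) with hδ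
  -- By invariance of the pairing, the component along u_n can be read off at level n − L, where
  -- both parameters lie in [0, v_{n−L}(a)].
  have hdot : δ ⬝ᵥ leftVec σ v n = t - t' := by
    have h3 := iterMat_mulVec_dotProduct_leftVec σ v (n - L) L δ
    rw [← hxy, sub_add_cancel] at h3
    rw [← h3]
    simp only [sub_dotProduct, smul_dotProduct, rightVec_dotProduct_leftVec, smul_eq_mul,
      h.rauzySubtile_dotProduct_leftVec hr, h.rauzySubtile_dotProduct_leftVec hr',
      div_mul_cancel₀ _ hc.ne', sub_zero]
  -- The projection discards the u-components, leaving images of points of the fractal of level n +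
  -- L.
  have hpi : piLevel σ u v n δ = (iterMat σ n L).mulVec q' - (iterMat σ n L).mulVec q := by
    rw [hδ, ← iterMat_mulVec_piLevel, ← Matrix.mulVec_sub, piLevel_eq]
    congr 1
    simp only [sub_dotProduct, smul_dotProduct, rightVec_dotProduct_leftVec, smul_eq_mul,
      h.rauzySubtile_dotProduct_leftVec hq, h.rauzySubtile_dotProduct_leftVec hq',
      div_mul_cancel₀ _ hc.ne', sub_zero, sub_div, sub_smul]
    abel
  have hdec : δ = piLevel σ u v n δ + ((t - t') / u ⬝ᵥ v) • rightVec σ u n := by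
    rw [piLevel_eq, hdot, sub_add_cancel]
  have hpi_le : ‖piLevel σ u v n δ‖ ≤ ε / 2 := by
    rw [hpi]
    refine (norm_sub_le _ _).trans ?_
    have h3 := hk L (le_max_left _ _) q (rauzySubtile_subset_rauzyFractal _ _ hq)
    have h4 := hk L (le_max_left _ _) q' (rauzySubtile_subset_rauzyFractal _ _ hq')
    linarith
  have htt : |t - t'| ≤ ε / 2 / (U + 1) := by
    obtain ⟨m, hm⟩ : ∃ m : ℕ, n - L = -(m : ℤ) := ⟨(L - n).toNat, by omega⟩
    have h3 := hj m (by omega)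
    rw [← hm] at h3
    have h4 : leftVec σ v (n - L) a ≤ ∑ a, leftVec σ v (n - L) a :=
      Finset.single_le_sum (fun b _ => (h.leftVec_pos _ b).le) (Finset.mem_univ a)
    rw [abs_le]
    constructor <;> linarith [ht.1, ht.2, ht'.1, ht'.2]
  rw [hdec]
  refine (norm_add_le _ _).trans ?_
  have h5 : ‖((t - t') / u ⬝ᵥ v) • rightVec σ u n‖ = |t - t'| * U := by
    rw [norm_smul, Real.norm_eq_abs, abs_div, abs_of_pos hc, hU]
    ring
  have h6 : |t - t'| * U ≤ ε / 2 := by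
    calc |t - t'| * U ≤ (ε / 2 / (U + 1)) * (U + 1) :=
          mul_le_mul htt (by linarith) hU0 (by positivity)
      _ = ε / 2 := by field_simp
  linarith

end CodingHypotheses

end Tilings

/-! ### The mapping family on the tori -/

section Torus

variable {d : ℕ}

theorem continuous_toTorus : Continuous (toTorus : (Fin d → ℝ) → UnitAddTorus (Fin d)) :=
  continuous_pi fun i => (AddCircle.continuous_mk' 1).comp (continuous_apply i)

theorem toTorus_add (x y : Fin d → ℝ) : toTorus (x + y) = toTorus x + toTorus y := by
  ext i; simp [toTorus]

theorem toTorus_sub (x y : Fin d → ℝ) : toTorus (x - y) = toTorus x - toTorus y := by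
  ext i; simp [toTorus]

theorem toTorus_eq_zero_iff {x : Fin d → ℝ} : toTorus x = 0 ↔ ∃ z, x = intVec z := by
  constructor
  · intro h
    have h1 : ∀ i, ∃ n : ℤ, n • (1 : ℝ) = x i := fun i =>
      (AddCircle.coe_eq_zero_iff 1).1 (congrFun h i)
    choose z hz using h1
    exact ⟨z, funext fun i => by rw [← hz i]; simp [intVec]⟩
  · rintro ⟨z, rfl⟩
    ext i
    exact (AddCircle.coe_eq_zero_iff 1).2 ⟨z i, by simp [intVec]⟩

theorem toTorus_eq_iff {x y : Fin d → ℝ} : toTorus x = toTorus y ↔ ∃ z, x = intVec z + y := by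
  rw [← sub_eq_zero, ← toTorus_sub, toTorus_eq_zero_iff]
  simp only [sub_eq_iff_eq_add]

theorem toTorus_surjective : Function.Surjective (toTorus : (Fin d → ℝ) → _) := by
  intro x
  choose y hy using fun i => QuotientAddGroup.mk_surjective (x i)
  exact ⟨y, funext hy⟩

theorem dist_toTorus_le (x y : Fin d → ℝ) : dist (toTorus x) (toTorus y) ≤ ‖x - y‖ := by
  rw [dist_pi_le_iff (norm_nonneg _)]
  intro i
  rw [dist_eq_norm]
  refine le_trans ?_ (norm_le_pi_norm (x - y) i)
  exact QuotientAddGroup.norm_mk_le_norm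

theorem torusAct_toTorus (M : Matrix (Fin d) (Fin d) ℤ) (x : Fin d → ℝ) :
    torusAct M (toTorus x) = toTorus ((M.map (Int.cast : ℤ → ℝ)).mulVec x) := by
  ext i
  simp only [torusAct, toTorus, Matrix.mulVec, dotProduct, Matrix.map_apply]
  rw [← QuotientAddGroup.mk'_apply, map_sum]
  refine Finset.sum_congr rfl fun j _ => ?_
  rw [← zsmul_eq_mul, map_zsmul]
  rfl

theorem torusAct_mul (M N : Matrix (Fin d) (Fin d) ℤ) (x : UnitAddTorus (Fin d)) :
    torusAct (M * N) x = torusAct M (torusAct N x) := by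
  obtain ⟨x, rfl⟩ := toTorus_surjective x
  rw [torusAct_toTorus, torusAct_toTorus, torusAct_toTorus, Matrix.mulVec_mulVec]
  congr 2
  exact Matrix.map_mul_intCast _ _

theorem torusAct_one (x : UnitAddTorus (Fin d)) : torusAct 1 x = x := by
  obtain ⟨x, rfl⟩ := toTorus_surjective x
  rw [torusAct_toTorus]
  simp

theorem continuous_torusAct (M : Matrix (Fin d) (Fin d) ℤ) : Continuous (torusAct M) :=
  continuous_pi fun _ => continuous_finsetSum _ fun j _ => (continuous_apply j).zsmul _

theorem torusAct_bijective {M : Matrix (Fin d) (Fin d) ℤ} (hM : IsUnit M.det) :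
    Function.Bijective (torusAct M) := by
  refine Function.bijective_iff_has_inverse.2 ⟨torusAct M⁻¹, fun x => ?_, fun x => ?_⟩
  · rw [← torusAct_mul, Matrix.nonsing_inv_mul _ hM, torusAct_one]
  · rw [← torusAct_mul, Matrix.mul_nonsing_inv _ hM, torusAct_one]

variable (σ : ℤ → UnimodularSubstitution d)

theorem familyMap_bijective (n : ℤ) : Function.Bijective (familyMap σ n) :=
  torusAct_bijective (by
    rw [Matrix.isUnit_nonsing_inv_det_iff]; exact isUnit_det_incidence _)

theorem continuous_familyMap (n : ℤ) : Continuous (familyMap σ n) := continuous_torusAct _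

theorem familyIter_bijective (k n : ℤ) : Function.Bijective (familyIter σ k n) := by
  unfold familyIter
  split_ifs
  · exact torusAct_bijective (isUnit_det_blockMatrix σ n k)
  · exact torusAct_bijective (by
      rw [Matrix.isUnit_nonsing_inv_det_iff]; exact isUnit_det_blockMatrix _ _ _)

theorem continuous_familyIter (k n : ℤ) : Continuous (familyIter σ k n) := by
  unfold familyIter
  split_ifs <;> exact continuous_torusAct _

theorem familyIter_self (n : ℤ) (x : UnitAddTorus (Fin d)) : familyIter σ n n x = x := by
  rw [familyIter, if_pos le_rfl, blockMatrix_self, torusAct_one]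

theorem familyIter_succ (k n : ℤ) (x : UnitAddTorus (Fin d)) :
    familyIter σ k (n + 1) x = familyMap σ n (familyIter σ k n x) := by
  rw [familyMap]
  rcases lt_trichotomy n k with h | rfl | h
  · rw [familyIter, familyIter, if_pos (by omega), if_pos (by omega), ← torusAct_mul,
      blockMatrix_succ_left σ h, ← mul_assoc, Matrix.nonsing_inv_mul _ (isUnit_det_incidence _),
      one_mul]
  · rw [familyIter_self, familyIter, if_neg (by omega), blockMatrix_succ_right σ le_rfl,
      blockMatrix_self, one_mul]
  · rw [familyIter, familyIter, if_neg (by omega), if_neg (by omega), ← torusAct_mul,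
      blockMatrix_succ_right σ (by omega), Matrix.mul_inv_rev]

theorem familyIter_familyMap (k n : ℤ) (x : UnitAddTorus (Fin d)) :
    familyIter σ (k + 1) n (familyMap σ k x) = familyIter σ k n x := by
  rw [familyMap]
  rcases lt_trichotomy n (k + 1) with h | rfl | h
  · rw [familyIter, familyIter, if_pos (by omega), if_pos (by omega), ← torusAct_mul,
      blockMatrix_succ_right σ (by omega), mul_assoc,
      Matrix.mul_nonsing_inv _ (isUnit_det_incidence _), mul_one]
  · rw [familyIter_self, familyIter, if_neg (by omega), blockMatrix_succ_right σ le_rfl,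
      blockMatrix_self, one_mul]
  · rw [familyIter, familyIter, if_neg (by omega), if_neg (by omega), ← torusAct_mul,
      blockMatrix_succ_left σ (by omega : k < n), Matrix.mul_inv_rev]

/-- The translation by ℓ(p) is integral and vanishes modulo ℤ^d, so all edges of level n give lifts
of the same torus map. -/
theorem toTorus_step (n : ℤ) (e : PrefixEdge d) (x : Fin d → ℝ) :
    toTorus (step σ n e x) = familyMap σ n (toTorus x) := by
  apply (torusAct_bijective (isUnit_det_incidence (σ n))).1
  rw [familyMap, ← torusAct_mul, Matrix.mul_nonsing_inv _ (isUnit_det_incidence _), torusAct_one,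
    torusAct_toTorus]
  change toTorus ((incR (σ n)).mulVec _) = _
  rw [incR_mulVec_step, toTorus_add, toTorus_eq_zero_iff.2 ⟨_, (intVec_abelInt e.word).symm⟩,
    add_zero]

end Torus

/-! ### Cylinders, coded points, continuity and uniqueness of codes -/

section CodedSets

variable {d : ℕ} {σ : ℤ → UnimodularSubstitution d} {u v : Fin d → ℝ}

variable (σ u v) in
/-- The points of the torus of level `n` that follow the edges of index `|k| ≤ l` of a path in the
interiors of their boxes. -/
def cylinderSet (n : ℤ) (e : ℤ → PrefixEdge d) (l : ℕ) : Set (UnitAddTorus (Fin d)) :=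
  ⋂ k ∈ {k : ℤ | |k| ≤ l}, familyIter σ k n '' (toTorus '' interior (edgeBox σ u v k (e k)))

theorem codedSet_eq (n : ℤ) (ω : ℤ → PrefixEdge d) :
    codedSet σ u v n ω = ⋂ l : ℕ, closure (cylinderSet σ u v n (fun k => ω (k - n)) l) := rfl

theorem mem_cylinderSet {n : ℤ} {e : ℤ → PrefixEdge d} {l : ℕ} {z : UnitAddTorus (Fin d)} :
    z ∈ cylinderSet σ u v n e l ↔ ∀ k : ℤ, |k| ≤ l →
      ∃ x ∈ interior (edgeBox σ u v k (e k)), familyIter σ k n (toTorus x) = z := by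
  simp only [cylinderSet, mem_iInter, image_image]
  rfl

theorem cylinderSet_antitone (n : ℤ) (e : ℤ → PrefixEdge d) :
    Antitone (cylinderSet σ u v n e) := by
  intro l l' hl z hz
  rw [mem_cylinderSet] at hz ⊢
  exact fun k hk => hz k (hk.trans (by exact_mod_cast hl))

theorem path_of_mem_edgeShift {n : ℤ} {ω : ℤ → PrefixEdge d}
    (hω : ω ∈ (bratteli σ).edgeShift n) :
    (fun k => ω (k - n)) ∈ (bratteli σ).edgeShift 0 := by
  rw [BratteliDiagram.edgeShift_eq_image] at hω
  obtain ⟨e, he, rfl⟩ := hω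
  simpa using he

namespace CodingHypotheses

variable (h : CodingHypotheses σ u v)

include h

theorem cylinderSet_nonempty (n : ℤ) {e : ℤ → PrefixEdge d}
    (he : e ∈ (bratteli σ).edgeShift 0) (l : ℕ) : (cylinderSet σ u v n e l).Nonempty := by
  -- Starting at level −l, 2l steps cover the whole window |k| ≤ l.
  obtain ⟨x, hx, hint⟩ := h.exists_orbit he (-l) (2 * l)
  have h1 : ∀ i : ℕ, familyIter σ (-l + i) n (toTorus (x i)) =
      familyIter σ (-l) n (toTorus (x 0)) := by
    intro i
    induction i with
    | zero => simp
    | succ i ih =>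
      rw [hx, toTorus_step, Nat.cast_succ, ← add_assoc, familyIter_familyMap, ih]
  refine ⟨familyIter σ (-l) n (toTorus (x 0)), mem_cylinderSet.2 fun k hk => ?_⟩
  rw [abs_le] at hk
  obtain ⟨i, rfl⟩ : ∃ i : ℕ, k = -l + i := ⟨(k + l).toNat, by omega⟩
  exact ⟨x i, hint i (by omega), h1 i⟩

theorem codedSet_nonempty {n : ℤ} {ω : ℤ → PrefixEdge d}
    (hω : ω ∈ (bratteli σ).edgeShift n) : (codedSet σ u v n ω).Nonempty := by
  rw [codedSet_eq]
  exact IsCompact.nonempty_iInter_of_sequence_nonempty_isCompact_isClosed _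
    (fun l => closure_mono (cylinderSet_antitone _ _ (Nat.le_succ l)))
    (fun l => (h.cylinderSet_nonempty n (path_of_mem_edgeShift hω) l).closure)
    isClosed_closure.isCompact fun l => isClosed_closure

/-- Consecutive points of lifts of an orbit are related by the maps of the edges. -/
theorem step_eq_of_familyIter_eq (n : ℤ) {k : ℤ} {e e' : PrefixEdge d} (he : e ∈ edgeSet (σ k))
    (he' : e' ∈ edgeSet (σ (k + 1))) {x x' : Fin d → ℝ}
    (hx : x ∈ interior (edgeBox σ u v k e)) (hx' : x' ∈ interior (edgeBox σ u v (k + 1) e'))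
    (heq : familyIter σ k n (toTorus x) = familyIter σ (k + 1) n (toTorus x')) :
    step σ k e x = x' ∧ e.rng = e'.src := by
  rw [← familyIter_familyMap, ← toTorus_step _ _ e] at heq
  obtain ⟨z, hz⟩ := toTorus_eq_iff.1 ((familyIter_bijective σ (k + 1) n).1 heq)
  exact h.eq_step_of_mem_interior he he' hx hx' hz

/-- `l` does not depend on the path. Hence one estimate gives both the uniqueness of the coded point
and the continuity of the coding. -/
theorem exists_dist_cylinderSet_le (n : ℤ) {ε : ℝ} (hε : 0 < ε) : ∃ l : ℕ,
    ∀ e ∈ (bratteli σ).edgeShift 0, ∀ z ∈ cylinderSet σ u v n e l,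
      ∀ z' ∈ cylinderSet σ u v n e l, dist z z' ≤ ε := by
  obtain ⟨L, hL⟩ := h.exists_norm_sub_le n hε
  -- The window must contain both n − L and n + L.
  refine ⟨n.natAbs + L, fun e he z hz z' hz' => ?_⟩
  set l := n.natAbs + L with hl
  rw [mem_cylinderSet] at hz hz'
  choose! x hx hxz using hz
  choose! x' hx' hxz' using hz'
  have hmem := fun k => mem_edgeSet_of_path he k
  -- Both lifted orbits move by the same affine maps, so the translations cancel in the difference.
  have hstep : ∀ k : ℤ, |k| ≤ l → |k + 1| ≤ l →
      x k - x' k = (incR (σ k)).mulVec (x (k + 1) - x' (k + 1)) := by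
    intro k hk hk1
    have h1 := (h.step_eq_of_familyIter_eq n (hmem k) (hmem (k + 1)) (hx k hk) (hx _ hk1)
      ((hxz k hk).trans (hxz _ hk1).symm)).1
    have h2 := (h.step_eq_of_familyIter_eq n (hmem k) (hmem (k + 1)) (hx' k hk) (hx' _ hk1)
      ((hxz' k hk).trans (hxz' _ hk1).symm)).1
    rw [← h1, ← h2, Matrix.mulVec_sub, incR_mulVec_step, incR_mulVec_step,
      add_sub_add_right_eq_sub]
  have hiter : ∀ (j : ℕ) (k : ℤ), -(l : ℤ) ≤ k → k + j ≤ l →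
      x k - x' k = (iterMat σ k j).mulVec (x (k + j) - x' (k + j)) := by
    intro j
    induction j with
    | zero => intro k _ _; simp [iterMat]
    | succ j ih =>
      intro k hk1 hk2
      rw [hstep k (abs_le.2 (by omega)) (abs_le.2 (by omega)), ih (k + 1) (by omega) (by omega),
        Matrix.mulVec_mulVec, iterMat,
        show k + 1 + (j : ℤ) = k + ((j + 1 : ℕ) : ℤ) by push_cast; ring]
  have hbox : ∀ k : ℤ, |k| ≤ l → x k ∈ rauzyBox σ u v k (e k).src ∧
      x' k ∈ rauzyBox σ u v k (e k).src := fun k hk =>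
    ⟨edgeBox_subset_rauzyBox (hmem k) (interior_subset (hx k hk)),
      edgeBox_subset_rauzyBox (hmem k) (interior_subset (hx' k hk))⟩
  have hlow := hbox (n - L) (abs_le.2 (by omega))
  have hhigh := hbox (n + L) (abs_le.2 (by omega))
  have h1 := hiter L n (by omega) (by omega)
  have h2 := hiter L (n - L) (by omega) (by omega)
  rw [sub_add_cancel, h1] at h2
  have h3 := hL _ _ _ _ _ _ hlow.1 hlow.2 hhigh.1 hhigh.2 h2
  rw [← h1] at h3
  have hn : |n| ≤ (l : ℤ) := abs_le.2 (by omega)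
  rw [← hxz n hn, ← hxz' n hn, familyIter_self, familyIter_self]
  exact (dist_toTorus_le _ _).trans h3

theorem codedSet_subsingleton {n : ℤ} {ω : ℤ → PrefixEdge d}
    (hω : ω ∈ (bratteli σ).edgeShift n) : (codedSet σ u v n ω).Subsingleton := by
  intro z hz z' hz'
  refine eq_of_forall_dist_le fun ε hε => ?_
  obtain ⟨l, hl⟩ := h.exists_dist_cylinderSet_le n hε
  rw [codedSet_eq, mem_iInter] at hz hz'
  have h1 := map_mem_closure₂ continuous_dist (hz l) (hz' l) (u := Iic ε)
    fun a ha b hb => hl _ (path_of_mem_edgeShift hω) a ha b hb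
  rwa [closure_Iic] at h1

theorem exists_codedSet_eq_singleton (n : ℤ) (ω : (bratteli σ).edgeShift n) :
    ∃ z, codedSet σ u v n ω.1 = {z} := by
  obtain ⟨z, hz⟩ := h.codedSet_nonempty ω.2
  exact ⟨z, (h.codedSet_subsingleton ω.2).eq_singleton_of_mem hz⟩

/-- Taking closures can leave the open boxes, but not the compact images of the closed ones. -/
theorem mem_image_edgeBox_of_mem_codedSet {n : ℤ} {ω : ℤ → PrefixEdge d}
    {z : UnitAddTorus (Fin d)} (hz : z ∈ codedSet σ u v n ω) (k : ℤ) :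
    z ∈ familyIter σ k n '' (toTorus '' edgeBox σ u v k (ω (k - n))) := by
  rw [codedSet_eq, mem_iInter] at hz
  have hcl : IsClosed (familyIter σ k n '' (toTorus '' edgeBox σ u v k (ω (k - n)))) :=
    (((h.isCompact_edgeBox k _).image continuous_toTorus).image
      (continuous_familyIter σ k n)).isClosed
  refine closure_minimal (fun w hw => ?_) hcl (hz k.natAbs)
  obtain ⟨x, hx, rfl⟩ := mem_cylinderSet.1 hw k (by rw [Int.abs_eq_natAbs])
  exact ⟨_, ⟨x, interior_subset hx, rfl⟩, rfl⟩

theorem exists_mem_interior_of_notMem_boundarySet {n k : ℤ} {e : PrefixEdge d}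
    (he : e ∈ edgeSet (σ k)) {z : UnitAddTorus (Fin d)} (hz : z ∉ boundarySet σ u v n)
    (hze : z ∈ familyIter σ k n '' (toTorus '' edgeBox σ u v k e)) :
    ∃ x ∈ interior (edgeBox σ u v k e), familyIter σ k n (toTorus x) = z := by
  obtain ⟨_, ⟨x, hx, rfl⟩, rfl⟩ := hze
  refine ⟨x, ?_, rfl⟩
  by_contra hint
  refine hz (mem_iUnion.2 ⟨k, mem_biUnion he ⟨_, ⟨x, ?_, rfl⟩, rfl⟩⟩)
  rw [(h.isCompact_edgeBox k e).isClosed.frontier_eq]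
  exact ⟨hx, hint⟩

/-- A point outside of the boundary set lies in the box of at most one edge of each level. -/
theorem edge_unique {n k : ℤ} {e e' : PrefixEdge d} (he : e ∈ edgeSet (σ k))
    (he' : e' ∈ edgeSet (σ k)) {z : UnitAddTorus (Fin d)} (hz : z ∉ boundarySet σ u v n)
    (hze : z ∈ familyIter σ k n '' (toTorus '' edgeBox σ u v k e))
    (hze' : z ∈ familyIter σ k n '' (toTorus '' edgeBox σ u v k e')) : e = e' := by
  obtain ⟨x, hx, hxz⟩ := h.exists_mem_interior_of_notMem_boundarySet he hz hze
  obtain ⟨x', hx', hxz'⟩ := h.exists_mem_interior_of_notMem_boundarySet he' hz hze'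
  obtain ⟨y, rfl⟩ := toTorus_eq_iff.1
    ((familyIter_bijective σ k n).1 (hxz.trans hxz'.symm))
  exact h.eq_of_mem_interior_edgeBox he he' hx hx'

theorem exists_edge_of_notMem_boundarySet {n : ℤ} {z : UnitAddTorus (Fin d)}
    (hz : z ∉ boundarySet σ u v n) (k : ℤ) : ∃ e ∈ edgeSet (σ k),
      ∃ x ∈ interior (edgeBox σ u v k e), familyIter σ k n (toTorus x) = z := by
  obtain ⟨w, rfl⟩ := (familyIter_bijective σ k n).2 z
  obtain ⟨x, rfl⟩ := toTorus_surjective w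
  obtain ⟨e, he, y, x', hx', rfl⟩ := h.exists_mem_edgeBox k x
  refine ⟨e, he, h.exists_mem_interior_of_notMem_boundarySet he hz ?_⟩
  rw [toTorus_eq_iff.2 ⟨y, rfl⟩]
  exact ⟨_, ⟨x', hx', rfl⟩, rfl⟩

/-- Off the boundary set, every level provides an edge whose open box contains the orbit point. The
Markov property makes consecutive edges composable. -/
theorem exists_mem_codedSet {n : ℤ} {z : UnitAddTorus (Fin d)}
    (hz : z ∉ boundarySet σ u v n) :
    ∃ ω : (bratteli σ).edgeShift n, z ∈ codedSet σ u v n ω.1 := by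
  choose e he x hx hxz using h.exists_edge_of_notMem_boundarySet hz
  have hpath : e ∈ (bratteli σ).edgeShift 0 := by
    rw [BratteliDiagram.mem_edgeShift_zero]
    exact fun k => ⟨he k, (h.step_eq_of_familyIter_eq n (he k) (he (k + 1)) (hx k) (hx (k + 1))
      ((hxz k).trans (hxz (k + 1)).symm)).2⟩
  have hω : (fun k => e (k + n)) ∈ (bratteli σ).edgeShift n := by
    rw [BratteliDiagram.edgeShift_eq_image]
    exact ⟨e, hpath, rfl⟩
  refine ⟨⟨_, hω⟩, ?_⟩
  rw [codedSet_eq, mem_iInter]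
  intro l
  refine subset_closure (mem_cylinderSet.2 fun k _ => ?_)
  simp only [sub_add_cancel]
  exact ⟨x k, hx k, hxz k⟩

omit h in
theorem image_familyMap_codedSet_subset (n : ℤ) (ω : (bratteli σ).edgeShift n) :
    familyMap σ n '' codedSet σ u v n ω.1 ⊆
      codedSet σ u v (n + 1) ((bratteli σ).shift n ω).1 := by
  rintro _ ⟨z, hz, rfl⟩
  rw [codedSet_eq, mem_iInter] at hz ⊢
  intro l
  refine map_mem_closure (continuous_familyMap σ n) (hz l) fun w hw => ?_
  rw [mem_cylinderSet] at hw ⊢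
  intro k hk
  obtain ⟨x, hx, rfl⟩ := hw k hk
  refine ⟨x, ?_, familyIter_succ σ k n _⟩
  simp only [BratteliDiagram.shift]
  rwa [show k - (n + 1) + 1 = k - n by ring]

omit h in
theorem familyMap_notMem_boundarySet {n : ℤ} {z : UnitAddTorus (Fin d)}
    (hz : z ∉ boundarySet σ u v n) : familyMap σ n z ∉ boundarySet σ u v (n + 1) := by
  intro hf
  apply hz
  simp only [boundarySet, mem_iUnion] at hf ⊢
  obtain ⟨k, e, he, w, hw, hwz⟩ := hf
  rw [familyIter_succ] at hwz
  exact ⟨k, e, he, w, hw, (familyMap_bijective σ n).1 hwz⟩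

/-- The coding maps are continuous. -/
theorem continuous_coding {n : ℤ} {ψ : (bratteli σ).edgeShift n → UnitAddTorus (Fin d)}
    (hψ : ∀ ω, codedSet σ u v n ω.1 = {ψ ω}) : Continuous ψ := by
  rw [continuous_iff_continuousAt]
  intro ω
  rw [ContinuousAt, Metric.tendsto_nhds]
  intro ε hε
  obtain ⟨l, hl⟩ := h.exists_dist_cylinderSet_le n (half_pos hε)
  have hmem : ∀ ω, ψ ω ∈ closure (cylinderSet σ u v n (fun k => ω.1 (k - n)) l) := by
    intro ω
    have h1 : ψ ω ∈ codedSet σ u v n ω.1 := by rw [hψ ω]; rfl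
    rw [codedSet_eq, mem_iInter] at h1
    exact h1 l
  have hfin : {k : ℤ | |k| ≤ l}.Finite :=
    (Set.finite_Icc (-(l : ℤ)) l).subset fun k hk => abs_le.1 hk
  have hev : ∀ᶠ ω' in nhds ω, ∀ k ∈ {k : ℤ | |k| ≤ l}, ω'.1 (k - n) = ω.1 (k - n) := by
    rw [Filter.eventually_all_finite hfin]
    intro k _
    have hc : Continuous fun ω' : (bratteli σ).edgeShift n => ω'.1 (k - n) :=
      (continuous_apply _).comp continuous_subtype_val
    exact hc.continuousAt.eventually (IsOpen.mem_nhds (isOpen_discrete {ω.1 (k - n)}) rfl)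
  filter_upwards [hev] with ω' hω'
  -- Paths agreeing in the window have the same cylinder, whose diameter is at most ε/2.
  have heq : cylinderSet σ u v n (fun k => ω'.1 (k - n)) l =
      cylinderSet σ u v n (fun k => ω.1 (k - n)) l := by
    refine iInter₂_congr fun k hk => ?_
    simp only [hω' k hk]
  have h2 := map_mem_closure₂ continuous_dist (heq ▸ hmem ω') (hmem ω) (u := Iic (ε / 2))
    fun a ha b hb => hl _ (path_of_mem_edgeShift ω.2) a ha b hb
  rw [closure_Iic] at h2
  exact lt_of_le_of_lt h2 (half_lt_self hε)

/-- A path is determined by its coded point outside of the boundary set. -/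
theorem eq_of_mem_codedSet {n : ℤ} {ω ω' : (bratteli σ).edgeShift n} {z : UnitAddTorus (Fin d)}
    (hz : z ∉ boundarySet σ u v n) (hω : z ∈ codedSet σ u v n ω.1)
    (hω' : z ∈ codedSet σ u v n ω'.1) : ω = ω' := by
  refine Subtype.ext (funext fun k => ?_)
  have h1 := h.mem_image_edgeBox_of_mem_codedSet hω (k + n)
  have h2 := h.mem_image_edgeBox_of_mem_codedSet hω' (k + n)
  rw [add_sub_cancel_right] at h1 h2
  exact h.edge_unique (ω.2 k).1 (ω'.2 k).1 hz h1 h2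

end CodingHypotheses

end CodedSets

/-! ### Null sets and invariance of Lebesgue measure on the torus -/

section TorusMeasure

variable {d : ℕ}

/-- The quotient map preserves measure on a unit cube, and the preimage of the image is a countable
union of integer translates of the null set. -/
theorem volume_toTorus_image_eq_zero {A : Set (Fin d → ℝ)} (hA : IsCompact A)
    (h0 : volume A = 0) : volume (toTorus '' A) = 0 := by
  have hcl : IsClosed (toTorus '' A) := (hA.image continuous_toTorus).isClosed
  have hmp : MeasurePreserving (toTorus : (Fin d → ℝ) → UnitAddTorus (Fin d))
      (Measure.pi fun _ => volume.restrict (Ioc (0 : ℝ) (0 + 1))) volume :=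
    measurePreserving_pi _ _ fun _ => UnitAddCircle.measurePreserving_mk 0
  rw [← hmp.measure_preimage hcl.measurableSet.nullMeasurableSet, ← Measure.restrict_pi_pi]
  refine le_antisymm ((Measure.restrict_apply_le _ _).trans ?_) zero_le
  change volume (toTorus ⁻¹' (toTorus '' A)) ≤ 0
  rw [nonpos_iff_eq_zero]
  have h3 : toTorus ⁻¹' (toTorus '' A) ⊆ ⋃ z : Fin d → ℤ, (fun x => intVec z + x) '' A := by
    rintro x ⟨y, hy, hyx⟩
    obtain ⟨z, rfl⟩ := toTorus_eq_iff.1 hyx.symm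
    exact mem_iUnion.2 ⟨z, y, hy, rfl⟩
  refine measure_mono_null h3 (measure_iUnion_null fun z => ?_)
  rw [image_add_left, measure_preimage_add, h0]

/-- A continuous surjective endomorphism of a compact group preserves Haar measure of fixed total
mass. -/
theorem measurePreserving_torusAct {M : Matrix (Fin d) (Fin d) ℤ} (hM : IsUnit M.det) :
    MeasurePreserving (torusAct M) := by
  let f : UnitAddTorus (Fin d) →+ UnitAddTorus (Fin d) :=
    { toFun := torusAct M
      map_zero' := by ext i; simp [torusAct]
      map_add' := fun x y => by ext i; simp [torusAct, Finset.sum_add_distrib] }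
  exact AddMonoidHom.measurePreserving (f := f) (continuous_torusAct M)
    (torusAct_bijective hM).2 rfl

variable (σ : ℤ → UnimodularSubstitution d)

theorem measurePreserving_familyMap (n : ℤ) : MeasurePreserving (familyMap σ n) :=
  measurePreserving_torusAct (by
    rw [Matrix.isUnit_nonsing_inv_det_iff]; exact isUnit_det_incidence _)

theorem measurePreserving_familyIter (k n : ℤ) : MeasurePreserving (familyIter σ k n) := by
  unfold familyIter
  split_ifs
  · exact measurePreserving_torusAct (isUnit_det_blockMatrix σ n k)
  · exact measurePreserving_torusAct (by
      rw [Matrix.isUnit_nonsing_inv_det_iff]; exact isUnit_det_blockMatrix _ _ _)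

theorem volume_familyIter_image_eq_zero (k n : ℤ) {A : Set (UnitAddTorus (Fin d))}
    (hA : IsCompact A) (h0 : volume A = 0) : volume (familyIter σ k n '' A) = 0 := by
  rw [← (measurePreserving_familyIter σ k n).measure_preimage
    (hA.image (continuous_familyIter σ k n)).measurableSet.nullMeasurableSet,
    preimage_image_eq _ (familyIter_bijective σ k n).1, h0]

end TorusMeasure

/-! ### Measurability and measure on disjoint unions -/

section SigmaMeasure

variable {ι : Type*} {X : ι → Type*} [∀ i, MeasurableSpace (X i)] {Y : Type*} [MeasurableSpace Y]

theorem measurableSet_sigma_iff {s : Set (Σ i, X i)} :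
    MeasurableSet s ↔ ∀ i, MeasurableSet (Sigma.mk i ⁻¹' s) :=
  MeasurableSpace.measurableSet_iInf

theorem measurable_sigma_mk (i : ι) : Measurable (Sigma.mk i : X i → Σ i, X i) :=
  fun _ hs => measurableSet_sigma_iff.1 hs i

theorem measurable_of_sigma {f : (Σ i, X i) → Y} (h : ∀ i, Measurable fun x => f ⟨i, x⟩) :
    Measurable f :=
  fun _ hs => measurableSet_sigma_iff.2 fun i => h i hs

theorem torusMeasure_apply {d : ℕ} {s : Set (TorusSpace d)} (hs : MeasurableSet s) :
    torusMeasure d s = ∑' n : ℤ, volume ((fun x => (⟨n, x⟩ : TorusSpace d)) ⁻¹' s) := by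
  rw [torusMeasure, Measure.sum_apply _ hs]
  exact tsum_congr fun n => Measure.map_apply (measurable_sigma_mk n) hs

theorem measurePreserving_totalFamilyMap {d : ℕ} (σ : ℤ → UnimodularSubstitution d) :
    MeasurePreserving (totalFamilyMap σ) (torusMeasure d) (torusMeasure d) := by
  have hmeas : Measurable (totalFamilyMap σ) := measurable_of_sigma fun n =>
    (measurable_sigma_mk (n + 1)).comp (continuous_familyMap σ n).measurable
  refine ⟨hmeas, Measure.ext fun s hs => ?_⟩
  rw [Measure.map_apply hmeas hs, torusMeasure_apply (hmeas hs), torusMeasure_apply hs]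
  refine Eq.trans (tsum_congr fun n => ?_) ((Equiv.addRight (1 : ℤ)).tsum_eq
    fun n => volume ((fun x => (⟨n, x⟩ : TorusSpace d)) ⁻¹' s))
  exact (measurePreserving_familyMap σ n).measure_preimage
    (measurableSet_sigma_iff.1 hs (n + 1)).nullMeasurableSet

end SigmaMeasure

/-! ### The measurable inverse and the conjugacy -/

section Coding

variable {d : ℕ} {σ : ℤ → UnimodularSubstitution d} {u v : Fin d → ℝ}

instance : Countable (PrefixEdge d) :=
  Function.Injective.countable (f := fun e : PrefixEdge d => (e.src, e.word, e.rng))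
    fun e e' h => by
      simp only [Prod.mk.injEq] at h
      exact PrefixEdge.ext h.1 h.2.1 h.2.2

instance : OpensMeasurableSpace (PrefixEdge d) := ⟨fun _ _ => trivial⟩

namespace CodingHypotheses

variable (h : CodingHypotheses σ u v)

include h

theorem isCompact_frontier_edgeBox (n : ℤ) (e : PrefixEdge d) :
    IsCompact (frontier (edgeBox σ u v n e)) :=
  (h.isCompact_edgeBox n e).of_isClosed_subset isClosed_frontier
    (h.isCompact_edgeBox n e).isClosed.frontier_subset

theorem measurableSet_boundarySet (n : ℤ) : MeasurableSet (boundarySet σ u v n) :=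
  MeasurableSet.iUnion fun k => (edgeSet_finite (σ k)).measurableSet_biUnion fun e _ =>
    (((h.isCompact_frontier_edgeBox k e).image continuous_toTorus).image
      (continuous_familyIter σ k n)).measurableSet

theorem volume_boundarySet (n : ℤ) : volume (boundarySet σ u v n) = 0 := by
  refine measure_iUnion_null fun k =>
    (measure_biUnion_null_iff (edgeSet_finite (σ k)).countable).2 fun e he => ?_
  exact volume_familyIter_image_eq_zero σ k n
    ((h.isCompact_frontier_edgeBox k e).image continuous_toTorus)
    (volume_toTorus_image_eq_zero (h.isCompact_frontier_edgeBox k e)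
      (h.volume_frontier_edgeBox he))

theorem measurableSet_totalBoundarySet : MeasurableSet (totalBoundarySet σ u v) :=
  measurableSet_sigma_iff.2 fun n => h.measurableSet_boundarySet n

theorem torusMeasure_totalBoundarySet : torusMeasure d (totalBoundarySet σ u v) = 0 := by
  rw [torusMeasure_apply h.measurableSet_totalBoundarySet]
  exact ENNReal.tsum_eq_zero.2 fun n => h.volume_boundarySet n

theorem edgeShift_nonempty (n : ℤ) : Nonempty ((bratteli σ).edgeShift n) := by
  obtain ⟨z, hz⟩ : ∃ z, z ∉ boundarySet σ u v n := by
    by_contra hcon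
    push Not at hcon
    have h1 : volume (univ : Set (UnitAddTorus (Fin d))) = 0 := by
      rw [← eq_univ_of_forall hcon]; exact h.volume_boundarySet n
    exact isOpen_univ.measure_ne_zero volume univ_nonempty h1
  exact ⟨(h.exists_mem_codedSet hz).choose⟩

/-- There is a measurable map that assigns to each point outside of the boundary set the path
that codes it. -/
theorem exists_measurable_path (n : ℤ) :
    ∃ g : UnitAddTorus (Fin d) → (bratteli σ).edgeShift n, Measurable g ∧
      ∀ z ∉ boundarySet σ u v n, z ∈ codedSet σ u v n (g z).1 := by
  classical
  -- A fixed default path on the boundary set makes the inverse constant there, so a null set of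
  -- arbitrary choices cannot spoil measurability.
  obtain ⟨ω₀⟩ := h.edgeShift_nonempty n
  have hex : ∀ z, ∃ ω : (bratteli σ).edgeShift n,
      (z ∈ boundarySet σ u v n → ω = ω₀) ∧
        (z ∉ boundarySet σ u v n → z ∈ codedSet σ u v n ω.1) := by
    intro z
    by_cases hz : z ∈ boundarySet σ u v n
    · exact ⟨ω₀, fun _ => rfl, fun hz' => absurd hz hz'⟩
    · obtain ⟨ω, hω⟩ := h.exists_mem_codedSet hz
      exact ⟨ω, fun hz' => absurd hz' hz, fun _ => hω⟩
  choose g hg0 hg using hex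
  refine ⟨g, Measurable.subtype_mk (measurable_pi_iff.2 fun k => ?_), hg⟩
  refine measurable_to_countable' fun e => ?_
  by_cases he : e ∈ edgeSet (σ (k + n))
  -- Off the boundary set, the edge at position k is `e` exactly when the point lies in the compact
  -- image of its box.
  · have hset : (fun z => (g z).1 k) ⁻¹' {e} =
        (boundarySet σ u v n ∩ {_z | ω₀.1 k = e}) ∪ ((boundarySet σ u v n)ᶜ ∩
          familyIter σ (k + n) n '' (toTorus '' edgeBox σ u v (k + n) e)) := by
      ext z
      by_cases hz : z ∈ boundarySet σ u v n
      · simp [hz, hg0 z hz]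
      · have h1 := h.mem_image_edgeBox_of_mem_codedSet (hg z hz) (k + n)
        rw [add_sub_cancel_right] at h1
        simp only [mem_preimage, mem_singleton_iff, mem_union, mem_inter_iff, hz, false_and,
          false_or, mem_compl_iff, not_false_eq_true, true_and]
        exact ⟨fun heq => heq ▸ h1, fun hze => h.edge_unique ((g z).2 k).1 he hz h1 hze⟩
    rw [hset]
    exact ((h.measurableSet_boundarySet n).inter (MeasurableSet.const _)).union
      ((h.measurableSet_boundarySet n).compl.inter
        (((h.isCompact_edgeBox (k + n) e).image continuous_toTorus).image
          (continuous_familyIter σ (k + n) n)).measurableSet)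
  · have hset : (fun z => (g z).1 k) ⁻¹' {e} = ∅ := by
      refine eq_empty_of_forall_notMem fun z hz => he ?_
      rw [← (hz : (g z).1 k = e)]
      exact ((g z).2 k).1
    rw [hset]
    exact MeasurableSet.empty

variable {ψ : ∀ n : ℤ, (bratteli σ).edgeShift n → UnitAddTorus (Fin d)}

theorem injOn_totalCoding (hψ : ∀ n ω, codedSet σ u v n ω.1 = {ψ n ω}) :
    InjOn (totalCoding σ ψ) (totalCoding σ ψ ⁻¹' totalBoundarySet σ u v)ᶜ := by
  rintro ⟨n, ω⟩ hω ⟨n', ω'⟩ _ heq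
  obtain ⟨rfl, h2⟩ := Sigma.mk.inj_iff.1 heq
  have h3 : ψ n ω = ψ n ω' := eq_of_heq h2
  have h4 : ω = ω' := h.eq_of_mem_codedSet (z := ψ n ω) hω (by rw [hψ]; rfl)
    (by rw [hψ, h3]; rfl)
  rw [h4]

/-- A family of coding maps that is compatible with the dynamics is a measurable conjugacy. -/
theorem exists_isMeasurableConjugacy (hψ : ∀ n ω, codedSet σ u v n ω.1 = {ψ n ω})
    (hcomm : ∀ n ω, ψ (n + 1) ((bratteli σ).shift n ω) = familyMap σ n (ψ n ω)) :
    ∃ μ : Measure (bratteli σ).EdgeShiftSpace,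
      IsMeasurableConjugacy (bratteli σ).totalShift (totalFamilyMap σ) μ (torusMeasure d)
        (totalCoding σ ψ) := by
  choose g hgm hg using h.exists_measurable_path
  set φ := totalCoding σ ψ with hφ
  set S := (bratteli σ).totalShift with hS
  set T := totalFamilyMap σ with hT
  set D := totalBoundarySet σ u v with hD
  let G : TorusSpace d → (bratteli σ).EdgeShiftSpace := fun y => ⟨y.1, g y.1 y.2⟩
  have hGm : Measurable G := measurable_of_sigma fun n => (measurable_sigma_mk n).comp (hgm n)
  have hφm : Measurable φ := measurable_of_sigma fun n =>
    (measurable_sigma_mk n).comp (h.continuous_coding (hψ n)).measurable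
  have hshift : ∀ n, Measurable ((bratteli σ).shift n) := fun n => by
    have h1 : Measurable fun (ω : (bratteli σ).edgeShift n) (k : ℤ) => ω.1 (k + 1) :=
      measurable_pi_iff.2 fun k => (measurable_pi_apply (k + 1)).comp measurable_subtype_coe
    exact h1.subtype_mk
  have hSm : Measurable S := measurable_of_sigma fun n =>
    (measurable_sigma_mk (n + 1)).comp (hshift n)
  have hTp : MeasurePreserving T (torusMeasure d) (torusMeasure d) :=
    measurePreserving_totalFamilyMap σ
  have hcommT : ∀ x, φ (S x) = T (φ x) := fun x => congrArg (Sigma.mk _) (hcomm x.1 x.2)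
  have hφG : ∀ y ∉ D, φ (G y) = y := by
    rintro ⟨n, z⟩ hz
    have h1 := hg n z hz
    rw [hψ] at h1
    exact congrArg (Sigma.mk n) (mem_singleton_iff.1 h1).symm
  have hTD : ∀ y ∉ D, T y ∉ D := fun y hy => familyMap_notMem_boundarySet hy
  have hinj := h.injOn_totalCoding hψ
  have hGφ : ∀ x, φ x ∉ D → G (φ x) = x := fun x hx =>
    hinj (show φ (G (φ x)) ∉ D by rwa [hφG _ hx]) hx (hφG _ hx)
  have hDae : ∀ᵐ y ∂torusMeasure d, y ∉ D :=
    measure_eq_zero_iff_ae_notMem.1 h.torusMeasure_totalBoundarySet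
  have hφp : MeasurePreserving φ ((torusMeasure d).map G) (torusMeasure d) := by
    refine ⟨hφm, ?_⟩
    rw [Measure.map_map hφm hGm]
    have h1 : φ ∘ G =ᵐ[torusMeasure d] id := by
      filter_upwards [hDae] with y hy using hφG y hy
    rw [Measure.map_congr h1, Measure.map_id]
  -- The measure on paths is λ transported by the inverse coding. Its image under the coding is λ
  -- again because `φ ∘ G` is the identity off D.
  refine ⟨(torusMeasure d).map G, ⟨⟨hSm, ?_⟩, hTp, hφp, Filter.Eventually.of_forall hcommT,
    G, hGm, ?_, ?_⟩⟩
  · rw [Measure.map_map hSm hGm]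
    -- Both sides are codes of `T y`, and off the invariant null set D the code is unique.
    have h1 : S ∘ G =ᵐ[torusMeasure d] G ∘ T := by
      filter_upwards [hDae] with y hy
      have h2 : φ (S (G y)) = T y := by rw [hcommT, hφG y hy]
      have h3 := hTD y hy
      rw [← h2] at h3
      change S (G y) = G (T y)
      rw [← hGφ _ h3, h2]
    rw [Measure.map_congr h1, ← Measure.map_map hGm hTp.measurable, hTp.map_eq]
  · filter_upwards [hφp.quasiMeasurePreserving.ae hDae] with x hx using hGφ x hx
  · filter_upwards [hDae] with y hy using hφG y hy

end CodingHypotheses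

end Coding

end SAdic

/-! ### The coding theorem -/

theorem mainTheorem5 {d : ℕ} (hd : 2 ≤ d) (σ : ℤ → SAdic.UnimodularSubstitution d)
    (u v : Fin d → ℝ)
    (hprim : SAdic.IsTwoSidedPrimitive σ)
    (htile : SAdic.TilingCondition σ u v)
    (hcompact : ∀ n : ℤ, IsCompact (SAdic.rauzyFractal σ u v n)) :
    ∃ ψ : ∀ n : ℤ, (SAdic.bratteli σ).edgeShift n → UnitAddTorus (Fin d),
      (∀ n ω, SAdic.codedSet σ u v n ω.1 = {ψ n ω}) ∧
      (∀ n, Continuous (ψ n)) ∧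
      (∀ n, Set.InjOn (ψ n) (ψ n ⁻¹' SAdic.boundarySet σ u v n)ᶜ) ∧
      (∀ n ω, ψ (n + 1) ((SAdic.bratteli σ).shift n ω) = SAdic.familyMap σ n (ψ n ω)) ∧
      (∃ μ : MeasureTheory.Measure (SAdic.bratteli σ).EdgeShiftSpace,
        SAdic.IsMeasurableConjugacy (SAdic.bratteli σ).totalShift (SAdic.totalFamilyMap σ)
          μ (SAdic.torusMeasure d) (SAdic.totalCoding σ ψ)) ∧
      Set.InjOn (SAdic.totalCoding σ ψ)
        (SAdic.totalCoding σ ψ ⁻¹' SAdic.totalBoundarySet σ u v)ᶜ ∧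
      SAdic.torusMeasure d (SAdic.totalBoundarySet σ u v) = 0 := by
  have h : SAdic.CodingHypotheses σ u v := ⟨hd, hprim, htile, hcompact⟩
  choose ψ hψ using h.exists_codedSet_eq_singleton
  have hcomm : ∀ n ω, ψ (n + 1) ((SAdic.bratteli σ).shift n ω) =
      SAdic.familyMap σ n (ψ n ω) := by
    intro n ω
    have h1 := SAdic.CodingHypotheses.image_familyMap_codedSet_subset (u := u) (v := v) n ω
    rw [hψ, hψ, Set.image_singleton, Set.singleton_subset_singleton] at h1
    exact h1.symm
  refine ⟨ψ, hψ, fun n => h.continuous_coding (hψ n), fun n ω hω ω' _ heq => ?_, hcomm,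
    h.exists_isMeasurableConjugacy hψ hcomm, h.injOn_totalCoding hψ,
    h.torusMeasure_totalBoundarySet⟩
  refine h.eq_of_mem_codedSet (z := ψ n ω) hω ?_ ?_
  · rw [hψ]; rfl
  · rw [hψ, heq]; rfl
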